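/- Let $d\ge 2$, $0<\lambda\le\Lambda<\infty$, $\gamma\in(0,1]$, $\mathsf M\in(0,\infty)$, and let $V:\mathbb R\to\mathbb R$ be even and of class $C^2$ with $\lambda\le V''\le\Lambda$ and $|V''(t)-V''(s)|\le \mathsf M|t-s|^\gamma$ for all $s,t\in\mathbb R$. For $L\in\mathbb N$, $L\ge1$, let $Q_L=[-L,L]^d\cap\mathbb Z^d$, let $Q_L^\circ$ be the set of $x\in Q_L$ all of whose nearest neighbours lie in $Q_L$, and $\partial Q_L=Q_L\setminus Q_L^\circ$. Let $\mathcal E(Q_L)$ be the set of nearest-neighbour pairs $e=(x,y)\in Q_L\times Q_L$ with $x_i\le y_i$ for all $i$ and not both $x,y\in\partial Q_L$ (each undirected edge occurs once), and for a function $f$ on $Q_L$ put $\nabla f(e)=f(y)-f(x)$. Let $|Q_L|:=2L(2L-1)^{d-1}$ be the number of edges of $\mathcal E(Q_L)$ in each coordinate direction, and let $\ell_p(x)=p\cdot x$. Let $\Omega_0(Q_L)\cong\mathbb R^{Q_L^\circ}$ be the space of functions $\phi:Q_L\to\mathbb R$ with $\phi=0$ on $\partial Q_L$, with Lebesgue measure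 $d\phi$. For $\xi\in\mathbb R^d$ set $$Z_{L,\xi}=\int_{\Omega_0(Q_L)}\exp\Big(-\sum_{e\in\mathcal E(Q_L)}V(\nabla\phi(e)-\nabla\ell_\xi(e))\Big)d\phi,\qquad d\mu_{L,\xi}=\frac1{Z_{L,\xi}}\exp\Big(-\sum_{e\in\mathcal E(Q_L)}V(\nabla\phi(e)-\nabla\ell_\xi(e))\Big)d\phi,$$ $$\sigma_L(\xi)=-\frac1{|Q_L|}\log\frac{Z_{L,\xi}}{Z_{L,0}},\qquad \mathbf a(e,\phi)=V''(\nabla\phi(e)-\nabla\ell_\xi(e)).$$ Write $\langle\cdot\rangle$ for the expectation under $\mu_{L,\xi}$ and $\partial_y$ for the partial derivative with respect to $\phi(y)$. Let $H^1(\mu_{L,\xi})$ be the completion of $C^2_c(\Omega_0(Q_L))$ for the norm with square $\langle F^2\rangle+\sum_{y\in Q_L^\circ}\langle(\partial_yF)^2\rangle$, and let $H^1_0(Q_L,\mu_{L,\xi})$ be the set of $w:Q_L\times\Omega_0(Q_L)\to\mathbb R$ with $w(x,\cdot)\in H^1(\mu_{L,\xi})$ for all $x\in Q_L$ and $w=0$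 on $\partial Q_L\times\Omega_0(Q_L)$. For $p\in\mathbb R^d$ define the Dirichlet Helffer–Sjöstrand energy with affine boundary data $$\nu_L(Q_L,0,p)=\inf_{v\in\ell_p+H^1_0(Q_L,\mu_{L,\xi})}\frac1{2|Q_L|}\Big(\sum_{y\in Q_L^\circ}\sum_{x\in Q_L^\circ}\big\langle(\partial_yv(x,\cdot))^2\big\rangle+\sum_{e\in\mathcal E(Q_L)}\big\langle\mathbf a(e,\cdot)(\nabla v(e,\cdot))^2\big\rangle\Big).$$ Then $\sigma_L$ is twice differentiable on $\mathbb R^d$ and, for every $\xi\in\mathbb R^d$, the map $p\mapsto\nu_L(Q_L,0,p)$ is a quadratic form, i.e. there is a (unique) symmetric matrix $\overline{\mathbf a}_{\mu_{L,\xi}}(Q_L)\in\mathbb R^{d\times d}$ with $\nu_L(Q_L,0,p)=\tfrac12\,p\cdot\overline{\mathbf a}_{\mu_{L,\xi}}(Q_L)\,p$ for all $p\in\mathbb R^d$; and $$D^2\sigma_L(\xi)=\overline{\mathbf a}_{\mu_{L,\xi}}(Q_L).$$ -/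

import Mathlib

noncomputable section

namespace GradPhi

open MeasureTheory Filter Topology
open scoped Classical

/-- The lattice `ℤ^d`; its pointwise order is the order `≪` used to orient the edges. -/
abbrev Site (d : ℕ) : Type := Fin d → ℤ

/-- Tilts and slopes, i.e. vectors of `ℝ^d` with the Euclidean norm. -/
abbrev Slope (d : ℕ) : Type := EuclideanSpace ℝ (Fin d)

/-- Standing assumptions on the interaction potential: `V` is even, of class `C^2`, with
`lam ≤ V'' ≤ Lam`, and `V''` is Hölder continuous with exponent `γ` and constant `M`. -/
structure IsPotential (γ lam Lam M : ℝ) (V : ℝ → ℝ) : Prop where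
  gamma_pos : 0 < γ
  gamma_le : γ ≤ 1
  lam_pos : 0 < lam
  lam_le : lam ≤ Lam
  M_pos : 0 < M
  contDiff : ContDiff ℝ 2 V
  holder : ∀ t s : ℝ, |deriv (deriv V) t - deriv (deriv V) s| ≤ M * |t - s| ^ γ
  lower : ∀ t : ℝ, lam ≤ deriv (deriv V) t
  upper : ∀ t : ℝ, deriv (deriv V) t ≤ Lam
  even : ∀ t : ℝ, V (-t) = V t

section Lattice

variable {d : ℕ}

/-- Nearest neighbours: `|x - y| = 1` in the Euclidean norm. -/
def Adj (x y : Site d) : Prop := ∑ i, (x i - y i) ^ 2 = 1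

/-- The interior `U°`: points of `U` all of whose neighbours lie in `U`. -/
def inner (U : Finset (Site d)) : Finset (Site d) :=
  U.filter fun x => ∀ y, Adj x y → y ∈ U

/-- The boundary `∂U = U \ U°`. -/
def bdry (U : Finset (Site d)) : Finset (Site d) := U \ inner U

/-- The interior edges `𝓔(U)`: pairs `(x, y)` of neighbours in `U` with `x ≪ y`, not both in `∂U`.
Every undirected edge is listed once. -/
def edges (U : Finset (Site d)) : Finset (Site d × Site d) :=
  (U ×ˢ U).filter fun e => ¬ (e.1 ∈ bdry U ∧ e.2 ∈ bdry U) ∧ Adj e.1 e.2 ∧ e.1 ≤ e.2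

/-- `∇f(e) = f(y) - f(x)` for `e = (x, y)`. -/
def grad (f : Site d → ℝ) (e : Site d × Site d) : ℝ := f e.2 - f e.1

/-- The affine function `ℓ_p(x) = p · x`. -/
def affine (p : Slope d) (x : Site d) : ℝ := ∑ i, p i * (x i : ℝ)

/-- The space `Ω₀(U)` of configurations vanishing on `∂U`, identified with `ℝ^{U°}`
(and so carrying Lebesgue measure). -/
abbrev Conf (U : Finset (Site d)) : Type := inner U → ℝ

/-- The function on the lattice given by a configuration: extension by zero outside `U°`. -/
def extend {U : Finset (Site d)} (φ : Conf U) (x : Site d) : ℝ :=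
  if h : x ∈ inner U then φ ⟨x, h⟩ else 0

end Lattice

section Gibbs

variable {d : ℕ} (V : ℝ → ℝ) (U : Finset (Site d)) (ξ : Slope d)

/-- The Hamiltonian with tilt `ξ`: the sum of `V(∇φ(e) - ∇ℓ_ξ(e))` over `e ∈ 𝓔(U)`. -/
def hamiltonian (φ : Conf U) : ℝ :=
  ∑ e ∈ edges U, V (grad (extend φ) e - grad (affine ξ) e)

/-- The partition function `Z_{U,ξ}`. -/
def partitionFn : ℝ := ∫ φ : Conf U, Real.exp (-hamiltonian V U ξ φ)

/-- The Gibbs measure on `Ω₀(U)`. -/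
def gibbs : Measure (Conf U) :=
  (volume : Measure (Conf U)).withDensity fun φ =>
    ENNReal.ofReal (Real.exp (-hamiltonian V U ξ φ) / partitionFn V U ξ)

/-- The coefficient `a(e,φ) = V''(∇φ(e) - ∇ℓ_ξ(e))`. -/
def coeff (e : Site d × Site d) (φ : Conf U) : ℝ :=
  deriv (deriv V) (grad (extend φ) e - grad (affine ξ) e)

end Gibbs

section Sobolev

variable {d : ℕ} {U : Finset (Site d)}

/-- The derivative `∂_y ψ(φ)` in the direction of the basis element `ω_y`. -/
def partialD (y : inner U) (ψ : Conf U → ℝ) (φ : Conf U) : ℝ :=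
  fderiv ℝ ψ φ (Pi.single y 1)

/-- `F ∈ H¹(μ)` with derivatives `∂_y F = DF y`. Here `H¹(μ)` is the completion of
`C²_c(Ω₀(U))` for the norm with square `⟨F²⟩ + ∑_y ⟨(∂_y F)²⟩`. Concretely, `(F, DF)` is the limit
in `L²(μ)` of the pairs `(ψ_n, ∂ψ_n)` for some sequence `ψ_n` in `C²_c(Ω₀(U))`. -/
def HasH1Grad (μ : Measure (Conf U)) (F : Conf U → ℝ) (DF : inner U → Conf U → ℝ) : Prop :=
  MemLp F 2 μ ∧ (∀ y, MemLp (DF y) 2 μ) ∧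
    ∃ ψ : ℕ → Conf U → ℝ,
      (∀ n, ContDiff ℝ 2 (ψ n) ∧ HasCompactSupport (ψ n)) ∧
      Tendsto (fun n => eLpNorm (ψ n - F) 2 μ) atTop (𝓝 0) ∧
      ∀ y, Tendsto (fun n => eLpNorm (partialD y (ψ n) - DF y) 2 μ) atTop (𝓝 0)

variable (U) in
/-- A function `w(x,φ)` on `U × Ω₀(U)`, recorded together with its derivatives `∂_y w(x,φ)`,
`y ∈ U°`. (Only the values at `x ∈ U` matter.) -/
structure Field where
  val : Site d → Conf U → ℝ
  der : Site d → inner U → Conf U → ℝ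

/-- `w ∈ H¹₀(U,μ)`: `w(x,·) ∈ H¹(μ)` for every `x ∈ U`, and `w = 0` on `∂U × Ω₀(U)`. -/
def MemH10 (μ : Measure (Conf U)) (w : Field U) : Prop :=
  (∀ x ∈ U, HasH1Grad μ (w.val x) (w.der x)) ∧ ∀ x ∈ bdry U, ∀ φ, w.val x φ = 0

/-- The function `ℓ_p + w`; since `ℓ_p` does not depend on `φ`, the derivatives `∂_y` are those
of `w`. -/
def affineAdd (p : Slope d) (w : Field U) : Field U where
  val x φ := affine p x + w.val x φ
  der := w.der

end Sobolev

section Cube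

variable {d : ℕ}

/-- The cube `Q_L = [-L, L]^d ∩ ℤ^d`. -/
def cube (d L : ℕ) : Finset (Site d) := Finset.Icc (fun _ => -(L : ℤ)) (fun _ => (L : ℤ))

/-- The volume `|Q_L|`: the number of edges of `𝓔(Q_L)` in each coordinate direction, which is
`n (n - 1)^{d - 1}` for a cube of side length `n`; here `n = 2 L`. -/
def cubeVol (d L : ℕ) : ℝ := (2 * (L : ℝ)) * (2 * (L : ℝ) - 1) ^ (d - 1)

/-- The finite-volume surface tension `σ_L(ξ) = - |Q_L|⁻¹ log (Z_{L,ξ} / Z_{L,0})`. -/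
def surfaceTension (V : ℝ → ℝ) (L : ℕ) (ξ : Slope d) : ℝ :=
  -(1 / cubeVol d L) *
    Real.log (partitionFn V (cube d L) ξ / partitionFn V (cube d L) 0)

/-- The bilinear form `B_{Q_L, μ_{L,ξ}}[v, w]` of the Helffer–Sjöstrand operator. -/
def formB (V : ℝ → ℝ) (L : ℕ) (ξ : Slope d) (v w : Field (cube d L)) : ℝ :=
  (1 / cubeVol d L) *
      ∑ y : inner (cube d L), ∑ x ∈ inner (cube d L),
        ∫ φ, v.der x y φ * w.der x y φ ∂(gibbs V (cube d L) ξ) +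
    (1 / cubeVol d L) *
      ∑ e ∈ edges (cube d L),
        ∫ φ, grad (fun x => v.val x φ) e * coeff V (cube d L) ξ e φ * grad (fun x => w.val x φ) e
          ∂(gibbs V (cube d L) ξ)

/-- `ν_L(Q_L, 0, p)`: the infimum of `½ B[v, v]` over `v ∈ ℓ_p + H¹₀(Q_L, μ_{L,ξ})`. -/
def nu (V : ℝ → ℝ) (L : ℕ) (ξ : Slope d) (p : Slope d) : ℝ :=
  sInf {E : ℝ | ∃ w : Field (cube d L), MemH10 (gibbs V (cube d L) ξ) w ∧
    E = 1 / 2 * formB V L ξ (affineAdd p w) (affineAdd p w)}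

/-- The standard basis vector `e_i`. -/
def stdVec (i : Fin d) : Slope d := EuclideanSpace.single i 1

/-- The matrix `ā_{μ_{L,ξ}}(Q_L)` of the quadratic form `p ↦ ν_L(Q_L, 0, p) = ½ p · ā p`,
whose entries are read off by polarization. -/
def aBar (V : ℝ → ℝ) (L : ℕ) (ξ : Slope d) : Matrix (Fin d) (Fin d) ℝ :=
  Matrix.of fun i j =>
    nu V L ξ (stdVec i + stdVec j) - nu V L ξ (stdVec i) - nu V L ξ (stdVec j)

/-- The Hessian matrix `(∂_i ∂_j f(ξ))`. -/
def hessian (f : Slope d → ℝ) (ξ : Slope d) : Matrix (Fin d) (Fin d) ℝ :=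
  Matrix.of fun i j => fderiv ℝ (fun η => fderiv ℝ f η (stdVec j)) ξ (stdVec i)

end Cube

end GradPhi

end

/-!
Write `H` for the Hamiltonian with tilt `ξ`, `μ` for the Gibbs measure `Z⁻¹ e^{-H} dφ`, and `∇^*` for the
adjoint of the gradient `∇ = (∂_x)` in `L²(e^{-H} dφ)`. For `p ∈ ℝ^d` let
`G = ∑ e, V' (∇φ(e) - ∇ℓ_ξ(e)) ∇ℓ_p(e)`, which is minus the derivative of `H` as `ξ` moves in the direction
`p`. Both sides of the claimed identity, evaluated on the diagonal at `p`, equal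

  `|Q_L|⁻¹ (⟨∑ e, a(e) (∇ℓ_p(e))²⟩ - Var G)`,

where `⟨·⟩` and `Var` refer to `μ`; up to the factor `|Q_L|⁻¹` this number is `hsMin`.

*The surface tension.* Differentiating `log Z` twice under the integral sign gives the mean of the second
derivative of `H` minus the variance of the first one (`fderiv_fderiv_neg_log_tiltZ_self`). The domination is
Gaussian: evenness and uniform convexity of `V` give quadratic growth, and the discrete gradient controls the
norm of a configuration with zero boundary values (`eq_zero_of_forall_gradL_eq_zero`, `exists_coercive`).

*The variational problem.* For a smooth compactly supported field `w`, integration by parts gives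
`∫ (∇^* w)² dμ = ∑ ∫ (∂_j w_i ∂_i w_j + w_i w_j ∂_i ∂_j H) dμ` (`integral_gradAdj_sq`). Inserting this and
`⟨G ∇^* w⟩ = ⟨∇G · w⟩` into the energy of `ℓ_p + w` completes the square (`hsEnergy_eq`): the energy is

  `hsMin + ‖∇^* w + G - ⟨G⟩‖² + ½ ∑ ‖∂_j w_i - ∂_i w_j‖²`.

Hence `hsMin` is a lower bound, first for smooth fields and then on all of `H¹₀` (`hsMin_le_hsEnergy`). It is
approached by gradients `w = -∇u` provided that `∇^* ∇ u` can be brought close to `G - ⟨G⟩` in `L²(μ)` with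
`u` smooth and compactly supported (`exists_hsEnergy_lt`, `exists_gradAdj_approx`), so that no solution theory
for the equation `∇^* ∇ u = G - ⟨G⟩` is needed.

*Density.* It remains to see that a function `g ∈ L²(μ)` orthogonal to all `∇^* ∇ u` is constant
(`ae_eq_const_of_orthogonal_generator`). Here `h = g e^{-H}` solves `Δh + div (h ∇H) = 0` weakly. Since `H` is
only `C²`, the equation is mollified, and a Caccioppoli estimate for the mollified equation (`caccioppoli`)
bounds the gradient of `e^H h` against test functions by a commutator error and a term carrying the gradient
of a cutoff; the former vanishes with the mollification parameter and the latter as the cutoff is spread out.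

The infimum is therefore the value at `p` of half a symmetric bilinear form, which gives the matrix statement
by polarization.
-/

set_option linter.unusedSectionVars false

noncomputable section

namespace GradPhi

open MeasureTheory Filter Topology
open scoped ContDiff ENNReal Pointwise

/-! ### Partial derivatives and integration by parts -/

section Calculus

variable {ι : Type*} [Fintype ι] [DecidableEq ι]

/-- The partial derivative `∂_i f` on `ℝ^ι`. For `ι = U°` this is `partialD`. -/
def pd (i : ι) (f : (ι → ℝ) → ℝ) (φ : ι → ℝ) : ℝ := fderiv ℝ f φ (Pi.single i 1)

lemma contDiff_pd {m n : WithTop ℕ∞} {f : (ι → ℝ) → ℝ} (hf : ContDiff ℝ n f) (h : m + 1 ≤ n)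
    (i : ι) : ContDiff ℝ m (pd i f) :=
  (hf.fderiv_right h).clm_apply contDiff_const

lemma hasCompactSupport_pd {f : (ι → ℝ) → ℝ} (hf : HasCompactSupport f) (i : ι) :
    HasCompactSupport (pd i f) :=
  hf.fderiv_apply ℝ _

lemma continuous_pd {f : (ι → ℝ) → ℝ} (hf : ContDiff ℝ 1 f) (i : ι) : Continuous (pd i f) :=
  (contDiff_pd (m := 0) hf (by simp) i).continuous

lemma pd_mul {f g : (ι → ℝ) → ℝ} (hf : Differentiable ℝ f) (hg : Differentiable ℝ g) (i : ι)
    (φ : ι → ℝ) : pd i (fun ψ => f ψ * g ψ) φ = f φ * pd i g φ + pd i f φ * g φ := by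
  simp only [pd]
  rw [fderiv_fun_mul (hf φ) (hg φ)]
  simp [mul_comm]

lemma pd_add {f g : (ι → ℝ) → ℝ} (hf : Differentiable ℝ f) (hg : Differentiable ℝ g) (i : ι) :
    pd i (fun ψ => f ψ + g ψ) = fun φ => pd i f φ + pd i g φ := by
  funext φ
  simp only [pd]
  rw [fderiv_fun_add (hf φ) (hg φ)]
  simp

lemma pd_const_mul (c : ℝ) {f : (ι → ℝ) → ℝ} (hf : Differentiable ℝ f) (i : ι) :
    pd i (fun ψ => c * f ψ) = fun φ => c * pd i f φ := by
  funext φ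
  simp only [pd]
  rw [fderiv_const_mul (hf φ)]
  simp

lemma pd_sub {f g : (ι → ℝ) → ℝ} (hf : Differentiable ℝ f) (hg : Differentiable ℝ g) (i : ι)
    (φ : ι → ℝ) : pd i (fun ψ => f ψ - g ψ) φ = pd i f φ - pd i g φ := by
  simp only [pd]
  rw [fderiv_fun_sub (hf φ) (hg φ)]
  simp

lemma pd_neg (f : (ι → ℝ) → ℝ) (i : ι) (φ : ι → ℝ) : pd i (fun ψ => -f ψ) φ = -pd i f φ := by
  simp only [pd]
  rw [fderiv_fun_neg]
  simp

lemma pd_sum {κ : Type*} (s : Finset κ) {f : κ → (ι → ℝ) → ℝ}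
    (hf : ∀ k ∈ s, Differentiable ℝ (f k)) (i : ι) (φ : ι → ℝ) :
    pd i (fun ψ => ∑ k ∈ s, f k ψ) φ = ∑ k ∈ s, pd i (f k) φ := by
  simp only [pd]
  rw [fderiv_fun_sum fun k hk => hf k hk φ]
  simp

lemma pd_exp {f : (ι → ℝ) → ℝ} (hf : Differentiable ℝ f) (i : ι) (φ : ι → ℝ) :
    pd i (fun ψ => Real.exp (f ψ)) φ = Real.exp (f φ) * pd i f φ := by
  simp only [pd]
  rw [fderiv_exp (hf φ)]
  simp

/-- Symmetry of second derivatives. -/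
lemma pd_comm {f : (ι → ℝ) → ℝ} (hf : ContDiff ℝ 2 f) (i j : ι) : pd i (pd j f) = pd j (pd i f) := by
  have hd : Differentiable ℝ (fderiv ℝ f) :=
    (hf.fderiv_right (m := 1) (by norm_num)).differentiable (by simp)
  have key : ∀ (i j : ι) (φ : ι → ℝ),
      pd i (pd j f) φ = fderiv ℝ (fderiv ℝ f) φ (Pi.single i 1) (Pi.single j 1) := by
    intro i j φ
    change fderiv ℝ (fun ψ => fderiv ℝ f ψ (Pi.single j 1)) φ (Pi.single i 1) = _
    rw [fderiv_clm_apply (hd φ) (differentiableAt_const _)]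
    simp
  funext φ
  rw [key, key]
  exact (hf.contDiffAt.isSymmSndFDerivAt (by simp)) _ _

lemma fderiv_eq_zero_of_pd {f : (ι → ℝ) → ℝ} {φ : ι → ℝ} (h : ∀ i, pd i f φ = 0) :
    fderiv ℝ f φ = 0 := by
  ext v
  rw [pi_eq_sum_univ' v]
  simp only [map_sum, map_smul]
  refine (Finset.sum_eq_zero fun i _ => ?_).trans (by simp)
  exact (congrArg (v i * ·) (h i)).trans (mul_zero _)

lemma integral_pd_eq_zero {f : (ι → ℝ) → ℝ} (hf : ContDiff ℝ 1 f) (hc : HasCompactSupport f)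
    (i : ι) : ∫ φ, pd i f φ = 0 := by
  have h1 : Integrable (pd i f) :=
    (continuous_pd hf i).integrable_of_hasCompactSupport (hasCompactSupport_pd hc i)
  have h := integral_mul_fderiv_eq_neg_fderiv_mul_of_integrable (μ := (volume : Measure (ι → ℝ)))
    (f := fun _ => (1 : ℝ)) (g := f) (v := Pi.single i 1) (by simp) (by simpa using! h1)
    (by simpa using hf.continuous.integrable_of_hasCompactSupport hc)
    (fun x _ => differentiableAt_const _) (fun x _ => hf.differentiable (by simp) x)
  simpa [pd] using h

/-- Integration by parts against Lebesgue measure. -/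
lemma integral_mul_pd {f g : (ι → ℝ) → ℝ} (hf : ContDiff ℝ 1 f) (hg : ContDiff ℝ 1 g)
    (hc : HasCompactSupport g) (i : ι) : ∫ φ, f φ * pd i g φ = -∫ φ, pd i f φ * g φ := by
  have h := integral_pd_eq_zero (hf.mul hg) (hc.mul_left (f := f)) i
  have e : ∀ φ, pd i (fun ψ => f ψ * g ψ) φ = f φ * pd i g φ + pd i f φ * g φ := fun φ =>
    pd_mul (hf.differentiable (by simp)) (hg.differentiable (by simp)) i φ
  simp only [e] at h
  rw [integral_add] at h
  · linarith
  · exact (hf.continuous.mul (continuous_pd hg i)).integrable_of_hasCompactSupport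
      ((hasCompactSupport_pd hc i).mul_left)
  · exact ((continuous_pd hf i).mul hg.continuous).integrable_of_hasCompactSupport hc.mul_left

variable (H : (ι → ℝ) → ℝ)

/-- The adjoint of `∂_i` in `L²(e^{-H} dφ)`: `∂_i^* f = f ∂_i H - ∂_i f`. -/
def pdAdj (i : ι) (f : (ι → ℝ) → ℝ) (φ : ι → ℝ) : ℝ := f φ * pd i H φ - pd i f φ

/-- The adjoint of the gradient in `L²(e^{-H} dφ)`: `∇^* w = ∑ i, ∂_i^* w_i`. -/
def gradAdj (w : ι → (ι → ℝ) → ℝ) (φ : ι → ℝ) : ℝ := ∑ i, pdAdj H i (w i) φ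

variable {H}

lemma contDiff_pdAdj (hH : ContDiff ℝ 2 H) {f : (ι → ℝ) → ℝ} (hf : ContDiff ℝ 2 f) (i : ι) :
    ContDiff ℝ 1 (pdAdj H i f) :=
  ((hf.of_le (by norm_num)).mul (contDiff_pd hH (by norm_num) i)).sub
    (contDiff_pd hf (by norm_num) i)

lemma continuous_pdAdj (hH : ContDiff ℝ 1 H) {f : (ι → ℝ) → ℝ} (hf : ContDiff ℝ 1 f) (i : ι) :
    Continuous (pdAdj H i f) :=
  (hf.continuous.mul (continuous_pd hH i)).sub (continuous_pd hf i)

lemma hasCompactSupport_pdAdj {f : (ι → ℝ) → ℝ} (hf : HasCompactSupport f) (i : ι) :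
    HasCompactSupport (pdAdj H i f) :=
  (hf.mul_right (f' := pd i H)).sub (hasCompactSupport_pd hf i)

lemma hasCompactSupport_finset_sum {κ X : Type*} [TopologicalSpace X] (s : Finset κ)
    {f : κ → X → ℝ} (h : ∀ k ∈ s, HasCompactSupport (f k)) :
    HasCompactSupport (fun x => ∑ k ∈ s, f k x) := by
  classical
  induction s using Finset.induction_on with
  | empty => simpa using! (HasCompactSupport.zero : HasCompactSupport (0 : X → ℝ))
  | insert a s ha ih =>
    simp only [Finset.sum_insert ha]
    exact (h a (by simp)).add (ih fun k hk => h k (by simp [hk]))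

lemma contDiff_gradAdj (hH : ContDiff ℝ 2 H) {w : ι → (ι → ℝ) → ℝ} (hw : ∀ i, ContDiff ℝ 2 (w i)) :
    ContDiff ℝ 1 (gradAdj H w) :=
  ContDiff.sum fun i _ => contDiff_pdAdj hH (hw i) i

lemma hasCompactSupport_gradAdj {w : ι → (ι → ℝ) → ℝ} (hw : ∀ i, HasCompactSupport (w i)) :
    HasCompactSupport (gradAdj H w) :=
  hasCompactSupport_finset_sum _ fun i _ => hasCompactSupport_pdAdj (hw i) i

lemma continuous_exp_neg (hH : ContDiff ℝ 1 H) : Continuous fun φ => Real.exp (-H φ) :=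
  Real.continuous_exp.comp hH.continuous.neg

/-- Integration by parts against `e^{-H} dφ`. -/
lemma integral_pd_mul_weight (hH : ContDiff ℝ 1 H) {f g : (ι → ℝ) → ℝ} (hf : ContDiff ℝ 1 f)
    (hg : ContDiff ℝ 1 g) (hc : HasCompactSupport f) (i : ι) :
    ∫ φ, f φ * pd i g φ * Real.exp (-H φ) = ∫ φ, pdAdj H i f φ * g φ * Real.exp (-H φ) := by
  have hρ : ContDiff ℝ 1 fun φ => Real.exp (-H φ) := hH.neg.exp
  have h1 := integral_mul_pd hg (hf.mul hρ) (hc.mul_right (f' := fun φ => Real.exp (-H φ))) i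
  have e : ∀ φ, pd i (fun ψ => f ψ * Real.exp (-H ψ)) φ = -(pdAdj H i f φ * Real.exp (-H φ)) := by
    intro φ
    rw [pd_mul (hf.differentiable (by simp)) (hρ.differentiable (by simp)),
      pd_exp (hH.neg.differentiable (by simp)), pd_neg, pdAdj]
    ring
  simp only [e] at h1
  have e1 : ∀ φ, f φ * pd i g φ * Real.exp (-H φ) = pd i g φ * (f φ * Real.exp (-H φ)) :=
    fun φ => by ring
  have e2 : ∀ φ, pdAdj H i f φ * g φ * Real.exp (-H φ) =
      -(g φ * -(pdAdj H i f φ * Real.exp (-H φ))) := fun φ => by ring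
  simp only [e1, e2, integral_neg, h1, neg_neg]

lemma pd_pdAdj (hH : ContDiff ℝ 2 H) {f : (ι → ℝ) → ℝ} (hf : ContDiff ℝ 2 f) (i j : ι) (φ : ι → ℝ) :
    pd i (pdAdj H j f) φ = pdAdj H j (pd i f) φ + f φ * pd i (pd j H) φ := by
  have h1 : Differentiable ℝ (pd j H) := (contDiff_pd (m := 1) hH (by norm_num) j).differentiable (by simp)
  have h2 : Differentiable ℝ (pd j f) := (contDiff_pd (m := 1) hf (by norm_num) j).differentiable (by simp)
  have h3 : Differentiable ℝ f := hf.differentiable (by simp)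
  change pd i (fun ψ => f ψ * pd j H ψ - pd j f ψ) φ = _
  rw [pd_sub (h3.fun_mul h1) h2, pd_mul h3 h1, pd_comm hf i j, pdAdj]
  ring

lemma integral_gradAdj_mul (hH : ContDiff ℝ 1 H) {w : ι → (ι → ℝ) → ℝ} {g : (ι → ℝ) → ℝ}
    (hw : ∀ i, ContDiff ℝ 1 (w i)) (hc : ∀ i, HasCompactSupport (w i)) (hg : ContDiff ℝ 1 g) :
    ∫ φ, gradAdj H w φ * g φ * Real.exp (-H φ) =
      ∑ i, ∫ φ, w i φ * pd i g φ * Real.exp (-H φ) := by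
  simp only [integral_pd_mul_weight hH (hw _) hg (hc _), gradAdj, Finset.sum_mul]
  refine integral_finsetSum _ fun i _ => ?_
  refine Continuous.integrable_of_hasCompactSupport ?_ ?_
  · exact ((continuous_pdAdj hH (hw i) i).mul hg.continuous).mul (continuous_exp_neg hH)
  · exact ((hasCompactSupport_pdAdj (hc i) i).mul_right).mul_right

/-- The commutation identity behind the Helffer–Sjöstrand representation:
`∫ (∇^* w)² e^{-H} = ∑ i j, ∫ (∂_j w_i ∂_i w_j + w_i w_j ∂_i ∂_j H) e^{-H}`. -/
lemma integral_gradAdj_sq (hH : ContDiff ℝ 2 H) {w : ι → (ι → ℝ) → ℝ}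
    (hw : ∀ i, ContDiff ℝ 2 (w i)) (hc : ∀ i, HasCompactSupport (w i)) :
    ∫ φ, gradAdj H w φ ^ 2 * Real.exp (-H φ) =
      ∫ φ, (∑ i, ∑ j, (pd j (w i) φ * pd i (w j) φ + w i φ * w j φ * pd i (pd j H) φ)) *
        Real.exp (-H φ) := by
  have hH1 : ContDiff ℝ 1 H := hH.of_le (by norm_num)
  have hw1 : ∀ i, ContDiff ℝ 1 (w i) := fun i => (hw i).of_le (by norm_num)
  have hρ := continuous_exp_neg hH1
  have hpw : ∀ i j, ContDiff ℝ 1 (pd i (w j)) := fun i j => contDiff_pd (hw j) (by norm_num) i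
  have hint1 : ∀ i j, Integrable fun φ => w i φ * pdAdj H j (pd i (w j)) φ * Real.exp (-H φ) :=
    fun i j => Continuous.integrable_of_hasCompactSupport
      (((hw i).continuous.mul (continuous_pdAdj hH1 (hpw i j) j)).mul hρ)
      ((hc i).mul_right).mul_right
  have hint2 : ∀ i j, Integrable fun φ => w i φ * w j φ * pd i (pd j H) φ * Real.exp (-H φ) :=
    fun i j => Continuous.integrable_of_hasCompactSupport
      ((((hw i).continuous.mul (hw j).continuous).mul
        (continuous_pd (contDiff_pd hH (by norm_num) j) i)).mul hρ)
      (((hc i).mul_right).mul_right).mul_right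
  have hint3 : ∀ i j, Integrable fun φ => pd j (w i) φ * pd i (w j) φ * Real.exp (-H φ) :=
    fun i j => Continuous.integrable_of_hasCompactSupport
      (((hpw j i).continuous.mul (hpw i j).continuous).mul hρ)
      ((hasCompactSupport_pd (hc i) j).mul_right).mul_right
  have e0 : ∀ φ, gradAdj H w φ ^ 2 * Real.exp (-H φ) =
      gradAdj H w φ * gradAdj H w φ * Real.exp (-H φ) := fun φ => by ring
  simp only [e0]
  rw [integral_gradAdj_mul hH1 hw1 hc (contDiff_gradAdj hH hw)]
  have e1 : ∀ i φ, w i φ * pd i (gradAdj H w) φ * Real.exp (-H φ) =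
      ∑ j, (w i φ * pdAdj H j (pd i (w j)) φ * Real.exp (-H φ) +
        w i φ * w j φ * pd i (pd j H) φ * Real.exp (-H φ)) := by
    intro i φ
    have : pd i (gradAdj H w) φ = ∑ j, pd i (pdAdj H j (w j)) φ :=
      pd_sum _ (fun k _ => (contDiff_pdAdj hH (hw k) k).differentiable (by simp)) i φ
    rw [this, Finset.mul_sum, Finset.sum_mul]
    refine Finset.sum_congr rfl fun j _ => ?_
    rw [pd_pdAdj hH (hw j)]
    ring
  have e2 : ∀ i j, ∫ φ, w i φ * pdAdj H j (pd i (w j)) φ * Real.exp (-H φ) =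
      ∫ φ, pd j (w i) φ * pd i (w j) φ * Real.exp (-H φ) := by
    intro i j
    have := integral_pd_mul_weight hH1 (hpw i j) (hw1 i) (hasCompactSupport_pd (hc j) i) j
    calc _ = ∫ φ, pdAdj H j (pd i (w j)) φ * w i φ * Real.exp (-H φ) := by
          congr 1; funext φ; ring
      _ = _ := this.symm
      _ = _ := by congr 1; funext φ; ring
  have e3 : ∀ φ, (∑ i, ∑ j, (pd j (w i) φ * pd i (w j) φ + w i φ * w j φ * pd i (pd j H) φ)) *
        Real.exp (-H φ) = ∑ i, ∑ j, (pd j (w i) φ * pd i (w j) φ * Real.exp (-H φ) +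
          w i φ * w j φ * pd i (pd j H) φ * Real.exp (-H φ)) := by
    intro φ
    simp only [Finset.sum_mul, add_mul]
  simp only [e1, e3]
  have hA : ∀ i j, Integrable fun φ => pd j (w i) φ * pd i (w j) φ * Real.exp (-H φ) +
      w i φ * w j φ * pd i (pd j H) φ * Real.exp (-H φ) := fun i j => (hint3 i j).add (hint2 i j)
  have hB : ∀ i j, Integrable fun φ => w i φ * pdAdj H j (pd i (w j)) φ * Real.exp (-H φ) +
      w i φ * w j φ * pd i (pd j H) φ * Real.exp (-H φ) := fun i j => (hint1 i j).add (hint2 i j)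
  rw [integral_finsetSum _ fun i _ => integrable_finsetSum _ fun j _ => hA i j]
  refine Finset.sum_congr rfl fun i _ => ?_
  rw [integral_finsetSum _ fun j _ => hB i j, integral_finsetSum _ fun j _ => hA i j]
  refine Finset.sum_congr rfl fun j _ => ?_
  rw [integral_add (hint1 i j) (hint2 i j), integral_add (hint3 i j) (hint2 i j), e2]

end Calculus

/-! ### Convergence in `L²` and mollification -/

section L2

variable {α : Type*} [MeasurableSpace α] {μ : Measure α}

lemma integral_mul_eq_inner {f g : α → ℝ} (hf : MemLp f 2 μ) (hg : MemLp g 2 μ) :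
    ∫ x, f x * g x ∂μ = Inner.inner ℝ (hf.toLp f) (hg.toLp g) := by
  rw [L2.inner_def]
  refine integral_congr_ae ?_
  filter_upwards [hf.coeFn_toLp, hg.coeFn_toLp] with x h1 h2
  rw [h1, h2]
  simp [mul_comm]

lemma tendsto_integral_mul_of_tendsto_eLpNorm {β : Type*} {l : Filter β} {f g : β → α → ℝ}
    {f₀ g₀ : α → ℝ} (hf : ∀ n, MemLp (f n) 2 μ) (hf₀ : MemLp f₀ 2 μ) (hg : ∀ n, MemLp (g n) 2 μ)
    (hg₀ : MemLp g₀ 2 μ) (hfl : Tendsto (fun n => eLpNorm (f n - f₀) 2 μ) l (𝓝 0))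
    (hgl : Tendsto (fun n => eLpNorm (g n - g₀) 2 μ) l (𝓝 0)) :
    Tendsto (fun n => ∫ x, f n x * g n x ∂μ) l (𝓝 (∫ x, f₀ x * g₀ x ∂μ)) := by
  simp only [integral_mul_eq_inner (hf _) (hg _), integral_mul_eq_inner hf₀ hg₀]
  exact ((Lp.tendsto_Lp_iff_tendsto_eLpNorm'' f hf f₀ hf₀).2 hfl).inner
    ((Lp.tendsto_Lp_iff_tendsto_eLpNorm'' g hg g₀ hg₀).2 hgl)

/-- The Cauchy–Schwarz inequality for integrals. -/
lemma sq_integral_mul_le {f g : α → ℝ} (hf : MemLp f 2 μ) (hg : MemLp g 2 μ) :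
    (∫ x, f x * g x ∂μ) ^ 2 ≤ (∫ x, f x ^ 2 ∂μ) * ∫ x, g x ^ 2 ∂μ := by
  have h := real_inner_mul_inner_self_le (hf.toLp f) (hg.toLp g)
  simp only [← integral_mul_eq_inner] at h
  simpa [pow_two] using h

lemma memLp_bounded_mul {m f : α → ℝ} {C : ℝ} (hm : AEStronglyMeasurable m μ)
    (hC : ∀ x, |m x| ≤ C) (hf : MemLp f 2 μ) : MemLp (fun x => m x * f x) 2 μ :=
  hf.of_le_mul (c := C) (hm.mul hf.1) (ae_of_all _ fun x => by
    rw [norm_mul]; exact mul_le_mul_of_nonneg_right (hC x) (norm_nonneg _))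

lemma tendsto_eLpNorm_bounded_mul {β : Type*} {l : Filter β} {m : α → ℝ} {C : ℝ}
    (hC : ∀ x, |m x| ≤ C) {f : β → α → ℝ} {f₀ : α → ℝ}
    (hfl : Tendsto (fun n => eLpNorm (f n - f₀) 2 μ) l (𝓝 0)) :
    Tendsto (fun n => eLpNorm ((fun x => m x * f n x) - fun x => m x * f₀ x) 2 μ) l (𝓝 0) := by
  have h2 : Tendsto (fun n => ENNReal.ofReal C * eLpNorm (f n - f₀) 2 μ) l (𝓝 0) := by
    simpa using ENNReal.Tendsto.const_mul hfl (Or.inr ENNReal.ofReal_ne_top)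
  refine tendsto_of_tendsto_of_tendsto_of_le_of_le tendsto_const_nhds h2 (fun _ => zero_le)
    fun n => ?_
  refine eLpNorm_le_mul_eLpNorm_of_ae_le_mul (ae_of_all _ fun x => ?_) 2
  simp only [Pi.sub_apply, ← mul_sub, norm_mul]
  exact mul_le_mul_of_nonneg_right (hC x) (norm_nonneg _)

/-- Products of `L²`-convergent sequences converge in `L¹`, also after multiplication by a bounded
function. -/
lemma tendsto_integral_bounded_mul_mul {β : Type*} {l : Filter β} {m : α → ℝ} {C : ℝ}
    (hm : AEStronglyMeasurable m μ) (hC : ∀ x, |m x| ≤ C) {f g : β → α → ℝ}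
    {f₀ g₀ : α → ℝ} (hf : ∀ n, MemLp (f n) 2 μ) (hf₀ : MemLp f₀ 2 μ) (hg : ∀ n, MemLp (g n) 2 μ)
    (hg₀ : MemLp g₀ 2 μ) (hfl : Tendsto (fun n => eLpNorm (f n - f₀) 2 μ) l (𝓝 0))
    (hgl : Tendsto (fun n => eLpNorm (g n - g₀) 2 μ) l (𝓝 0)) :
    Tendsto (fun n => ∫ x, m x * (f n x * g n x) ∂μ) l (𝓝 (∫ x, m x * (f₀ x * g₀ x) ∂μ)) := by
  simp only [← mul_assoc]
  exact tendsto_integral_mul_of_tendsto_eLpNorm (fun n => memLp_bounded_mul hm hC (hf n))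
    (memLp_bounded_mul hm hC hf₀) hg hg₀ (tendsto_eLpNorm_bounded_mul hC hfl) hgl

/-- Jensen's inequality for the square and a probability density `w`. -/
lemma sq_lintegral_mul_le {w k : α → ℝ≥0∞} (hw : AEMeasurable w μ) (hk : AEMeasurable k μ)
    (h1 : ∫⁻ x, w x ∂μ = 1) : (∫⁻ x, w x * k x ∂μ) ^ (2 : ℝ) ≤ ∫⁻ x, w x * k x ^ (2 : ℝ) ∂μ := by
  have hs : ∀ a : ℝ≥0∞, (a ^ (1 / 2 : ℝ)) ^ (2 : ℝ) = a := fun a => by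
    rw [← ENNReal.rpow_mul]; norm_num
  have hs' : ∀ a : ℝ≥0∞, a ^ (1 / 2 : ℝ) * a ^ (1 / 2 : ℝ) = a := fun a => by
    rw [← ENNReal.rpow_add_of_nonneg _ _ (by norm_num) (by norm_num)]; norm_num
  have h := ENNReal.lintegral_mul_le_Lp_mul_Lq μ Real.HolderConjugate.two_two
    (f := fun x => w x ^ (1 / 2 : ℝ)) (g := fun x => w x ^ (1 / 2 : ℝ) * k x)
    (hw.pow_const _) ((hw.pow_const _).mul hk)
  simp only [Pi.mul_apply, ← mul_assoc, hs', hs, h1,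
    ENNReal.mul_rpow_of_nonneg _ _ (zero_le_two : (0 : ℝ) ≤ 2), ENNReal.one_rpow, one_mul] at h
  calc _ ≤ ((∫⁻ x, w x * k x ^ (2 : ℝ) ∂μ) ^ (1 / 2 : ℝ)) ^ (2 : ℝ) :=
        ENNReal.rpow_le_rpow h (by norm_num)
    _ = _ := hs _

end L2

section Mollify

variable {E : Type*} [NormedAddCommGroup E] [NormedSpace ℝ E] [FiniteDimensional ℝ E]
  [MeasurableSpace E] [BorelSpace E] {μ : Measure E} [μ.IsAddHaarMeasure]

/-- Continuity of translations in `L²`. -/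
lemma tendsto_eLpNorm_translate_sub {f : E → ℝ} (hf : MemLp f 2 μ) :
    Tendsto (fun t => eLpNorm (fun x => f (x - t) - f x) 2 μ) (𝓝 0) (𝓝 0) := by
  let g : E → C(E, E) := fun t => ⟨fun x => x - t, by fun_prop⟩
  have hg : Continuous g := ContinuousMap.continuous_of_continuous_uncurry _
    (by change Continuous fun p : E × E => p.2 - p.1; fun_prop)
  have hgm : ∀ t, MeasurePreserving (g t) μ μ := fun t => measurePreserving_sub_right μ t
  have h := (continuous_const (y := hf.toLp f)).compMeasurePreservingLp hg hgm
    ENNReal.ofNat_ne_top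
  have h0 := (h.tendsto 0)
  rw [tendsto_iff_edist_tendsto_0] at h0
  refine h0.congr fun t => ?_
  rw [Lp.toLp_compMeasurePreserving hf, Lp.toLp_compMeasurePreserving hf, Lp.edist_toLp_toLp]
  congr 1
  funext x
  simp [g]

/-- The mollification `φ ⋆ f` of a function by a normalized bump function. -/
def mollify (μ : Measure E) (φ : ContDiffBump (0 : E)) (f : E → ℝ) : E → ℝ :=
  convolution (φ.normed μ) f (ContinuousLinearMap.lsmul ℝ ℝ) μ

lemma eLpNorm_mollify_sub_le (φ : ContDiffBump (0 : E)) {f : E → ℝ} (hf : MemLp f 2 μ) {ε : ℝ≥0∞}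
    (hε : ∀ t ∈ Metric.ball (0 : E) φ.rOut, eLpNorm (fun x => f (x - t) - f x) 2 μ ≤ ε) :
    eLpNorm (mollify μ φ f - f) 2 μ ≤ ε := by
  have hfl : LocallyIntegrable f μ := hf.locallyIntegrable (by norm_num)
  have hw : Measurable fun t => ‖φ.normed μ t‖ₑ := φ.continuous_normed.enorm.measurable
  have hw1 : ∫⁻ t, ‖φ.normed μ t‖ₑ ∂μ = 1 := by
    have := ofReal_integral_norm_eq_lintegral_enorm (φ.integrable_normed (μ := μ))
    rw [← this]
    simp_rw [Real.norm_of_nonneg (φ.nonneg_normed _)]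
    simp [φ.integral_normed]
  have hsub : ∀ x, AEStronglyMeasurable (fun t => f (x - t)) μ := fun x =>
    hf.1.comp_quasiMeasurePreserving (quasiMeasurePreserving_sub_left μ x)
  have hpt : ∀ x, ‖(mollify μ φ f - f) x‖ₑ ^ (2 : ℝ) ≤
      ∫⁻ t, ‖φ.normed μ t‖ₑ * ‖f (x - t) - f x‖ₑ ^ (2 : ℝ) ∂μ := by
    intro x
    have hi : Integrable (fun t => φ.normed μ t * f (x - t)) μ :=
      HasCompactSupport.convolutionExists_left (ContinuousLinearMap.lsmul ℝ ℝ)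
        φ.hasCompactSupport_normed φ.continuous_normed hfl x
    have e : (mollify μ φ f - f) x = ∫ t, φ.normed μ t * (f (x - t) - f x) ∂μ := by
      simp only [mul_sub]
      rw [integral_sub hi (φ.integrable_normed.mul_const _), integral_mul_const, φ.integral_normed]
      simp [mollify, convolution_def]
    rw [e]
    refine (ENNReal.rpow_le_rpow (enorm_integral_le_lintegral_enorm _) (by norm_num)).trans ?_
    simp only [enorm_mul]
    exact sq_lintegral_mul_le hw.aemeasurable ((hsub x).sub aestronglyMeasurable_const).enorm hw1
  have h2 : ∀ g : E → ℝ, eLpNorm g 2 μ ^ (2 : ℝ) = ∫⁻ x, ‖g x‖ₑ ^ (2 : ℝ) ∂μ := fun g => by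
    have := eLpNorm_nnreal_pow_eq_lintegral (μ := μ) (f := g) (p := 2) (by norm_num)
    simpa using this
  rw [← ENNReal.rpow_le_rpow_iff (zero_lt_two : (0 : ℝ) < 2), h2]
  have hprod : AEMeasurable (Function.uncurry fun x t =>
      ‖φ.normed μ t‖ₑ * ‖f (x - t) - f x‖ₑ ^ (2 : ℝ)) (μ.prod μ) := by
    have h3 : AEStronglyMeasurable (fun p : E × E => f (p.1 - p.2)) (μ.prod μ) := by
      simpa using (aestronglyMeasurable_const (b := (1 : ℝ)) (μ := μ)).convolution_integrand
        (ContinuousLinearMap.lsmul ℝ ℝ) hf.1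
    exact (hw.comp measurable_snd).aemeasurable.mul
      (((h3.sub hf.1.comp_fst).enorm).pow_const _)
  calc _ ≤ ∫⁻ x, ∫⁻ t, ‖φ.normed μ t‖ₑ * ‖f (x - t) - f x‖ₑ ^ (2 : ℝ) ∂μ ∂μ := lintegral_mono hpt
    _ = ∫⁻ t, ∫⁻ x, ‖φ.normed μ t‖ₑ * ‖f (x - t) - f x‖ₑ ^ (2 : ℝ) ∂μ ∂μ :=
        lintegral_lintegral_swap hprod
    _ ≤ ∫⁻ t, ‖φ.normed μ t‖ₑ * ε ^ (2 : ℝ) ∂μ := by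
        refine lintegral_mono fun t => ?_
        rw [lintegral_const_mul' _ _ enorm_ne_top, ← h2 fun x => f (x - t) - f x]
        by_cases ht : t ∈ Metric.ball (0 : E) φ.rOut
        · gcongr
          exact hε t ht
        · have : φ.normed μ t = 0 := by
            rw [← Function.notMem_support, φ.support_normed_eq]; exact ht
          simp [this]
    _ = ε ^ (2 : ℝ) := by rw [lintegral_mul_const _ hw, hw1, one_mul]

/-- Mollifications converge in `L²`. -/
lemma tendsto_eLpNorm_mollify_sub {φ : ℕ → ContDiffBump (0 : E)}
    (hφ : Tendsto (fun n => (φ n).rOut) atTop (𝓝 0)) {f : E → ℝ} (hf : MemLp f 2 μ) :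
    Tendsto (fun n => eLpNorm (mollify μ (φ n) f - f) 2 μ) atTop (𝓝 0) := by
  rw [ENNReal.tendsto_nhds_zero]
  intro ε hε
  have h := ENNReal.tendsto_nhds_zero.1 (tendsto_eLpNorm_translate_sub hf) ε hε
  obtain ⟨δ, hδ, hb⟩ := Metric.eventually_nhds_iff_ball.1 h
  filter_upwards [hφ.eventually (gt_mem_nhds hδ)] with n hn
  exact eLpNorm_mollify_sub_le (φ n) hf fun t ht => hb t (Metric.ball_subset_ball hn.le ht)

lemma contDiff_mollify (φ : ContDiffBump (0 : E)) {f : E → ℝ} (hf : LocallyIntegrable f μ) :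
    ContDiff ℝ ∞ (mollify μ φ f) :=
  φ.hasCompactSupport_normed.contDiff_convolution_left (n := ⊤) _ φ.contDiff_normed hf

lemma memLp_mollify (φ : ContDiffBump (0 : E)) {f : E → ℝ} (hf : MemLp f 2 μ) :
    MemLp (mollify μ φ f) 2 μ := by
  have hc := (contDiff_mollify φ (hf.locallyIntegrable (by norm_num))).continuous
  have h : MemLp (mollify μ φ f - f) 2 μ := by
    refine ⟨hc.aestronglyMeasurable.sub hf.1, ?_⟩
    refine (eLpNorm_mollify_sub_le φ hf (ε := eLpNorm f 2 μ + eLpNorm f 2 μ) fun t _ => ?_).trans_lt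
      (ENNReal.add_lt_top.2 ⟨hf.2, hf.2⟩)
    have hm := measurePreserving_sub_right μ t
    have h1 : eLpNorm (fun x => f (x - t)) 2 μ = eLpNorm f 2 μ :=
      eLpNorm_comp_measurePreserving hf.1 hm
    calc _ ≤ eLpNorm (fun x => f (x - t)) 2 μ + eLpNorm f 2 μ :=
          eLpNorm_sub_le (hf.1.comp_measurePreserving hm) hf.1 (by norm_num)
      _ = _ := by rw [h1]
  simpa using h.add hf

/-- Mollification is symmetric. -/
lemma integral_mul_mollify (φ : ContDiffBump (0 : E)) {f k : E → ℝ} (hf : LocallyIntegrable f μ)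
    (hk : Continuous k) (hc : HasCompactSupport k) :
    ∫ x, f x * mollify μ φ k x ∂μ = ∫ x, mollify μ φ f x * k x ∂μ := by
  set K : Set E := Metric.closedBall (0 : E) φ.rOut + tsupport k with hK
  have hKc : IsCompact K := (isCompact_closedBall _ _).add hc
  have hsupp : ∀ x y, φ.normed μ (x - y) * k y ≠ 0 → x ∈ K := by
    intro x y h
    have h1 : x - y ∈ Function.support (φ.normed μ) := left_ne_zero_of_mul h
    rw [φ.support_normed_eq] at h1
    refine ⟨x - y, Metric.ball_subset_closedBall h1, y, subset_tsupport _ (right_ne_zero_of_mul h), ?_⟩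
    simp
  have e1 : ∀ x, f x * mollify μ φ k x = ∫ y, f x * (φ.normed μ (x - y) * k y) ∂μ := by
    intro x
    rw [integral_const_mul, mollify, convolution_eq_swap]
    simp
  have e2 : ∀ y, mollify μ φ f y * k y = ∫ x, f x * (φ.normed μ (x - y) * k y) ∂μ := by
    intro y
    rw [mollify, convolution_eq_swap, ← integral_mul_const]
    congr 1
    funext x
    have : φ.normed μ (y - x) = φ.normed μ (x - y) := by rw [← φ.normed_neg, neg_sub]
    simp only [ContinuousLinearMap.lsmul_apply, smul_eq_mul, this]
    ring
  simp only [e1, e2]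
  refine integral_integral_swap ?_
  obtain ⟨C, hC⟩ := φ.hasCompactSupport_normed (μ := μ)|>.exists_bound_of_continuous
    φ.continuous_normed
  have hfK : Integrable (K.indicator f) μ :=
    (integrable_indicator_iff hKc.measurableSet).2 (hf.integrableOn_isCompact hKc)
  have hki : Integrable k μ := hk.integrable_of_hasCompactSupport hc
  refine ((hfK.mul_prod hki).norm.const_mul C).mono' ?_ (ae_of_all _ fun p => ?_)
  · refine hf.aestronglyMeasurable.comp_fst.mul (Continuous.aestronglyMeasurable ?_)
    exact (φ.continuous_normed.comp (continuous_fst.sub continuous_snd)).mul (hk.comp continuous_snd)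
  · rcases p with ⟨x, y⟩
    simp only [Function.uncurry]
    by_cases h : φ.normed μ (x - y) * k y = 0
    · rw [h, mul_zero, norm_zero]
      exact mul_nonneg ((norm_nonneg _).trans (hC 0)) (norm_nonneg _)
    · rw [Set.indicator_of_mem (hsupp x y h)]
      simp only [norm_mul]
      calc _ = ‖φ.normed μ (x - y)‖ * (‖f x‖ * ‖k y‖) := by ring
        _ ≤ _ := mul_le_mul_of_nonneg_right (hC _) (by positivity)

end Mollify

section MollifyPd

variable {ι : Type*} [Fintype ι] [DecidableEq ι]

/-- Mollification commutes with partial derivatives. -/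
lemma pd_mollify (φ : ContDiffBump (0 : ι → ℝ)) {k : (ι → ℝ) → ℝ} (hk : ContDiff ℝ 1 k)
    (hc : HasCompactSupport k) (i : ι) :
    pd i (mollify volume φ k) = mollify volume φ (pd i k) := by
  funext x
  have h := hc.hasFDerivAt_convolution_right (ContinuousLinearMap.lsmul ℝ ℝ)
    ((φ.continuous_normed (μ := volume)).locallyIntegrable (μ := volume)) hk x
  rw [pd, mollify, h.fderiv]
  exact convolution_precompR_apply _ ((φ.continuous_normed (μ := volume)).locallyIntegrable (μ := volume))
    (hc.fderiv ℝ) (hk.continuous_fderiv (by simp)) x _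

lemma hasCompactSupport_mollify (φ : ContDiffBump (0 : ι → ℝ)) {k : (ι → ℝ) → ℝ}
    (hc : HasCompactSupport k) : HasCompactSupport (mollify volume φ k) :=
  φ.hasCompactSupport_normed.convolution _ hc

/-- The partial derivatives of a mollified function, as derivatives of the mollifier. -/
lemma pd_mollify_eq_integral (φ : ContDiffBump (0 : ι → ℝ)) {f : (ι → ℝ) → ℝ}
    (hf : LocallyIntegrable f) (i : ι) (x : ι → ℝ) :
    pd i (mollify volume φ f) x = ∫ y, pd i (φ.normed volume) (x - y) * f y := by
  have h := (φ.hasCompactSupport_normed (μ := volume)).hasFDerivAt_convolution_left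
    (ContinuousLinearMap.lsmul ℝ ℝ) φ.contDiff_normed hf x
  rw [pd, mollify, h.fderiv, convolution_eq_swap, ContinuousLinearMap.integral_apply]
  · rfl
  · exact ((φ.hasCompactSupport_normed (μ := volume)).fderiv ℝ).convolutionExists_left _
      ((φ.contDiff_normed (n := 1)).continuous_fderiv (by simp)) hf x |>.integrable_swap

end MollifyPd

/-! ### Weak solutions of the adjoint equation -/

section Caccioppoli

variable {ι : Type*} [Fintype ι] [DecidableEq ι] {H : (ι → ℝ) → ℝ}

/-- If `h` satisfies `Δh + div (h ∇H) = 0` weakly, with `J = h ∇H`, then its mollifications satisfy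
`div (∇(φ ⋆ h) + φ ⋆ J) = 0`. -/
lemma mollify_weak_equation {h : (ι → ℝ) → ℝ} {J : ι → (ι → ℝ) → ℝ} (hh : MemLp h 2 volume)
    (hJ : ∀ i, MemLp (J i) 2 volume)
    (orth : ∀ u : (ι → ℝ) → ℝ, ContDiff ℝ ∞ u → HasCompactSupport u →
      ∫ φ, ∑ i, (J i φ * pd i u φ - h φ * pd i (pd i u) φ) = 0)
    (b : ContDiffBump (0 : ι → ℝ)) {ψ : (ι → ℝ) → ℝ} (hψ : ContDiff ℝ 2 ψ)
    (hc : HasCompactSupport ψ) :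
    ∫ φ, ∑ i, (pd i (mollify volume b h) φ + mollify volume b (J i) φ) * pd i ψ φ = 0 := by
  have hhl : LocallyIntegrable h := hh.locallyIntegrable (by norm_num)
  have hJl : ∀ i, LocallyIntegrable (J i) := fun i => (hJ i).locallyIntegrable (by norm_num)
  have hu : ContDiff ℝ ∞ (mollify volume b ψ) := contDiff_mollify b hψ.continuous.locallyIntegrable
  have hψ1 : ContDiff ℝ 1 ψ := hψ.of_le (by norm_num)
  have hpψ : ∀ i, ContDiff ℝ 1 (pd i ψ) := fun i => contDiff_pd hψ (by norm_num) i
  have hppψ : ∀ i, Continuous (pd i (pd i ψ)) := fun i => continuous_pd (hpψ i) i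
  have hcp : ∀ i, HasCompactSupport (pd i ψ) := fun i => hasCompactSupport_pd hc i
  have hcpp : ∀ i, HasCompactSupport (pd i (pd i ψ)) := fun i => hasCompactSupport_pd (hcp i) i
  have h0 := orth _ hu (hasCompactSupport_mollify b hc)
  simp only [pd_mollify b hψ1 hc, pd_mollify b (hpψ _) (hcp _)] at h0
  have i1 : ∀ i, Integrable fun φ => J i φ * mollify volume b (pd i ψ) φ := fun i =>
    (hJl i).integrable_smul_right_of_hasCompactSupport
      (contDiff_mollify b (hpψ i).continuous.locallyIntegrable).continuous
      (hasCompactSupport_mollify b (hcp i))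
  have i2 : ∀ i, Integrable fun φ => h φ * mollify volume b (pd i (pd i ψ)) φ := fun i =>
    hhl.integrable_smul_right_of_hasCompactSupport
      (contDiff_mollify b (hppψ i).locallyIntegrable).continuous
      (hasCompactSupport_mollify b (hcpp i))
  have hm : ContDiff ℝ 1 (mollify volume b h) := (contDiff_mollify b hhl).of_le (by simp)
  have hmJ : ∀ i, Continuous (mollify volume b (J i)) := fun i =>
    (contDiff_mollify b (hJl i)).continuous
  have i3 : ∀ i, Integrable fun φ => pd i (mollify volume b h) φ * pd i ψ φ := fun i =>
    ((continuous_pd hm i).mul (hpψ i).continuous).integrable_of_hasCompactSupport (hcp i).mul_left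
  have i4 : ∀ i, Integrable fun φ => mollify volume b (J i) φ * pd i ψ φ := fun i =>
    ((hmJ i).mul (hpψ i).continuous).integrable_of_hasCompactSupport (hcp i).mul_left
  have i5 : ∀ i, Integrable fun φ =>
      (pd i (mollify volume b h) φ + mollify volume b (J i) φ) * pd i ψ φ := fun i => by
    simpa only [add_mul] using! (i3 i).add (i4 i)
  have i6 : ∀ i, Integrable fun φ =>
      J i φ * mollify volume b (pd i ψ) φ - h φ * mollify volume b (pd i (pd i ψ)) φ :=
    fun i => (i1 i).sub (i2 i)
  rw [integral_finsetSum _ fun i _ => i6 i] at h0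
  rw [integral_finsetSum _ fun i _ => i5 i, ← h0]
  refine Finset.sum_congr rfl fun i _ => ?_
  simp only [add_mul]
  rw [integral_add (i3 i) (i4 i), integral_sub (i1 i) (i2 i),
    integral_mul_mollify b (hJl i) (hpψ i).continuous (hcp i),
    integral_mul_mollify b hhl (hppψ i) (hcpp i),
    integral_mul_pd hm (hpψ i) (hcp i) i]
  ring

lemma exp_neg_mul_exp (x : ℝ) : Real.exp (-x) * Real.exp x = 1 := by
  rw [← Real.exp_add]; simp

/-- Caccioppoli inequality: the equation `div (∇h + J) = 0` is tested with `χ² k`, where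
`k = e^H h`. In terms of `k` it reads `div (e^{-H} ∇k + (J - h ∇H)) = 0`. -/
lemma caccioppoli (hH : ContDiff ℝ 2 H) {h χ : (ι → ℝ) → ℝ} {J : ι → (ι → ℝ) → ℝ}
    (hh : ContDiff ℝ 2 h) (hJ : ∀ i, Continuous (J i)) (hχ : ContDiff ℝ 2 χ)
    (hc : HasCompactSupport χ)
    (weak : ∀ ψ : (ι → ℝ) → ℝ, ContDiff ℝ 2 ψ → HasCompactSupport ψ →
      ∫ φ, ∑ i, (pd i h φ + J i φ) * pd i ψ φ = 0) :
    ∑ i, ∫ φ, Real.exp (-H φ) * pd i (fun ψ => χ ψ * (Real.exp (H ψ) * h ψ)) φ ^ 2 ≤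
      3 * (∑ i, ∫ φ, Real.exp (H φ) * pd i χ φ ^ 2 * (h φ * h φ)) +
      2 * ∑ i, ∫ φ, Real.exp (H φ) * χ φ ^ 2 * (J i φ - h φ * pd i H φ) ^ 2 := by
  set k : (ι → ℝ) → ℝ := fun φ => Real.exp (H φ) * h φ with hk
  have hkC : ContDiff ℝ 2 k := hH.exp.mul hh
  have hkd : Differentiable ℝ k := hkC.differentiable (by simp)
  have hχd : Differentiable ℝ χ := hχ.differentiable (by simp)
  have hpχ : ∀ i, Continuous (pd i χ) := fun i => continuous_pd (hχ.of_le (by norm_num)) i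
  have hpk : ∀ i, Continuous (pd i k) := fun i => continuous_pd (hkC.of_le (by norm_num)) i
  have hpH : ∀ i, Continuous (pd i H) := fun i => continuous_pd (hH.of_le (by norm_num)) i
  have hph : ∀ i, Continuous (pd i h) := fun i => continuous_pd (hh.of_le (by norm_num)) i
  have hE : Continuous fun φ => Real.exp (H φ) := Real.continuous_exp.comp hH.continuous
  have hEn : Continuous fun φ => Real.exp (-H φ) := continuous_exp_neg (hH.of_le (by norm_num))
  have hχk : ContDiff ℝ 2 fun φ => χ φ * k φ := hχ.mul hkC
  have hχχk : ContDiff ℝ 2 fun φ => χ φ * (χ φ * k φ) := hχ.mul hχk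
  have h0 := weak (fun φ => χ φ * (χ φ * k φ)) hχχk hc.mul_right
  have e1 : ∀ i φ, pd i (fun φ => χ φ * k φ) φ = χ φ * pd i k φ + pd i χ φ * k φ :=
    fun i φ => pd_mul hχd hkd i φ
  have e2 : ∀ i φ, pd i (fun φ => χ φ * (χ φ * k φ)) φ =
      χ φ * (χ φ * pd i k φ + pd i χ φ * k φ) + pd i χ φ * (χ φ * k φ) := fun i φ => by
    rw [pd_mul hχd (hχk.differentiable (by simp)), e1]
  have e3 : ∀ φ, h φ = Real.exp (-H φ) * k φ := fun φ => by
    rw [hk, ← mul_assoc, exp_neg_mul_exp, one_mul]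
  have e4 : ∀ i φ, pd i h φ = Real.exp (-H φ) * pd i k φ - h φ * pd i H φ := fun i φ => by
    have : pd i h φ = pd i (fun ψ => Real.exp (-H ψ) * k ψ) φ := by rw [← funext e3]
    rw [this, pd_mul (hH.neg.exp.differentiable (by simp)) hkd,
      pd_exp (hH.neg.differentiable (by simp)), pd_neg, e3 φ]
    ring
  have key : ∀ i φ, 1 / 2 * (Real.exp (-H φ) * pd i (fun ψ => χ ψ * k ψ) φ ^ 2) ≤
      (pd i h φ + J i φ) * pd i (fun φ => χ φ * (χ φ * k φ)) φ +
      (3 / 2 * (Real.exp (H φ) * pd i χ φ ^ 2 * (h φ * h φ)) +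
      Real.exp (H φ) * χ φ ^ 2 * (J i φ - h φ * pd i H φ) ^ 2) := by
    intro i φ
    rw [e1, e2, e4]
    obtain ⟨c, hc⟩ : ∃ c, c = J i φ - h φ * pd i H φ := ⟨_, rfl⟩
    have hJc : J i φ = c + h φ * pd i H φ := by rw [hc]; ring
    rw [hJc, e3 φ]
    have hre := exp_neg_mul_exp (H φ)
    have hr := Real.exp_pos (-H φ)
    generalize Real.exp (-H φ) = r at *
    generalize Real.exp (H φ) = e at *
    generalize χ φ = x at *
    generalize pd i k φ = a at *
    generalize pd i χ φ = b at *
    generalize k φ = y at *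
    generalize pd i H φ = z at *
    -- the difference of the two sides is half the sum of the squares in `p1` and `p2`
    have p1 : 0 ≤ r * ((x * a + b * y) + e * x * c) ^ 2 := mul_nonneg hr.le (sq_nonneg _)
    have p2 : 0 ≤ r * (y * b + e * x * c) ^ 2 := mul_nonneg hr.le (sq_nonneg _)
    have : (r * a - r * y * z + (c + r * y * z)) * (x * (x * a + b * y) + b * (x * y)) +
        (3 / 2 * (e * b ^ 2 * (r * y * (r * y))) + e * x ^ 2 * (c + r * y * z - r * y * z) ^ 2) -
        1 / 2 * (r * (x * a + b * y) ^ 2) =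
        1 / 2 * (r * ((x * a + b * y) + e * x * c) ^ 2) + 1 / 2 * (r * (y * b + e * x * c) ^ 2) := by
      linear_combination (3 / 2 * r * y ^ 2 * b ^ 2 - e * x ^ 2 * c ^ 2 -
        (x * a + b * y) * x * c - y * b * x * c) * hre
    linarith
  have j0 : ∀ i, Integrable fun φ => Real.exp (-H φ) * pd i (fun ψ => χ ψ * k ψ) φ ^ 2 := fun i => by
    refine Continuous.integrable_of_hasCompactSupport
      (hEn.mul ((continuous_pd (hχk.of_le (by norm_num)) i).pow 2)) ?_
    have := hasCompactSupport_pd (hc.mul_right (f' := k)) i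
    simp only [pow_two]
    exact (this.mul_right (f' := _)).mul_left
  have j1 : ∀ i, Integrable fun φ =>
      (pd i h φ + J i φ) * pd i (fun φ => χ φ * (χ φ * k φ)) φ := fun i =>
    (((hph i).add (hJ i)).mul (continuous_pd (hχχk.of_le (by norm_num)) i)).integrable_of_hasCompactSupport
      ((hasCompactSupport_pd (hc.mul_right (f' := fun φ => χ φ * k φ)) i).mul_left)
  have j2 : ∀ i, Integrable fun φ => Real.exp (H φ) * pd i χ φ ^ 2 * (h φ * h φ) := fun i => by
    refine Continuous.integrable_of_hasCompactSupport
      ((hE.mul ((hpχ i).pow 2)).mul (hh.continuous.mul hh.continuous)) ?_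
    simp only [pow_two]
    exact (((hasCompactSupport_pd hc i).mul_right).mul_left).mul_right
  have j3 : ∀ i, Integrable fun φ =>
      Real.exp (H φ) * χ φ ^ 2 * (J i φ - h φ * pd i H φ) ^ 2 := fun i => by
    refine Continuous.integrable_of_hasCompactSupport
      ((hE.mul (hχ.continuous.pow 2)).mul (((hJ i).sub (hh.continuous.mul (hpH i))).pow 2)) ?_
    have : HasCompactSupport fun φ => χ φ ^ 2 := by simpa only [pow_two] using! hc.mul_right (f' := χ)
    exact this.mul_left.mul_right
  rw [integral_finsetSum _ fun i _ => j1 i] at h0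
  have hi : ∀ i, 1 / 2 * (∫ φ, Real.exp (-H φ) * pd i (fun ψ => χ ψ * k ψ) φ ^ 2) ≤
      (∫ φ, (pd i h φ + J i φ) * pd i (fun φ => χ φ * (χ φ * k φ)) φ) +
      (3 / 2 * (∫ φ, Real.exp (H φ) * pd i χ φ ^ 2 * (h φ * h φ)) +
      ∫ φ, Real.exp (H φ) * χ φ ^ 2 * (J i φ - h φ * pd i H φ) ^ 2) := by
    intro i
    have j2' := (j2 i).const_mul (3 / 2)
    have := integral_mono ((j0 i).const_mul (1 / 2)) ((j1 i).add (j2'.add (j3 i))) (key i)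
    rw [integral_const_mul, integral_add' (j1 i) (j2'.add (j3 i)), integral_add' j2' (j3 i),
      integral_const_mul] at this
    exact this
  have := Finset.sum_le_sum fun i (_ : i ∈ Finset.univ) => hi i
  simp only [Finset.sum_add_distrib, ← Finset.mul_sum, h0] at this
  linarith

/-- A weak derivative of `k = e^H h`, tested on a region where the cutoff `χ` equals `1`, is controlled
by the energy of `χ k`. -/
lemma sq_integral_mul_pdAdj_le (hH : ContDiff ℝ 2 H) {h χ w : (ι → ℝ) → ℝ} (hh : ContDiff ℝ 2 h)
    (hχ : ContDiff ℝ 2 χ) (hc : HasCompactSupport χ) (hw : ContDiff ℝ 1 w)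
    (hwc : HasCompactSupport w) (h1 : ∀ φ, w φ ≠ 0 → χ =ᶠ[𝓝 φ] fun _ => 1) (i : ι) :
    (∫ φ, h φ * pdAdj H i w φ) ^ 2 ≤
      (∑ j, ∫ φ, Real.exp (-H φ) * pd j (fun ψ => χ ψ * (Real.exp (H ψ) * h ψ)) φ ^ 2) *
        ∫ φ, Real.exp (-H φ) * w φ ^ 2 := by
  set k : (ι → ℝ) → ℝ := fun φ => Real.exp (H φ) * h φ with hk
  have hH1 : ContDiff ℝ 1 H := hH.of_le (by norm_num)
  have hkC : ContDiff ℝ 2 k := hH.exp.mul hh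
  have hk1 : ContDiff ℝ 1 k := hkC.of_le (by norm_num)
  have hχk : ContDiff ℝ 1 fun φ => χ φ * k φ := (hχ.mul hkC).of_le (by norm_num)
  set s : (ι → ℝ) → ℝ := fun φ => Real.exp (-H φ / 2) with hs
  have hsC : Continuous s := Real.continuous_exp.comp (hH.continuous.neg.div_const 2)
  have hss : ∀ φ, s φ * s φ = Real.exp (-H φ) := fun φ => by
    rw [hs, ← Real.exp_add, add_halves]
  have hcχk : ∀ j, HasCompactSupport (pd j fun φ => χ φ * k φ) := fun j =>
    hasCompactSupport_pd (hc.mul_right (f' := k)) j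
  have e1 : ∫ φ, h φ * pdAdj H i w φ =
      ∫ φ, (s φ * pd i (fun ψ => χ ψ * k ψ) φ) * (s φ * w φ) := by
    have := integral_pd_mul_weight hH1 hw hk1 hwc i
    have e : ∀ φ, h φ * pdAdj H i w φ = pdAdj H i w φ * k φ * Real.exp (-H φ) := fun φ => by
      have := exp_neg_mul_exp (H φ)
      rw [hk]
      linear_combination (-(h φ * pdAdj H i w φ)) * this
    simp only [e, ← this]
    congr 1
    funext φ
    by_cases hφ : w φ = 0
    · simp [hφ]
    · have hd : pd i (fun ψ => χ ψ * k ψ) φ = pd i k φ := by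
        have : (fun ψ => χ ψ * k ψ) =ᶠ[𝓝 φ] k := by
          filter_upwards [h1 φ hφ] with ψ hψ
          rw [hψ, one_mul]
        rw [pd, this.fderiv_eq, pd]
      rw [hd, ← hss]
      ring
  have m1 : MemLp (fun φ => s φ * pd i (fun ψ => χ ψ * k ψ) φ) 2 volume :=
    (hsC.mul (continuous_pd hχk i)).memLp_of_hasCompactSupport (hcχk i).mul_left
  have m2 : MemLp (fun φ => s φ * w φ) 2 volume :=
    (hsC.mul hw.continuous).memLp_of_hasCompactSupport hwc.mul_left
  rw [e1]
  refine (sq_integral_mul_le m1 m2).trans ?_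
  simp only [mul_pow, pow_two (s _), hss]
  refine mul_le_mul_of_nonneg_right ?_ (integral_nonneg fun φ => by positivity)
  exact Finset.single_le_sum
    (f := fun j => ∫ φ, Real.exp (-H φ) * pd j (fun ψ => χ ψ * k ψ) φ ^ 2)
    (fun j _ => integral_nonneg fun φ => by positivity) (Finset.mem_univ i)

end Caccioppoli

section WeakSolutions

variable {ι : Type*} [Fintype ι] [DecidableEq ι] {H : (ι → ℝ) → ℝ}

/-- Smooth cutoff functions at scale `R`, with gradient of order `1 / R`. -/
lemma exists_cutoff : ∃ C : ℝ, ∀ R : ℝ, 0 < R → ∃ χ : (ι → ℝ) → ℝ, ContDiff ℝ 2 χ ∧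
    HasCompactSupport χ ∧ (∀ φ, ‖φ‖ < R → χ =ᶠ[𝓝 φ] fun _ => 1) ∧
    ∀ i φ, |pd i χ φ| ≤ C / R := by
  let b : ContDiffBump (0 : ι → ℝ) := ⟨1, 2, one_pos, one_lt_two⟩
  have hb : ContDiff ℝ 2 b := b.contDiff
  obtain ⟨C, hC⟩ : ∃ C, ∀ φ, ‖fderiv ℝ b φ‖ ≤ C :=
    (b.hasCompactSupport.fderiv ℝ).exists_bound_of_continuous (hb.continuous_fderiv (by simp))
  refine ⟨C, fun R hR => ⟨fun φ => b (R⁻¹ • φ), hb.comp (contDiff_const_smul _),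
    b.hasCompactSupport.comp_smul (inv_ne_zero hR.ne'), fun φ hφ => ?_, fun i φ => ?_⟩⟩
  · have hmem : R⁻¹ • φ ∈ Metric.ball (0 : ι → ℝ) b.rIn := by
      rw [mem_ball_zero_iff, norm_smul, norm_inv, Real.norm_of_nonneg hR.le]
      change R⁻¹ * ‖φ‖ < 1
      rw [inv_mul_lt_iff₀ hR, mul_one]
      exact hφ
    have hcont : Tendsto (fun ψ : ι → ℝ => R⁻¹ • ψ) (𝓝 φ) (𝓝 (R⁻¹ • φ)) :=
      (continuous_const_smul _).tendsto _
    filter_upwards [hcont.eventually (b.eventuallyEq_one_of_mem_ball hmem)] with ψ hψ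
    exact hψ
  · rw [pd, fderiv_comp_smul]
    simp only [smul_apply, smul_eq_mul, abs_mul, abs_inv, abs_of_pos hR]
    rw [div_eq_inv_mul]
    refine mul_le_mul_of_nonneg_left ?_ (by positivity)
    have h1 : ‖(Pi.single i 1 : ι → ℝ)‖ ≤ 1 := by rw [Pi.norm_single, norm_one]
    exact ((fderiv ℝ b (R⁻¹ • φ)).le_opNorm_of_le h1).trans (by simpa using hC _)

/-- Bump functions at the origin shrinking to a point, with comparable radii. -/
def shrinkingBump (ι : Type*) [Fintype ι] (n : ℕ) : ContDiffBump (0 : ι → ℝ) :=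
  ⟨1 / ((n : ℝ) + 1), 2 * (1 / ((n : ℝ) + 1)), by positivity, by
    have : 0 < 1 / ((n : ℝ) + 1) := by positivity
    linarith⟩

lemma tendsto_shrinkingBump_rOut :
    Tendsto (fun n => (shrinkingBump ι n).rOut) atTop (𝓝 0) := by
  have h := (tendsto_one_div_add_atTop_nhds_zero_nat (𝕜 := ℝ)).const_mul 2
  rw [mul_zero] at h
  exact h

/-- A weak solution of the generator's adjoint equation has vanishing weak gradient: letting the
mollification parameter tend to `0` in `caccioppoli` removes the commutator term, and the remaining
term carries the factor `|∇χ|²`, which vanishes as the cutoff is spread out. -/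
lemma integral_mul_pdAdj_eq_zero (hH : ContDiff ℝ 2 H) {h : (ι → ℝ) → ℝ} (hh : MemLp h 2 volume)
    (hJ : ∀ i, MemLp (fun φ => h φ * pd i H φ) 2 volume)
    (hi : Integrable fun φ => Real.exp (H φ) * (h φ * h φ))
    (orth : ∀ u : (ι → ℝ) → ℝ, ContDiff ℝ ∞ u → HasCompactSupport u →
      ∫ φ, ∑ i, (h φ * pd i H φ * pd i u φ - h φ * pd i (pd i u) φ) = 0)
    {w : (ι → ℝ) → ℝ} (hw : ContDiff ℝ 1 w) (hwc : HasCompactSupport w) (i : ι) :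
    ∫ φ, h φ * pdAdj H i w φ = 0 := by
  have hH1 : ContDiff ℝ 1 H := hH.of_le (by norm_num)
  obtain ⟨C, hC⟩ := exists_cutoff (ι := ι)
  obtain ⟨R₀, hR₀⟩ : ∃ R₀ : ℝ, ∀ φ, w φ ≠ 0 → ‖φ‖ < R₀ := by
    obtain ⟨r, hr⟩ := hwc.isCompact.isBounded.subset_ball (0 : ι → ℝ)
    exact ⟨r, fun φ hφ => by simpa using hr (subset_tsupport _ hφ)⟩
  set X := ∫ φ, h φ * pdAdj H i w φ with hX
  set W := ∫ φ, Real.exp (-H φ) * w φ ^ 2 with hW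
  have hW0 : 0 ≤ W := integral_nonneg fun φ => by positivity
  set A := ∫ φ, Real.exp (H φ) * (h φ * h φ) with hA
  let b := shrinkingBump ι
  have hb := tendsto_shrinkingBump_rOut (ι := ι)
  have hhl : LocallyIntegrable h := hh.locallyIntegrable (by norm_num)
  let hn : ℕ → (ι → ℝ) → ℝ := fun n => mollify volume (b n) h
  let Jn : ℕ → ι → (ι → ℝ) → ℝ := fun n i => mollify volume (b n) (fun φ => h φ * pd i H φ)
  have hnC : ∀ n, ContDiff ℝ 2 (hn n) := fun n => contDiff_infty.1 (contDiff_mollify (b n) hhl) 2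
  have hnL : ∀ n, MemLp (hn n) 2 volume := fun n => memLp_mollify (b n) hh
  have hnT : Tendsto (fun n => eLpNorm (hn n - h) 2 volume) atTop (𝓝 0) :=
    tendsto_eLpNorm_mollify_sub hb hh
  have JnC : ∀ n i, Continuous (Jn n i) := fun n i =>
    (contDiff_mollify (b n) ((hJ i).locallyIntegrable (by norm_num))).continuous
  have JnL : ∀ n i, MemLp (Jn n i) 2 volume := fun n i => memLp_mollify (b n) (hJ i)
  have JnT : ∀ i, Tendsto (fun n => eLpNorm (Jn n i - fun φ => h φ * pd i H φ) 2 volume)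
      atTop (𝓝 0) := fun i => tendsto_eLpNorm_mollify_sub hb (hJ i)
  have hXn : Tendsto (fun n => ∫ φ, hn n φ * pdAdj H i w φ) atTop (𝓝 X) := by
    have hL : MemLp (pdAdj H i w) 2 volume :=
      (continuous_pdAdj hH1 hw i).memLp_of_hasCompactSupport (hasCompactSupport_pdAdj hwc i)
    exact tendsto_integral_mul_of_tendsto_eLpNorm hnL hh (fun _ => hL) hL hnT (by simp)
  have main : ∀ R : ℝ, R₀ ≤ R → 0 < R →
      X ^ 2 ≤ (3 * (Fintype.card ι * ((C / R) ^ 2 * A))) * W := by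
    intro R hR hRpos
    obtain ⟨χ, hχ, hχc, hχ1, hχd⟩ := hC R hRpos
    have hE : Continuous fun φ => Real.exp (H φ) := Real.continuous_exp.comp hH.continuous
    have hpχ : ∀ i, Continuous (pd i χ) := fun i => continuous_pd (hχ.of_le (by norm_num)) i
    have hpH : ∀ i, Continuous (pd i H) := fun i => continuous_pd hH1 i
    have hineq : ∀ n, (∫ φ, hn n φ * pdAdj H i w φ) ^ 2 ≤
        (3 * (∑ j, ∫ φ, Real.exp (H φ) * pd j χ φ ^ 2 * (hn n φ * hn n φ)) +
        2 * ∑ j, ∫ φ, Real.exp (H φ) * χ φ ^ 2 * (Jn n j φ - hn n φ * pd j H φ) ^ 2) * W := by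
      intro n
      refine (sq_integral_mul_pdAdj_le hH (hnC n) hχ hχc hw hwc
        (fun φ hφ => hχ1 φ ((hR₀ φ hφ).trans_le hR)) i).trans ?_
      refine mul_le_mul_of_nonneg_right ?_ hW0
      exact caccioppoli hH (hnC n) (JnC n) hχ hχc fun ψ hψ hψc =>
        mollify_weak_equation hh hJ orth (b n) hψ hψc
    have t1 : ∀ j, Tendsto (fun n => ∫ φ, Real.exp (H φ) * pd j χ φ ^ 2 * (hn n φ * hn n φ)) atTop
        (𝓝 (∫ φ, Real.exp (H φ) * pd j χ φ ^ 2 * (h φ * h φ))) := by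
      intro j
      have hm : Continuous fun φ => Real.exp (H φ) * pd j χ φ ^ 2 := hE.mul ((hpχ j).pow 2)
      have hmc : HasCompactSupport fun φ => Real.exp (H φ) * pd j χ φ ^ 2 := by
        simp only [pow_two]
        exact ((hasCompactSupport_pd hχc j).mul_right).mul_left
      obtain ⟨K, hK⟩ := hmc.exists_bound_of_continuous hm
      exact tendsto_integral_bounded_mul_mul hm.aestronglyMeasurable hK hnL hh hnL hh hnT hnT
    have t2 : ∀ j, Tendsto (fun n => ∫ φ, Real.exp (H φ) * χ φ ^ 2 *
        (Jn n j φ - hn n φ * pd j H φ) ^ 2) atTop (𝓝 0) := by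
      intro j
      -- `s = e^{H/2} χ`, so that the integrand is the square of `s Jₙ - s ∂_j H hₙ`
      set s : (ι → ℝ) → ℝ := fun φ => Real.exp (H φ / 2) * χ φ with hs
      have hsC : Continuous s := (Real.continuous_exp.comp (hH.continuous.div_const 2)).mul
        hχ.continuous
      have hsc : HasCompactSupport s := hχc.mul_left
      have hzC : Continuous fun φ => s φ * pd j H φ := hsC.mul (hpH j)
      obtain ⟨K₁, hK₁⟩ := hsc.exists_bound_of_continuous hsC
      obtain ⟨K₂, hK₂⟩ := (hsc.mul_right (f' := pd j H)).exists_bound_of_continuous hzC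
      let q : ℕ → (ι → ℝ) → ℝ := fun n φ => s φ * Jn n j φ - s φ * pd j H φ * hn n φ
      have hq : ∀ n, MemLp (q n) 2 volume := fun n =>
        (memLp_bounded_mul hsC.aestronglyMeasurable hK₁ (JnL n j)).sub
          (memLp_bounded_mul hzC.aestronglyMeasurable hK₂ (hnL n))
      have a1 := tendsto_eLpNorm_bounded_mul hK₁ (JnT j)
      have a2 := tendsto_eLpNorm_bounded_mul hK₂ hnT
      have hq0 : Tendsto (fun n => eLpNorm (q n - fun _ => 0) 2 volume) atTop (𝓝 0) := by
        have a3 := a1.add a2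
        rw [add_zero] at a3
        refine tendsto_of_tendsto_of_tendsto_of_le_of_le tendsto_const_nhds a3
          (fun _ => zero_le) fun n => ?_
        have : (q n - fun _ => 0) =
            ((fun φ => s φ * Jn n j φ) - fun φ => s φ * (h φ * pd j H φ)) -
            ((fun φ => s φ * pd j H φ * hn n φ) - fun φ => s φ * pd j H φ * h φ) := by
          funext φ
          simp only [q, Pi.sub_apply]
          ring
        rw [this]
        exact eLpNorm_sub_le
          ((memLp_bounded_mul hsC.aestronglyMeasurable hK₁ (JnL n j)).sub
            (memLp_bounded_mul hsC.aestronglyMeasurable hK₁ (hJ j))).1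
          ((memLp_bounded_mul hzC.aestronglyMeasurable hK₂ (hnL n)).sub
            (memLp_bounded_mul hzC.aestronglyMeasurable hK₂ hh)).1 (by norm_num)
      have hlim := tendsto_integral_mul_of_tendsto_eLpNorm hq (MemLp.zero' (ε := ℝ)) hq
        (MemLp.zero' (ε := ℝ)) hq0 hq0
      simp only [mul_zero, integral_zero] at hlim
      refine hlim.congr fun n => ?_
      congr 1
      funext φ
      have : Real.exp (H φ) = Real.exp (H φ / 2) * Real.exp (H φ / 2) := by
        rw [← Real.exp_add, add_halves]
      simp only [q, hs, this]
      ring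
    have hlim := le_of_tendsto_of_tendsto' (hXn.pow 2)
      ((((tendsto_finsetSum Finset.univ fun j _ => t1 j).const_mul 3).add
        ((tendsto_finsetSum Finset.univ fun j _ => t2 j).const_mul 2)).mul_const W) hineq
    refine hlim.trans (mul_le_mul_of_nonneg_right ?_ hW0)
    have hj : ∀ j, ∫ φ, Real.exp (H φ) * pd j χ φ ^ 2 * (h φ * h φ) ≤ (C / R) ^ 2 * A := by
      intro j
      rw [hA, ← integral_const_mul]
      refine integral_mono_of_nonneg (ae_of_all _ fun φ => ?_) (hi.const_mul _)
        (ae_of_all _ fun φ => ?_)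
      · have := mul_self_nonneg (h φ)
        positivity
      · have h1 : pd j χ φ ^ 2 ≤ (C / R) ^ 2 := sq_le_sq' (by linarith [neg_le_of_abs_le (hχd j φ)])
          (le_of_abs_le (hχd j φ))
        have h2 : 0 ≤ Real.exp (H φ) * (h φ * h φ) :=
          mul_nonneg (Real.exp_pos _).le (mul_self_nonneg _)
        calc _ = pd j χ φ ^ 2 * (Real.exp (H φ) * (h φ * h φ)) := by ring
          _ ≤ _ := mul_le_mul_of_nonneg_right h1 h2
    have hsum := Finset.sum_le_card_nsmul Finset.univ _ _ fun j _ => hj j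
    simp only [Finset.card_univ, nsmul_eq_mul] at hsum
    simp only [Finset.sum_const_zero, mul_zero, add_zero]
    linarith
  have hlim : Tendsto (fun R : ℝ => (3 * (Fintype.card ι * ((C / R) ^ 2 * A))) * W) atTop (𝓝 0) := by
    have h1 : Tendsto (fun R : ℝ => C / R) atTop (𝓝 0) := tendsto_const_nhds.div_atTop tendsto_id
    have h2 := (((h1.pow 2).mul_const A).const_mul (Fintype.card ι : ℝ)).const_mul 3 |>.mul_const W
    simpa using h2
  have hX2 : X ^ 2 ≤ 0 := ge_of_tendsto hlim (by
    filter_upwards [eventually_ge_atTop R₀, eventually_gt_atTop 0] with R h1 h2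
    exact main R h1 h2)
  exact pow_eq_zero_iff (two_ne_zero) |>.1 (le_antisymm hX2 (sq_nonneg X))

/-- A locally integrable function with vanishing weak gradient is almost everywhere constant. -/
lemma ae_eq_const_of_integral_mul_pd_eq_zero {g : (ι → ℝ) → ℝ} (hg : LocallyIntegrable g)
    (h : ∀ v : (ι → ℝ) → ℝ, ContDiff ℝ 1 v → HasCompactSupport v → ∀ i,
      ∫ φ, g φ * pd i v φ = 0) : ∃ c : ℝ, g =ᵐ[volume] fun _ => c := by
  let b := shrinkingBump ι
  have hconst : ∀ n x, mollify volume (b n) g x = mollify volume (b n) g 0 := by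
    intro n x
    have hd : Differentiable ℝ (mollify volume (b n) g) :=
      (contDiff_mollify (b n) hg).differentiable (by simp)
    refine is_const_of_fderiv_eq_zero (𝕜 := ℝ) hd (fun y => fderiv_eq_zero_of_pd fun i => ?_) x 0
    rw [pd_mollify_eq_integral (b n) hg]
    let v : (ι → ℝ) → ℝ := fun z => (b n).normed volume (y - z)
    have hv : ContDiff ℝ 1 v := (b n).contDiff_normed.comp (contDiff_const.sub contDiff_id)
    have hvc : HasCompactSupport v :=
      (b n).hasCompactSupport_normed.comp_homeomorph (Homeomorph.subLeft y)
    have e : ∀ z, pd i ((b n).normed volume) (y - z) = -pd i v z := by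
      intro z
      have h1 : HasFDerivAt v (-(fderiv ℝ ((b n).normed volume) (y - z))) z := by
        have h2 : HasFDerivAt ((b n).normed volume) (fderiv ℝ ((b n).normed volume) (y - z))
          (y - z) := (((b n).contDiff_normed (n := 1)).differentiable (by simp) _).hasFDerivAt
        have h3 := h2.comp z ((hasFDerivAt_id z).const_sub y)
        simpa using! h3
      rw [pd, pd, h1.fderiv]
      simp
    have := h v hv hvc i
    calc _ = ∫ z, -(g z * pd i v z) := by
          congr 1; funext z; rw [e]; ring
      _ = 0 := by rw [integral_neg, this, neg_zero]
  have hlim := ContDiffBump.ae_convolution_tendsto_right_of_locallyIntegrable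
    (φ := b) (K := 2) tendsto_shrinkingBump_rOut (Eventually.of_forall fun n => le_rfl) hg
  obtain ⟨x₀, hx₀⟩ := hlim.exists
  refine ⟨g x₀, ?_⟩
  filter_upwards [hlim] with x hx
  refine tendsto_nhds_unique hx (hx₀.congr fun n => ?_)
  exact (hconst n x₀).trans (hconst n x).symm

/-- The orthogonal complement in `L²(e^{-H} dφ)` of the range of the generator
`u ↦ ∇^* ∇ u = -Δu + ∇H · ∇u` on smooth compactly supported functions consists of constants. -/
theorem ae_eq_const_of_orthogonal_generator (hH : ContDiff ℝ 2 H) {g : (ι → ℝ) → ℝ}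
    (hh : MemLp (fun φ => g φ * Real.exp (-H φ)) 2 volume)
    (hJ : ∀ i, MemLp (fun φ => g φ * Real.exp (-H φ) * pd i H φ) 2 volume)
    (hi : Integrable fun φ => g φ ^ 2 * Real.exp (-H φ))
    (orth : ∀ u : (ι → ℝ) → ℝ, ContDiff ℝ ∞ u → HasCompactSupport u →
      ∫ φ, g φ * gradAdj H (fun i => pd i u) φ * Real.exp (-H φ) = 0) :
    ∃ c : ℝ, g =ᵐ[volume] fun _ => c := by
  have hH1 : ContDiff ℝ 1 H := hH.of_le (by norm_num)
  have hE : Continuous fun φ => Real.exp (H φ) := Real.continuous_exp.comp hH.continuous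
  have hg : LocallyIntegrable g := by
    have := (hh.locallyIntegrable (by norm_num)).continuous_smul hE
    refine this.congr (ae_of_all _ fun φ => ?_)
    have := exp_neg_mul_exp (H φ)
    simp only [smul_eq_mul]
    linear_combination g φ * this
  refine ae_eq_const_of_integral_mul_pd_eq_zero hg fun v hv hvc i => ?_
  have hw : ContDiff ℝ 1 fun φ => Real.exp (H φ) * v φ := hH1.exp.mul hv
  have key := integral_mul_pdAdj_eq_zero hH hh hJ (hi.congr (ae_of_all _ fun φ => by
      have := exp_neg_mul_exp (H φ)
      simp only
      linear_combination (-(g φ ^ 2 * Real.exp (-H φ))) * this)) (fun u hu huc => by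
      rw [← orth u hu huc]
      congr 1
      funext φ
      simp only [gradAdj, pdAdj, Finset.mul_sum, Finset.sum_mul]
      exact Finset.sum_congr rfl fun i _ => by ring) hw (hvc.mul_left) i
  rw [← neg_eq_zero, ← integral_neg, ← key]
  congr 1
  funext φ
  rw [pdAdj, pd_mul (hH1.exp.differentiable (by simp)) (hv.differentiable (by simp)),
    pd_exp (hH1.differentiable (by simp))]
  have := exp_neg_mul_exp (H φ)
  linear_combination (g φ * pd i v φ) * this

end WeakSolutions

/-! ### The probability measure with density proportional to `e^{-H}` -/

section Weighted

variable {ι : Type*} [Fintype ι] [DecidableEq ι] {H : (ι → ℝ) → ℝ}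

/-- The probability measure `Z⁻¹ e^{-H} dφ`. -/
def expMeasure (H : (ι → ℝ) → ℝ) : Measure (ι → ℝ) :=
  (volume : Measure (ι → ℝ)).withDensity fun φ =>
    ENNReal.ofReal (Real.exp (-H φ) / ∫ ψ : ι → ℝ, Real.exp (-H ψ))

lemma measurable_expDensity (hH : Continuous H) : Measurable fun φ =>
    ENNReal.ofReal (Real.exp (-H φ) / ∫ ψ : ι → ℝ, Real.exp (-H ψ)) :=
  ((Real.continuous_exp.comp hH.neg).div_const _).measurable.ennreal_ofReal

lemma integral_exp_neg_pos (hi : Integrable fun φ => Real.exp (-H φ)) :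
    0 < ∫ φ, Real.exp (-H φ) := integral_exp_pos hi

lemma expDensity_toReal (hi : Integrable fun φ => Real.exp (-H φ)) (φ : ι → ℝ) :
    (ENNReal.ofReal (Real.exp (-H φ) / ∫ ψ : ι → ℝ, Real.exp (-H ψ))).toReal =
      (∫ ψ : ι → ℝ, Real.exp (-H ψ))⁻¹ * Real.exp (-H φ) := by
  have := integral_exp_neg_pos hi
  rw [ENNReal.toReal_ofReal (by positivity), div_eq_inv_mul]

lemma integral_expMeasure (hH : Continuous H) (hi : Integrable fun φ => Real.exp (-H φ))
    (f : (ι → ℝ) → ℝ) :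
    ∫ φ, f φ ∂expMeasure H =
      (∫ φ : ι → ℝ, Real.exp (-H φ))⁻¹ * ∫ φ, f φ * Real.exp (-H φ) := by
  rw [expMeasure, integral_withDensity_eq_integral_toReal_smul (measurable_expDensity hH)
    (ae_of_all _ fun _ => ENNReal.ofReal_lt_top), ← integral_const_mul]
  congr 1
  funext φ
  rw [expDensity_toReal hi, smul_eq_mul]
  ring

lemma integrable_expMeasure_iff (hH : Continuous H) (hi : Integrable fun φ => Real.exp (-H φ))
    (f : (ι → ℝ) → ℝ) :
    Integrable f (expMeasure H) ↔ Integrable fun φ => f φ * Real.exp (-H φ) := by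
  have hZ := integral_exp_neg_pos hi
  rw [expMeasure, integrable_withDensity_iff_integrable_smul' (measurable_expDensity hH)
    (ae_of_all _ fun _ => ENNReal.ofReal_lt_top)]
  simp only [expDensity_toReal hi, smul_eq_mul, mul_assoc]
  rw [integrable_const_mul_iff (IsUnit.mk0 _ (inv_ne_zero hZ.ne'))]
  simp only [mul_comm]

lemma isProbabilityMeasure_expMeasure (hi : Integrable fun φ => Real.exp (-H φ)) :
    IsProbabilityMeasure (expMeasure H) := by
  have hZ := integral_exp_neg_pos hi
  refine ⟨?_⟩
  rw [expMeasure, withDensity_apply _ MeasurableSet.univ, Measure.restrict_univ,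
    ← ofReal_integral_eq_lintegral_ofReal (hi.div_const _) (ae_of_all _ fun φ => by positivity),
    integral_div, div_self hZ.ne', ENNReal.ofReal_one]

lemma volume_absolutelyContinuous_expMeasure (hH : Continuous H)
    (hi : Integrable fun φ => Real.exp (-H φ)) :
    (volume : Measure (ι → ℝ)) ≪ expMeasure H := by
  have hZ := integral_exp_neg_pos hi
  refine withDensity_absolutelyContinuous' (measurable_expDensity hH).aemeasurable
    (ae_of_all _ fun φ => ?_)
  rw [Ne, ENNReal.ofReal_eq_zero, not_le]
  positivity

/-! ### Density of the range of the generator -/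

lemma gradAdj_add {v w : ι → (ι → ℝ) → ℝ} (hv : ∀ i, Differentiable ℝ (v i))
    (hw : ∀ i, Differentiable ℝ (w i)) (φ : ι → ℝ) :
    gradAdj H (fun i ψ => v i ψ + w i ψ) φ = gradAdj H v φ + gradAdj H w φ := by
  simp only [gradAdj, pdAdj, pd_add (hv _) (hw _), ← Finset.sum_add_distrib]
  exact Finset.sum_congr rfl fun i _ => by ring

lemma gradAdj_const_mul (c : ℝ) {w : ι → (ι → ℝ) → ℝ} (hw : ∀ i, Differentiable ℝ (w i))
    (φ : ι → ℝ) : gradAdj H (fun i ψ => c * w i ψ) φ = c * gradAdj H w φ := by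
  simp only [gradAdj, pdAdj, pd_const_mul c (hw _), Finset.mul_sum]
  exact Finset.sum_congr rfl fun i _ => by ring

lemma differentiable_pd_of_contDiff_infty {u : (ι → ℝ) → ℝ} (hu : ContDiff ℝ ∞ u) (i : ι) :
    Differentiable ℝ (pd i u) :=
  (contDiff_pd (m := 1) (contDiff_infty.1 hu 2) (by norm_num) i).differentiable (by simp)

variable (H) in
/-- The elements of `L²(e^{-H} dφ)` of the form `∇^* ∇ u` with `u` smooth and compactly supported. -/
def generatorRange : Submodule ℝ (Lp ℝ 2 (expMeasure H)) where
  carrier := {f | ∃ u : (ι → ℝ) → ℝ, ContDiff ℝ ∞ u ∧ HasCompactSupport u ∧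
    f =ᵐ[expMeasure H] gradAdj H fun i => pd i u}
  zero_mem' := ⟨fun _ => 0, contDiff_const, HasCompactSupport.zero, by
    refine (Lp.coeFn_zero ..).trans (ae_of_all _ fun φ => ?_)
    have h0 : ∀ i : ι, pd i (fun _ => (0 : ℝ)) = fun _ => 0 := fun i => by funext ψ; simp [pd]
    simp [gradAdj, pdAdj, h0]⟩
  add_mem' := by
    rintro f g ⟨u, hu, huc, hf⟩ ⟨v, hv, hvc, hg⟩
    refine ⟨fun φ => u φ + v φ, hu.add hv, huc.add hvc, ?_⟩
    filter_upwards [Lp.coeFn_add f g, hf, hg] with φ h1 h2 h3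
    rw [h1, Pi.add_apply, h2, h3, ← gradAdj_add (differentiable_pd_of_contDiff_infty hu)
      (differentiable_pd_of_contDiff_infty hv)]
    simp only [pd_add (hu.differentiable (by simp)) (hv.differentiable (by simp))]
  smul_mem' := by
    rintro c f ⟨u, hu, huc, hf⟩
    refine ⟨fun φ => c * u φ, contDiff_const.mul hu, huc.mul_left, ?_⟩
    filter_upwards [Lp.coeFn_smul c f, hf] with φ h1 h2
    rw [h1, Pi.smul_apply, h2, smul_eq_mul,
      ← gradAdj_const_mul c (differentiable_pd_of_contDiff_infty hu)]
    simp only [pd_const_mul c (hu.differentiable (by simp))]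

lemma memLp_gradAdj {μ : Measure (ι → ℝ)} [IsFiniteMeasure μ] (hH : ContDiff ℝ 2 H)
    {w : ι → (ι → ℝ) → ℝ} (hw : ∀ i, ContDiff ℝ 2 (w i)) (hc : ∀ i, HasCompactSupport (w i)) :
    MemLp (gradAdj H w) 2 μ :=
  (contDiff_gradAdj hH hw).continuous.memLp_of_hasCompactSupport (hasCompactSupport_gradAdj hc)

/-- The equation `∇^* ∇ u = G - ⟨G⟩` can be solved approximately in `L²(e^{-H} dφ)` by smooth compactly
supported functions `u`. -/
theorem exists_gradAdj_approx (hH : ContDiff ℝ 2 H) (hi : Integrable fun φ => Real.exp (-H φ))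
    {C : ℝ} (hC : ∀ φ, Real.exp (-H φ) ≤ C) (hC' : ∀ i φ, pd i H φ ^ 2 * Real.exp (-H φ) ≤ C)
    {G : (ι → ℝ) → ℝ} (hG : MemLp G 2 (expMeasure H)) {ε : ℝ} (hε : 0 < ε) :
    ∃ u : (ι → ℝ) → ℝ, ContDiff ℝ ∞ u ∧ HasCompactSupport u ∧
      ∫ φ, (gradAdj H (fun i => pd i u) φ - (G φ - ∫ ψ, G ψ ∂expMeasure H)) ^ 2 ∂expMeasure H
        < ε := by
  have hprob := isProbabilityMeasure_expMeasure hi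
  have hac := volume_absolutelyContinuous_expMeasure hH.continuous hi
  have hZ := integral_exp_neg_pos hi
  set μ := expMeasure H with hμ
  set m := ∫ ψ, G ψ ∂μ with hm
  have hGm : MemLp (fun φ => G φ - m) 2 μ := hG.sub (memLp_const m)
  have hu2 : ∀ {u : (ι → ℝ) → ℝ}, ContDiff ℝ ∞ u → ∀ i, ContDiff ℝ 2 (pd i u) := fun hu i =>
    contDiff_pd (contDiff_infty.1 hu 3) (by norm_num) i
  have hmem : hGm.toLp _ ∈ (generatorRange H).topologicalClosure := by
    rw [← Submodule.orthogonal_orthogonal_eq_closure, Submodule.mem_orthogonal]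
    intro g hg
    rw [Submodule.mem_orthogonal] at hg
    have hg2 : MemLp g 2 μ := Lp.memLp g
    have hgi : Integrable fun φ => g φ ^ 2 * Real.exp (-H φ) :=
      (integrable_expMeasure_iff hH.continuous hi _).1 hg2.integrable_sq
    have hgm : AEStronglyMeasurable g volume := hg2.1.mono_ac hac
    have hEm : Continuous fun φ => Real.exp (-H φ) := continuous_exp_neg (hH.of_le (by norm_num))
    have hpH : ∀ i, Continuous (pd i H) := fun i => continuous_pd (hH.of_le (by norm_num)) i
    have hm1 : AEStronglyMeasurable (fun φ => g φ * Real.exp (-H φ)) volume :=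
      hgm.mul hEm.aestronglyMeasurable
    have hm2 : ∀ i, AEStronglyMeasurable (fun φ => g φ * Real.exp (-H φ) * pd i H φ) volume :=
      fun i => hm1.mul (hpH i).aestronglyMeasurable
    obtain ⟨c, hc⟩ : ∃ c : ℝ, g =ᵐ[volume] fun _ => c := by
      refine ae_eq_const_of_orthogonal_generator hH ?_ (fun i => ?_) hgi fun u hu huc => ?_
      · refine (memLp_two_iff_integrable_sq hm1).2 ((hgi.const_mul C).mono' (hm1.pow 2)
          (ae_of_all _ fun φ => ?_))
        rw [Real.norm_of_nonneg (sq_nonneg _)]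
        calc _ = Real.exp (-H φ) * (g φ ^ 2 * Real.exp (-H φ)) := by ring
          _ ≤ _ := mul_le_mul_of_nonneg_right (hC φ) (by positivity)
      · refine (memLp_two_iff_integrable_sq (hm2 i)).2 ((hgi.const_mul C).mono' ((hm2 i).pow 2)
          (ae_of_all _ fun φ => ?_))
        rw [Real.norm_of_nonneg (sq_nonneg _)]
        calc _ = pd i H φ ^ 2 * Real.exp (-H φ) * (g φ ^ 2 * Real.exp (-H φ)) := by ring
          _ ≤ _ := mul_le_mul_of_nonneg_right (hC' i φ) (by positivity)
      · have hL := memLp_gradAdj (μ := μ) hH (hu2 hu) (fun i => hasCompactSupport_pd huc i)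
        have h0 := hg (hL.toLp _) ⟨u, hu, huc, hL.coeFn_toLp⟩
        rw [← Lp.toLp_coeFn g hg2, ← integral_mul_eq_inner hL hg2,
          integral_expMeasure hH.continuous hi] at h0
        rcases mul_eq_zero.1 h0 with h0 | h0
        · exact absurd h0 (inv_ne_zero hZ.ne')
        · rw [← h0]
          congr 1
          funext φ
          ring
    have hc' : g =ᵐ[μ] fun _ => c := (withDensity_absolutelyContinuous _ _).ae_eq hc
    rw [← Lp.toLp_coeFn g hg2, ← integral_mul_eq_inner hg2 hGm]
    calc _ = ∫ φ, c * (G φ - m) ∂μ := integral_congr_ae (by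
          filter_upwards [hc'] with φ hφ
          rw [hφ])
      _ = 0 := by
          rw [integral_const_mul, integral_sub (hG.integrable (by norm_num)) (integrable_const _)]
          simp [hm]
  obtain ⟨f, ⟨u, hu, huc, hfu⟩, hf⟩ := Metric.mem_closure_iff.1 hmem (Real.sqrt ε)
    (Real.sqrt_pos.2 hε)
  refine ⟨u, hu, huc, ?_⟩
  have hL := memLp_gradAdj (μ := μ) hH (hu2 hu) (fun i => hasCompactSupport_pd huc i)
  have hD : MemLp (fun φ => gradAdj H (fun i => pd i u) φ - (G φ - m)) 2 μ := hL.sub hGm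
  have e1 : f = hL.toLp _ := Lp.ext (hfu.trans hL.coeFn_toLp.symm)
  have e2 : ∫ φ, (gradAdj H (fun i => pd i u) φ - (G φ - m)) ^ 2 ∂μ =
      ‖hL.toLp _ - hGm.toLp _‖ ^ 2 := by
    rw [← MemLp.toLp_sub hL hGm, ← real_inner_self_eq_norm_sq,
      ← integral_mul_eq_inner (hL.sub hGm) (hL.sub hGm)]
    simp [pow_two]
  rw [e2, ← e1, ← dist_eq_norm, dist_comm]
  calc _ < Real.sqrt ε ^ 2 := pow_lt_pow_left₀ hf dist_nonneg two_ne_zero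
    _ = ε := Real.sq_sqrt hε.le

end Weighted

/-! ### The Helffer–Sjöstrand variational problem -/

section HelfferSjostrand

variable {ι : Type*} [Fintype ι] [DecidableEq ι] {κ : Type*}

/-- The energy `∑ e, V (l_e φ - t_e)`. In the application `e` runs over the edges, `l_e φ = ∇φ(e)`, and
`t_e = ∇ℓ_ξ(e)`. -/
def edgeEnergy (V : ℝ → ℝ) (s : Finset κ) (l : κ → (ι → ℝ) →L[ℝ] ℝ) (t : κ → ℝ) (φ : ι → ℝ) : ℝ :=
  ∑ e ∈ s, V (l e φ - t e)

/-- The function `G = ∑ e, V' (l_e φ - t_e) β_e`, i.e. minus the derivative of `edgeEnergy` as `t` moves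
in the direction `β`. -/
def edgeForce (V : ℝ → ℝ) (s : Finset κ) (l : κ → (ι → ℝ) →L[ℝ] ℝ) (t β : κ → ℝ) (φ : ι → ℝ) : ℝ :=
  ∑ e ∈ s, deriv V (l e φ - t e) * β e

/-- The Helffer–Sjöstrand energy (without volume factor) of the field `β + l F`, where
`F : ι → (ι → ℝ) → ℝ` has derivatives `∂_j F_i = DF i j`. -/
def hsEnergy (V : ℝ → ℝ) (s : Finset κ) (l : κ → (ι → ℝ) →L[ℝ] ℝ) (t β : κ → ℝ)
    (F : ι → (ι → ℝ) → ℝ) (DF : ι → ι → (ι → ℝ) → ℝ) : ℝ :=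
  ∑ i, ∑ j, ∫ φ, DF i j φ ^ 2 ∂expMeasure (edgeEnergy V s l t) +
    ∑ e ∈ s, ∫ φ, deriv (deriv V) (l e φ - t e) * (β e + l e fun i => F i φ) ^ 2
      ∂expMeasure (edgeEnergy V s l t)

/-- The infimum of `hsEnergy`: `⟨∑ e, V'' (l_e φ - t_e) β_e²⟩ - Var G`. -/
def hsMin (V : ℝ → ℝ) (s : Finset κ) (l : κ → (ι → ℝ) →L[ℝ] ℝ) (t β : κ → ℝ) : ℝ :=
  (∑ e ∈ s, ∫ φ, deriv (deriv V) (l e φ - t e) * β e ^ 2 ∂expMeasure (edgeEnergy V s l t)) -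
    ∫ φ, (edgeForce V s l t β φ -
      ∫ ψ, edgeForce V s l t β ψ ∂expMeasure (edgeEnergy V s l t)) ^ 2
      ∂expMeasure (edgeEnergy V s l t)

variable {V : ℝ → ℝ} {s : Finset κ} {l : κ → (ι → ℝ) →L[ℝ] ℝ} {t β : κ → ℝ}

lemma contDiff_edgeEnergy (hV : ContDiff ℝ 2 V) : ContDiff ℝ 2 (edgeEnergy V s l t) :=
  ContDiff.sum fun e _ => hV.comp ((l e).contDiff.sub contDiff_const)

lemma contDiff_deriv (hV : ContDiff ℝ 2 V) : ContDiff ℝ 1 (deriv V) :=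
  ((contDiff_succ_iff_deriv (n := 1)).1 hV).2.2

lemma continuous_deriv_deriv (hV : ContDiff ℝ 2 V) : Continuous (deriv (deriv V)) :=
  (contDiff_deriv hV).continuous_deriv le_rfl

lemma contDiff_edgeForce (hV : ContDiff ℝ 2 V) : ContDiff ℝ 1 (edgeForce V s l t β) :=
  ContDiff.sum fun e _ =>
    ((contDiff_deriv hV).comp ((l e).contDiff.sub contDiff_const)).mul contDiff_const

lemma pd_comp_affine {f : ℝ → ℝ} (hf : Differentiable ℝ f) (L : (ι → ℝ) →L[ℝ] ℝ) (c : ℝ) (i : ι)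
    (φ : ι → ℝ) : pd i (fun ψ => f (L ψ - c)) φ = deriv f (L φ - c) * L (Pi.single i 1) := by
  have h1 : HasFDerivAt (fun ψ => L ψ - c) L φ := L.hasFDerivAt.sub_const c
  have h2 : HasFDerivAt (fun ψ => f (L ψ - c)) (deriv f (L φ - c) • L) φ :=
    (hf (L φ - c)).hasDerivAt.comp_hasFDerivAt φ h1
  rw [pd, h2.fderiv]
  simp

lemma pd_edgeEnergy (hV : ContDiff ℝ 2 V) (i : ι) :
    pd i (edgeEnergy V s l t) = edgeForce V s l t fun e => l e (Pi.single i 1) := by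
  have hd : Differentiable ℝ V := hV.differentiable (by simp)
  funext φ
  refine (pd_sum s (fun e _ => hd.comp ((l e).differentiable.sub_const _)) i φ).trans ?_
  exact Finset.sum_congr rfl fun e _ => pd_comp_affine hd (l e) (t e) i φ

lemma pd_edgeForce (hV : ContDiff ℝ 2 V) (i : ι) (φ : ι → ℝ) :
    pd i (edgeForce V s l t β) φ =
      ∑ e ∈ s, deriv (deriv V) (l e φ - t e) * β e * l e (Pi.single i 1) := by
  have hd : Differentiable ℝ (deriv V) := (contDiff_deriv hV).differentiable (by simp)
  have hd' : ∀ e, Differentiable ℝ fun φ => deriv V (l e φ - t e) :=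
    fun e => hd.comp ((l e).differentiable.sub_const _)
  refine (pd_sum s (fun e _ => (hd' e).mul_const (β e)) i φ).trans ?_
  refine Finset.sum_congr rfl fun e _ => ?_
  have h1 := congrFun (pd_const_mul (β e) (hd' e) i) φ
  simp only [mul_comm (β e)] at h1
  rw [h1, pd_comp_affine hd]
  ring

lemma clm_pi_apply (L : (ι → ℝ) →L[ℝ] ℝ) (v : ι → ℝ) : L v = ∑ i, v i * L (Pi.single i 1) := by
  conv_lhs => rw [pi_eq_sum_univ' v]
  simp [map_sum, map_smul]

/-- The pointwise form of `integral_gradAdj_sq` for `edgeEnergy`: the zeroth order term of the energy is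
given by its Hessian. -/
lemma edge_quadratic_identity (hV : ContDiff ℝ 2 V) (w : ι → ℝ) (φ : ι → ℝ) :
    ∑ e ∈ s, deriv (deriv V) (l e φ - t e) * (β e + l e w) ^ 2 =
      ∑ e ∈ s, deriv (deriv V) (l e φ - t e) * β e ^ 2 +
      2 * ∑ i, w i * pd i (edgeForce V s l t β) φ +
      ∑ i, ∑ j, w i * w j * pd i (pd j (edgeEnergy V s l t)) φ := by
  have h1 : ∑ i, w i * pd i (edgeForce V s l t β) φ =
      ∑ e ∈ s, deriv (deriv V) (l e φ - t e) * β e * l e w := by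
    simp only [pd_edgeForce hV, Finset.mul_sum]
    rw [Finset.sum_comm]
    refine Finset.sum_congr rfl fun e _ => ?_
    rw [clm_pi_apply (l e) w, Finset.mul_sum]
    exact Finset.sum_congr rfl fun i _ => by ring
  have h2 : ∑ i, ∑ j, w i * w j * pd i (pd j (edgeEnergy V s l t)) φ =
      ∑ e ∈ s, deriv (deriv V) (l e φ - t e) * (l e w * l e w) := by
    simp only [pd_edgeEnergy hV, pd_edgeForce hV, Finset.mul_sum]
    have : ∀ e, deriv (deriv V) (l e φ - t e) * (l e w * l e w) = ∑ i, ∑ j,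
        w i * w j * (deriv (deriv V) (l e φ - t e) * l e (Pi.single j 1) *
          l e (Pi.single i 1)) := fun e => by
      rw [clm_pi_apply (l e) w, Finset.sum_mul_sum, Finset.mul_sum]
      refine Finset.sum_congr rfl fun i _ => ?_
      rw [Finset.mul_sum]
      exact Finset.sum_congr rfl fun j _ => by ring
    simp only [this]
    rw [Finset.sum_comm]
    conv_rhs => rw [Finset.sum_comm]
    rw [Finset.sum_comm]
    refine Finset.sum_congr rfl fun i _ => ?_
    rw [Finset.sum_comm]
  rw [h1, h2, Finset.mul_sum, ← Finset.sum_add_distrib, ← Finset.sum_add_distrib]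
  exact Finset.sum_congr rfl fun e _ => by ring

/-- Completing the square: the energy of a smooth field exceeds `hsMin` by the norm of
`∇^* w + G - ⟨G⟩` and a term measuring how far `w` is from being a gradient. -/
lemma hsEnergy_eq (hV : ContDiff ℝ 2 V) {Λ : ℝ} (hΛ : ∀ x, |deriv (deriv V) x| ≤ Λ)
    (hi : Integrable fun φ => Real.exp (-edgeEnergy V s l t φ))
    (hG : MemLp (edgeForce V s l t β) 2 (expMeasure (edgeEnergy V s l t)))
    {w : ι → (ι → ℝ) → ℝ} (hw : ∀ i, ContDiff ℝ 2 (w i)) (hc : ∀ i, HasCompactSupport (w i)) :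
    hsEnergy V s l t β w (fun i j => pd j (w i)) = hsMin V s l t β +
      ∫ φ, (gradAdj (edgeEnergy V s l t) w φ + (edgeForce V s l t β φ -
        ∫ ψ, edgeForce V s l t β ψ ∂expMeasure (edgeEnergy V s l t))) ^ 2
        ∂expMeasure (edgeEnergy V s l t) +
      ∫ φ, ∑ i, ∑ j, (pd j (w i) φ ^ 2 - pd j (w i) φ * pd i (w j) φ)
        ∂expMeasure (edgeEnergy V s l t) := by
  have hH : ContDiff ℝ 2 (edgeEnergy V s l t) := contDiff_edgeEnergy hV
  have hH1 : ContDiff ℝ 1 (edgeEnergy V s l t) := hH.of_le (by norm_num)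
  have hw1 : ∀ i, ContDiff ℝ 1 (w i) := fun i => (hw i).of_le (by norm_num)
  have hprob := isProbabilityMeasure_expMeasure hi
  have hmean := integral_expMeasure hH.continuous hi
  have hGC : ContDiff ℝ 1 (edgeForce V s l t β) := contDiff_edgeForce hV
  simp only [hsEnergy, hsMin]
  set H := edgeEnergy V s l t with hHdef
  set μ := expMeasure H with hμ
  set G := edgeForce V s l t β with hGdef
  set m := ∫ ψ, G ψ ∂μ with hm
  set δ := gradAdj H w with hδ
  have hδC : Continuous δ := (contDiff_gradAdj hH hw).continuous
  have hδc : HasCompactSupport δ := hasCompactSupport_gradAdj hc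
  have hpw : ∀ i j, Continuous (pd j (w i)) := fun i j => continuous_pd (hw1 i) j
  have hpwc : ∀ i j, HasCompactSupport (pd j (w i)) := fun i j => hasCompactSupport_pd (hc i) j
  have haC : ∀ e, Continuous fun φ => deriv (deriv V) (l e φ - t e) := fun e =>
    (continuous_deriv_deriv hV).comp ((l e).continuous.sub continuous_const)
  have hpwi : ∀ i j, Integrable (fun φ => pd j (w i) φ ^ 2) μ := fun i j => by
    refine ((hpw i j).pow 2).integrable_of_hasCompactSupport ?_
    simpa only [pow_two] using! (hpwc i j).mul_right (f' := pd j (w i))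
  have hβi : ∀ e, Integrable (fun φ => deriv (deriv V) (l e φ - t e) * β e ^ 2) μ := fun e =>
    ((Integrable.of_bound (haC e).aestronglyMeasurable Λ
      (ae_of_all _ fun φ => hΛ _)).mul_const _)
  set Q : (ι → ℝ) → ℝ := fun φ =>
    ∑ i, ∑ j, (pd j (w i) φ * pd i (w j) φ + w i φ * w j φ * pd i (pd j H) φ) with hQ
  set P : (ι → ℝ) → ℝ := fun φ =>
    ∑ i, ∑ j, (pd j (w i) φ ^ 2 - pd j (w i) φ * pd i (w j) φ) with hP
  set S : (ι → ℝ) → ℝ := fun φ => ∑ i, w i φ * pd i G φ with hS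
  have hQi : Integrable Q μ := by
    refine integrable_finsetSum _ fun i _ => integrable_finsetSum _ fun j _ => ?_
    refine Continuous.integrable_of_hasCompactSupport ?_ ?_
    · exact ((hpw i j).mul (hpw j i)).add (((hw i).continuous.mul (hw j).continuous).mul
        (continuous_pd (contDiff_pd hH (by norm_num) j) i))
    · exact (hpwc i j).mul_right.add ((hc i).mul_right).mul_right
  have hPi : Integrable P μ := by
    refine integrable_finsetSum _ fun i _ => integrable_finsetSum _ fun j _ => ?_
    exact (hpwi i j).sub (((hpw i j).mul (hpw j i)).integrable_of_hasCompactSupport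
      (hpwc i j).mul_right)
  have hSi : Integrable S μ := by
    refine integrable_finsetSum _ fun i _ => ?_
    exact ((hw i).continuous.mul (continuous_pd hGC i)).integrable_of_hasCompactSupport
      (hc i).mul_right
  have hδ2 : Integrable (fun φ => δ φ ^ 2) μ := by
    refine (hδC.pow 2).integrable_of_hasCompactSupport ?_
    simpa only [pow_two] using! hδc.mul_right (f' := δ)
  have hδi : Integrable δ μ := hδC.integrable_of_hasCompactSupport hδc
  have hδG : Integrable (fun φ => δ φ * G φ) μ :=
    (hδC.mul hGC.continuous).integrable_of_hasCompactSupport hδc.mul_right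
  have hGm : Integrable (fun φ => (G φ - m) ^ 2) μ := (hG.sub (memLp_const m)).integrable_sq
  -- the three integrations by parts
  have k1 : ∫ φ, δ φ ^ 2 ∂μ = ∫ φ, Q φ ∂μ := by
    rw [hmean, hmean, integral_gradAdj_sq hH hw hc]
  have k2 : ∫ φ, δ φ * G φ ∂μ = ∫ φ, S φ ∂μ := by
    rw [hmean, hmean, integral_gradAdj_mul hH1 hw1 hc hGC]
    congr 1
    rw [← integral_finsetSum _ fun i _ => ?_]
    · simp only [hS, Finset.sum_mul]
    · exact (((hw i).continuous.mul (continuous_pd hGC i)).mul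
        (continuous_exp_neg hH1)).integrable_of_hasCompactSupport (hc i).mul_right.mul_right
  have k3 : ∫ φ, δ φ ∂μ = 0 := by
    have h := integral_gradAdj_mul hH1 hw1 hc (contDiff_const (c := (1 : ℝ)))
    have h0 : ∀ i φ, pd i (fun _ : ι → ℝ => (1 : ℝ)) φ = 0 := fun i φ => by simp [pd]
    simp only [mul_one, h0, mul_zero, zero_mul, integral_zero, Finset.sum_const_zero] at h
    rw [hmean, h, mul_zero]
  have e1 : ∫ φ, (δ φ + (G φ - m)) ^ 2 ∂μ =
      ∫ φ, Q φ ∂μ + 2 * ∫ φ, S φ ∂μ + ∫ φ, (G φ - m) ^ 2 ∂μ := by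
    have e : ∀ φ, (δ φ + (G φ - m)) ^ 2 =
        ((δ φ ^ 2 + 2 * (δ φ * G φ)) + (-(2 * m)) * δ φ) + (G φ - m) ^ 2 := fun φ => by ring
    simp only [e]
    have i1 : Integrable (fun φ => δ φ ^ 2 + 2 * (δ φ * G φ)) μ := hδ2.add (hδG.const_mul 2)
    have i2 : Integrable (fun φ => δ φ ^ 2 + 2 * (δ φ * G φ) + (-(2 * m)) * δ φ) μ :=
      i1.add (hδi.const_mul _)
    rw [integral_add i2 hGm, integral_add i1 (hδi.const_mul _),
      integral_add hδ2 (hδG.const_mul 2), integral_const_mul, integral_const_mul, k1, k2, k3]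
    ring
  have hli : ∀ e, Integrable
      (fun φ => deriv (deriv V) (l e φ - t e) * (β e + l e fun i => w i φ) ^ 2) μ := by
    intro e
    have hlw : Continuous fun φ => l e fun i => w i φ :=
      (l e).continuous.comp (continuous_pi fun i => (hw i).continuous)
    have hlc : HasCompactSupport fun φ => l e fun i => w i φ := by
      simp only [fun φ => clm_pi_apply (l e) fun i => w i φ]
      exact hasCompactSupport_finset_sum _ fun i _ => (hc i).mul_right
    have e2 : ∀ φ, deriv (deriv V) (l e φ - t e) * (β e + l e fun i => w i φ) ^ 2 =
        deriv (deriv V) (l e φ - t e) * β e ^ 2 + (l e fun i => w i φ) *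
          (deriv (deriv V) (l e φ - t e) * (2 * β e + l e fun i => w i φ)) := fun φ => by ring
    refine Integrable.congr ?_ (ae_of_all _ fun φ => (e2 φ).symm)
    exact (hβi e).add ((hlw.mul ((haC e).mul (continuous_const.add
      hlw))).integrable_of_hasCompactSupport hlc.mul_right)
  have e3 : (∑ i, ∑ j, ∫ φ, pd j (w i) φ ^ 2 ∂μ) + ∑ e ∈ s, ∫ φ, deriv (deriv V) (l e φ - t e) *
      (β e + l e fun i => w i φ) ^ 2 ∂μ =
      (∑ e ∈ s, ∫ φ, deriv (deriv V) (l e φ - t e) * β e ^ 2 ∂μ) +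
      (∫ φ, P φ ∂μ + ∫ φ, Q φ ∂μ + 2 * ∫ φ, S φ ∂μ) := by
    have hsum : Integrable (fun φ => ∑ i, ∑ j, pd j (w i) φ ^ 2) μ :=
      integrable_finsetSum _ fun i _ => integrable_finsetSum _ fun j _ => hpwi i j
    have i0 : Integrable (fun φ => ∑ e ∈ s, deriv (deriv V) (l e φ - t e) *
        (β e + l e fun i => w i φ) ^ 2) μ := integrable_finsetSum _ fun e _ => hli e
    have i1 : Integrable (fun φ => ∑ e ∈ s, deriv (deriv V) (l e φ - t e) * β e ^ 2) μ :=
      integrable_finsetSum _ fun e _ => hβi e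
    have i2 : Integrable (fun φ => P φ + Q φ) μ := hPi.add hQi
    have i3 : Integrable (fun φ => P φ + Q φ + 2 * S φ) μ := i2.add (hSi.const_mul 2)
    rw [← integral_const_mul, ← integral_add hPi hQi, ← integral_add i2 (hSi.const_mul 2),
      ← integral_finsetSum _ fun e _ => hβi e, ← integral_add i1 i3,
      ← integral_finsetSum _ fun e _ => hli e]
    have : ∑ i, ∑ j, ∫ φ, pd j (w i) φ ^ 2 ∂μ = ∫ φ, ∑ i, ∑ j, pd j (w i) φ ^ 2 ∂μ := by
      rw [integral_finsetSum _ fun i _ => integrable_finsetSum _ fun j _ => hpwi i j]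
      exact Finset.sum_congr rfl fun i _ => (integral_finsetSum _ fun j _ => hpwi i j).symm
    rw [this, ← integral_add hsum i0]
    congr 1
    funext φ
    rw [edge_quadratic_identity hV (fun i => w i φ) φ]
    simp only [hP, hQ, hS, Finset.sum_add_distrib, Finset.sum_sub_distrib, ← hHdef, ← hGdef]
    ring
  rw [e3, e1]
  ring

lemma sum_sq_sub_mul_swap_nonneg (A : ι → ι → ℝ) :
    0 ≤ ∑ i, ∑ j, (A i j ^ 2 - A i j * A j i) := by
  have h : ∑ i, ∑ j, (A i j ^ 2 - A i j * A j i) = ∑ i, ∑ j, 1 / 2 * (A i j - A j i) ^ 2 := by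
    have h1 : ∑ i, ∑ j, A i j ^ 2 = ∑ i, ∑ j, A j i ^ 2 := Finset.sum_comm
    have h2 : ∑ i, ∑ j, 1 / 2 * (A i j - A j i) ^ 2 =
        1 / 2 * ∑ i, ∑ j, A i j ^ 2 + 1 / 2 * ∑ i, ∑ j, A j i ^ 2 - ∑ i, ∑ j, A i j * A j i := by
      simp only [Finset.mul_sum, ← Finset.sum_add_distrib, ← Finset.sum_sub_distrib]
      exact Finset.sum_congr rfl fun i _ => Finset.sum_congr rfl fun j _ => by ring
    rw [h2, ← h1]
    simp only [Finset.sum_sub_distrib]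
    ring
  rw [h]
  exact Finset.sum_nonneg fun i _ => Finset.sum_nonneg fun j _ => by positivity

/-- `hsMin` is a lower bound for the energy of every field in the Sobolev space; for smooth fields
this is `hsEnergy_eq`, and the energy is continuous for the Sobolev norm. -/
theorem hsMin_le_hsEnergy (hV : ContDiff ℝ 2 V) {Λ : ℝ} (hΛ : ∀ x, |deriv (deriv V) x| ≤ Λ)
    (hi : Integrable fun φ => Real.exp (-edgeEnergy V s l t φ))
    (hG : MemLp (edgeForce V s l t β) 2 (expMeasure (edgeEnergy V s l t)))
    {F : ι → (ι → ℝ) → ℝ} {DF : ι → ι → (ι → ℝ) → ℝ}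
    (hF : ∀ i, MemLp (F i) 2 (expMeasure (edgeEnergy V s l t)))
    (hDF : ∀ i j, MemLp (DF i j) 2 (expMeasure (edgeEnergy V s l t)))
    {w : ℕ → ι → (ι → ℝ) → ℝ} (hw : ∀ n i, ContDiff ℝ 2 (w n i))
    (hc : ∀ n i, HasCompactSupport (w n i))
    (hl : ∀ i, Tendsto (fun n => eLpNorm (w n i - F i) 2 (expMeasure (edgeEnergy V s l t)))
      atTop (𝓝 0))
    (hDl : ∀ i j, Tendsto (fun n => eLpNorm (pd j (w n i) - DF i j) 2
      (expMeasure (edgeEnergy V s l t))) atTop (𝓝 0)) :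
    hsMin V s l t β ≤ hsEnergy V s l t β F DF := by
  have hprob := isProbabilityMeasure_expMeasure hi
  have hle : ∀ n, hsMin V s l t β ≤ hsEnergy V s l t β (w n) (fun i j => pd j (w n i)) := by
    intro n
    rw [hsEnergy_eq hV hΛ hi hG (hw n) (hc n), add_assoc]
    refine le_add_of_nonneg_right (add_nonneg (integral_nonneg fun φ => sq_nonneg _)
      (integral_nonneg fun φ => ?_))
    exact sum_sq_sub_mul_swap_nonneg fun i j => pd j (w n i) φ
  refine ge_of_tendsto' (x := atTop) ?_ hle
  set μ := expMeasure (edgeEnergy V s l t) with hμ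
  have hwL : ∀ n i, MemLp (w n i) 2 μ := fun n i =>
    (hw n i).continuous.memLp_of_hasCompactSupport (hc n i)
  have hpL : ∀ n i j, MemLp (pd j (w n i)) 2 μ := fun n i j =>
    (continuous_pd ((hw n i).of_le (by norm_num)) j).memLp_of_hasCompactSupport
      (hasCompactSupport_pd (hc n i) j)
  refine Tendsto.add (tendsto_finsetSum _ fun i _ => tendsto_finsetSum _ fun j _ => ?_)
    (tendsto_finsetSum _ fun e _ => ?_)
  · simp only [pow_two]
    exact tendsto_integral_mul_of_tendsto_eLpNorm (fun n => hpL n i j) (hDF i j)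
      (fun n => hpL n i j) (hDF i j) (hDl i j) (hDl i j)
  · have haC : Continuous fun φ => deriv (deriv V) (l e φ - t e) :=
      (continuous_deriv_deriv hV).comp ((l e).continuous.sub continuous_const)
    have hsumL : ∀ f : ι → (ι → ℝ) → ℝ, (∀ i, MemLp (f i) 2 μ) →
        MemLp (fun φ => β e + l e fun i => f i φ) 2 μ := by
      intro f hf
      simp only [fun φ => clm_pi_apply (l e) fun i => f i φ]
      have h : MemLp (fun φ => ∑ i, f i φ * l e (Pi.single i 1)) 2 μ :=
        memLp_finsetSum Finset.univ (f := fun i φ => f i φ * l e (Pi.single i 1))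
          fun i _ => (hf i).mul_const _
      exact (memLp_const (β e)).add h
    have hconv : Tendsto (fun n => eLpNorm ((fun φ => β e + l e fun i => w n i φ) -
        fun φ => β e + l e fun i => F i φ) 2 μ) atTop (𝓝 0) := by
      have h1 : Tendsto (fun n => ∑ i, ‖l e (Pi.single i 1)‖ₑ * eLpNorm (w n i - F i) 2 μ) atTop
          (𝓝 (∑ i : ι, ‖l e (Pi.single i 1)‖ₑ * 0)) :=
        tendsto_finsetSum _ fun i _ => ENNReal.Tendsto.const_mul (hl i) (Or.inr enorm_ne_top)
      simp only [mul_zero, Finset.sum_const_zero] at h1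
      refine tendsto_of_tendsto_of_tendsto_of_le_of_le tendsto_const_nhds h1
        (fun _ => zero_le) fun n => ?_
      have e1 : ((fun φ => β e + l e fun i => w n i φ) - fun φ => β e + l e fun i => F i φ) =
          ∑ i, l e (Pi.single i 1) • (w n i - F i) := by
        funext φ
        simp only [Pi.sub_apply, Finset.sum_apply, Pi.smul_apply, smul_eq_mul,
          clm_pi_apply (l e) (fun i => w n i φ), clm_pi_apply (l e) (fun i => F i φ)]
        rw [add_sub_add_left_eq_sub, ← Finset.sum_sub_distrib]
        exact Finset.sum_congr rfl fun i _ => by ring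
      rw [e1]
      refine (eLpNorm_sum_le (fun i _ => ((hwL n i).sub (hF i)).1.const_smul _)
        (by norm_num)).trans ?_
      exact Finset.sum_le_sum fun i _ => (eLpNorm_const_smul ..).le
    simp only [pow_two]
    exact tendsto_integral_bounded_mul_mul haC.aestronglyMeasurable (fun φ => hΛ _)
      (fun n => hsumL _ (hwL n)) (hsumL _ hF) (fun n => hsumL _ (hwL n)) (hsumL _ hF) hconv hconv

/-- `hsMin` is approached by the energies of gradient fields `w = -∇u`, where `u` approximately solves
`∇^* ∇ u = G - ⟨G⟩`. -/
theorem exists_hsEnergy_lt (hV : ContDiff ℝ 2 V) {Λ : ℝ} (hΛ : ∀ x, |deriv (deriv V) x| ≤ Λ)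
    (hi : Integrable fun φ => Real.exp (-edgeEnergy V s l t φ))
    {C : ℝ} (hC : ∀ φ, Real.exp (-edgeEnergy V s l t φ) ≤ C)
    (hC' : ∀ i φ, pd i (edgeEnergy V s l t) φ ^ 2 * Real.exp (-edgeEnergy V s l t φ) ≤ C)
    (hG : MemLp (edgeForce V s l t β) 2 (expMeasure (edgeEnergy V s l t))) {ε : ℝ} (hε : 0 < ε) :
    ∃ w : ι → (ι → ℝ) → ℝ, (∀ i, ContDiff ℝ 2 (w i)) ∧ (∀ i, HasCompactSupport (w i)) ∧
      hsEnergy V s l t β w (fun i j => pd j (w i)) < hsMin V s l t β + ε := by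
  obtain ⟨u, hu, huc, hlt⟩ := exists_gradAdj_approx (contDiff_edgeEnergy hV) hi hC hC' hG hε
  have hu2 : ∀ i, ContDiff ℝ 2 (pd i u) := fun i => contDiff_pd (contDiff_infty.1 hu 3) (by norm_num) i
  have hw : ∀ i, ContDiff ℝ 2 fun φ => -1 * pd i u φ := fun i => contDiff_const.mul (hu2 i)
  have hc : ∀ i, HasCompactSupport fun φ => -1 * pd i u φ := fun i =>
    (hasCompactSupport_pd huc i).mul_left
  refine ⟨fun i φ => -1 * pd i u φ, hw, hc, ?_⟩
  rw [hsEnergy_eq hV hΛ hi hG hw hc]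
  have h0 : ∀ φ, ∑ i, ∑ j, (pd j (fun ψ => -1 * pd i u ψ) φ ^ 2 -
      pd j (fun ψ => -1 * pd i u ψ) φ * pd i (fun ψ => -1 * pd j u ψ) φ) = 0 := by
    intro φ
    refine Finset.sum_eq_zero fun i _ => Finset.sum_eq_zero fun j _ => ?_
    rw [pd_const_mul _ (differentiable_pd_of_contDiff_infty hu i),
      pd_const_mul _ (differentiable_pd_of_contDiff_infty hu j),
      pd_comm (contDiff_infty.1 hu 2) i j]
    ring
  simp only [h0, integral_zero, add_zero]
  have h1 : ∀ φ, (gradAdj (edgeEnergy V s l t) (fun i φ => -1 * pd i u φ) φ +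
      (edgeForce V s l t β φ -
        ∫ ψ, edgeForce V s l t β ψ ∂expMeasure (edgeEnergy V s l t))) ^ 2 =
      (gradAdj (edgeEnergy V s l t) (fun i => pd i u) φ - (edgeForce V s l t β φ -
        ∫ ψ, edgeForce V s l t β ψ ∂expMeasure (edgeEnergy V s l t))) ^ 2 := by
    intro φ
    rw [gradAdj_const_mul (-1) (differentiable_pd_of_contDiff_infty hu)]
    ring
  simp only [h1]
  linarith

end HelfferSjostrand

/-! ### Growth of the potential -/

section Potential

variable {γ lam Lam M : ℝ} {V : ℝ → ℝ}

lemma IsPotential.abs_deriv_deriv_le (hV : IsPotential γ lam Lam M V) (t : ℝ) :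
    |deriv (deriv V) t| ≤ Lam := by
  rw [abs_of_nonneg (hV.lam_pos.le.trans (hV.lower t))]
  exact hV.upper t

lemma IsPotential.differentiable_deriv (hV : IsPotential γ lam Lam M V) :
    Differentiable ℝ (deriv V) := (contDiff_deriv hV.contDiff).differentiable (by simp)

lemma IsPotential.differentiable (hV : IsPotential γ lam Lam M V) :
    Differentiable ℝ V := hV.contDiff.differentiable (by simp)

lemma IsPotential.deriv_zero (hV : IsPotential γ lam Lam M V) : deriv V 0 = 0 := by
  have h : (fun t => V (-t)) = V := funext hV.even
  have h1 := deriv_comp_neg V 0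
  rw [h, neg_zero] at h1
  linarith

lemma IsPotential.abs_deriv_le (hV : IsPotential γ lam Lam M V) (t : ℝ) :
    |deriv V t| ≤ Lam * |t| := by
  have h := Convex.norm_image_sub_le_of_norm_deriv_le (f := deriv V) (s := Set.univ) (x := 0) (y := t)
    (fun x _ => hV.differentiable_deriv x) (fun x _ => hV.abs_deriv_deriv_le x) convex_univ
    (Set.mem_univ _) (Set.mem_univ _)
  simpa [hV.deriv_zero] using h

/-- Uniform convexity and evenness give quadratic growth. -/
lemma IsPotential.quadratic_lower_bound (hV : IsPotential γ lam Lam M V) (t : ℝ) :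
    V 0 + lam / 2 * t ^ 2 ≤ V t := by
  have hq : ∀ x : ℝ, HasDerivAt (fun x : ℝ => lam / 2 * x ^ 2) (lam * x) x := fun x => by
    have := (hasDerivAt_pow 2 x).const_mul (lam / 2)
    refine this.congr_deriv ?_
    simp
    ring
  have hl : ∀ x : ℝ, HasDerivAt (fun x : ℝ => lam * x) lam x := fun x => by
    simpa using (hasDerivAt_id x).const_mul lam
  have h1 : Monotone fun x => deriv V x - lam * x := by
    refine monotone_of_deriv_nonneg (hV.differentiable_deriv.sub fun x =>
      (hl x).differentiableAt) fun x => ?_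
    have := ((hV.differentiable_deriv x).hasDerivAt.sub (hl x)).deriv
    have h2 := hV.lower x
    change 0 ≤ deriv (deriv V - fun x => lam * x) x
    rw [this]
    linarith
  have h2 : MonotoneOn (fun x => V x - lam / 2 * x ^ 2) (Set.Ici 0) := by
    have hd : ∀ x, HasDerivAt (fun x => V x - lam / 2 * x ^ 2) (deriv V x - lam * x) x := fun x =>
      (hV.differentiable x).hasDerivAt.sub (hq x)
    refine monotoneOn_of_deriv_nonneg (convex_Ici 0) (fun x _ => (hd x).continuousAt.continuousWithinAt)
      (fun x _ => (hd x).differentiableAt.differentiableWithinAt) fun x hx => ?_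
    rw [interior_Ici] at hx
    rw [(hd x).deriv]
    have := h1 (le_of_lt hx)
    simpa [hV.deriv_zero] using this
  have h3 : ∀ x, 0 ≤ x → V 0 + lam / 2 * x ^ 2 ≤ V x := fun x hx => by
    have := h2 Set.self_mem_Ici hx hx
    simp only at this
    linarith
  rcases le_total 0 t with ht | ht
  · exact h3 t ht
  · have := h3 (-t) (by linarith)
    rwa [hV.even, neg_sq] at this

end Potential

/-! ### Gaussian domination -/

section Envelope

variable {X : Type*} [NormedAddCommGroup X] [NormedSpace ℝ X] [FiniteDimensional ℝ X]

/-- The dominating functions `(1 + ‖φ‖)^k e^{-a ‖φ‖²}`. -/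
def envelope (a : ℝ) (k : ℕ) (φ : X) : ℝ := (1 + ‖φ‖) ^ k * Real.exp (-(a * ‖φ‖ ^ 2))

lemma envelope_nonneg (a : ℝ) (k : ℕ) (φ : X) : 0 ≤ envelope a k φ := by
  unfold envelope; positivity

lemma continuous_envelope (a : ℝ) (k : ℕ) : Continuous (envelope a k : X → ℝ) := by
  unfold envelope; fun_prop

lemma exists_envelope_le {a : ℝ} (ha : 0 < a) (k : ℕ) : ∃ C : ℝ, ∀ φ : X, envelope a k φ ≤ C := by
  refine ⟨k.factorial * Real.exp (1 + 1 / (4 * a)), fun φ => ?_⟩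
  have h1 := Real.pow_div_factorial_le_exp (1 + ‖φ‖) (by positivity) k
  rw [div_le_iff₀ (by positivity)] at h1
  -- the polynomial is absorbed by `e^{1 + ‖φ‖}`, and the exponent is bounded by completing the square
  have h2 : 1 + ‖φ‖ + -(a * ‖φ‖ ^ 2) ≤ 1 + 1 / (4 * a) := by
    have : 1 / (4 * a) - ‖φ‖ + a * ‖φ‖ ^ 2 = a * (‖φ‖ - 1 / (2 * a)) ^ 2 := by
      field_simp
      ring
    nlinarith [mul_nonneg ha.le (sq_nonneg (‖φ‖ - 1 / (2 * a)))]
  calc envelope a k φ ≤ Real.exp (1 + ‖φ‖) * k.factorial * Real.exp (-(a * ‖φ‖ ^ 2)) := by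
        unfold envelope; gcongr
    _ = k.factorial * Real.exp (1 + ‖φ‖ + -(a * ‖φ‖ ^ 2)) := by rw [Real.exp_add (1 + ‖φ‖)]; ring
    _ ≤ _ := by gcongr

lemma integrable_envelope [MeasurableSpace X] [BorelSpace X] (μ : Measure X) [μ.IsAddHaarMeasure]
    {a : ℝ} (ha : 0 < a) (k : ℕ) : Integrable (envelope a k : X → ℝ) μ := by
  set n := Module.finrank ℝ X + 1 with hn
  obtain ⟨C, hC⟩ := exists_envelope_le (X := X) ha (k + n)
  have hi : Integrable (fun φ : X => C * (1 + ‖φ‖) ^ (-(n : ℝ))) μ :=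
    (integrable_one_add_norm (by rw [hn]; push_cast; linarith)).const_mul C
  refine hi.mono' (continuous_envelope a k).aestronglyMeasurable (ae_of_all _ fun φ => ?_)
  have hp : 0 < (1 + ‖φ‖) ^ n := by positivity
  rw [Real.norm_of_nonneg (envelope_nonneg a k φ), Real.rpow_neg (by positivity), Real.rpow_natCast,
    ← div_eq_mul_inv, le_div_iff₀ hp]
  refine le_trans (le_of_eq ?_) (hC φ)
  unfold envelope
  rw [pow_add]
  ring

end Envelope

/-! ### Differentiation of the partition function -/

section Tilt

variable {ι : Type*} [Fintype ι] [DecidableEq ι] {κ : Type*} {E : Type*} [NormedAddCommGroup E]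
  [NormedSpace ℝ E]

/-- Differentiation under the integral sign with locally uniform domination. -/
lemma hasFDerivAt_integral_of_locally_dominated {X : Type*} [TopologicalSpace X] [MeasurableSpace X]
    [OpensMeasurableSpace X] {μ : Measure X} {F : E → X → ℝ} {F' : E → X → E →L[ℝ] ℝ}
    [SecondCountableTopologyEither X (E →L[ℝ] ℝ)]
    (hF : ∀ ξ, Continuous (F ξ)) (hF' : ∀ ξ, Continuous (F' ξ))
    (hd : ∀ ξ x, HasFDerivAt (fun η => F η x) (F' ξ x) ξ)
    (hb : ∀ R : ℝ, ∃ B : X → ℝ, Integrable B μ ∧ ∀ ξ, ‖ξ‖ ≤ R → ∀ x, |F ξ x| ≤ B x ∧ ‖F' ξ x‖ ≤ B x)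
    (ξ : E) : HasFDerivAt (fun η => ∫ x, F η x ∂μ) (∫ x, F' ξ x ∂μ) ξ := by
  obtain ⟨B, hB, hle⟩ := hb (‖ξ‖ + 1)
  refine hasFDerivAt_integral_of_dominated_of_fderiv_le (s := Metric.ball ξ 1)
    (Metric.ball_mem_nhds ξ one_pos)
    (Eventually.of_forall fun η => (hF η).aestronglyMeasurable) ?_ (hF' ξ).aestronglyMeasurable
    (ae_of_all _ fun x η hη => (hle η ?_ x).2) hB (ae_of_all _ fun x η _ => hd η x)
  · exact hB.mono' (hF ξ).aestronglyMeasurable (ae_of_all _ fun x => (hle ξ (by linarith) x).1)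
  · have : ‖η - ξ‖ < 1 := by simpa [dist_eq_norm] using hη
    linarith [norm_le_norm_add_norm_sub' η ξ]

variable {γ lam Lam M : ℝ} {V : ℝ → ℝ} {s : Finset κ} {l : κ → (ι → ℝ) →L[ℝ] ℝ} {b : κ → E →L[ℝ] ℝ}

/-- Gaussian bound for the weight, locally uniform in the tilt. -/
lemma exists_exp_neg_edgeEnergy_le (hV : IsPotential γ lam Lam M V) {c : ℝ}
    (hco : ∀ φ, c * ‖φ‖ ^ 2 ≤ ∑ e ∈ s, l e φ ^ 2) (R : ℝ) :
    ∃ C : ℝ, 0 < C ∧ ∀ ξ : E, ‖ξ‖ ≤ R → ∀ φ : ι → ℝ,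
      Real.exp (-edgeEnergy V s l (fun e => b e ξ) φ) ≤
        C * Real.exp (-(lam * c / 4 * ‖φ‖ ^ 2)) := by
  have hlam := hV.lam_pos
  refine ⟨Real.exp (-(∑ e ∈ s, (V 0 - lam / 2 * (‖b e‖ * R) ^ 2))), Real.exp_pos _,
    fun ξ hξ φ => ?_⟩
  rw [← Real.exp_add, Real.exp_le_exp]
  have h1 : ∑ e ∈ s, ((V 0 - lam / 2 * (‖b e‖ * R) ^ 2) + lam / 4 * l e φ ^ 2) ≤
      edgeEnergy V s l (fun e => b e ξ) φ := by
    refine Finset.sum_le_sum fun e _ => ?_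
    have h2 := hV.quadratic_lower_bound (l e φ - b e ξ)
    have h3 : (b e ξ) ^ 2 ≤ (‖b e‖ * R) ^ 2 := by
      rw [← sq_abs]
      have : |b e ξ| ≤ ‖b e‖ * R := (b e).le_opNorm_of_le hξ
      gcongr
    -- `x² ≤ 2 (x - b)² + 2 b²`
    have h4 : lam * l e φ ^ 2 / 4 ≤ lam / 2 * (l e φ - b e ξ) ^ 2 + lam / 2 * (b e ξ) ^ 2 := by
      nlinarith [mul_nonneg hlam.le (sq_nonneg (l e φ - 2 * b e ξ))]
    have h5 : lam / 2 * (b e ξ) ^ 2 ≤ lam / 2 * (‖b e‖ * R) ^ 2 := by gcongr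
    linarith
  rw [Finset.sum_add_distrib, ← Finset.mul_sum] at h1
  have h6 := mul_le_mul_of_nonneg_left (hco φ) (by positivity : 0 ≤ lam / 4)
  linarith

/-- The covector `∑ e, V' (l_e φ - b_e ξ) b_e`, i.e. minus the derivative of the energy in `ξ`. -/
def tiltForce (V : ℝ → ℝ) (s : Finset κ) (l : κ → (ι → ℝ) →L[ℝ] ℝ) (b : κ → E →L[ℝ] ℝ) (ξ : E)
    (φ : ι → ℝ) : E →L[ℝ] ℝ := ∑ e ∈ s, deriv V (l e φ - b e ξ) • b e

/-- The covector `∑ e, V'' (l_e φ - b_e ξ) (b_e p) b_e`, i.e. minus the derivative of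
`edgeForce` in `ξ`, for the direction `β_e = b_e p`. -/
def tiltHess (V : ℝ → ℝ) (s : Finset κ) (l : κ → (ι → ℝ) →L[ℝ] ℝ) (b : κ → E →L[ℝ] ℝ) (ξ p : E)
    (φ : ι → ℝ) : E →L[ℝ] ℝ := ∑ e ∈ s, (deriv (deriv V) (l e φ - b e ξ) * b e p) • b e

lemma tiltForce_apply (ξ p : E) (φ : ι → ℝ) :
    tiltForce V s l b ξ φ p = edgeForce V s l (fun e => b e ξ) (fun e => b e p) φ := by
  simp [tiltForce, edgeForce]

lemma tiltHess_apply (ξ p v : E) (φ : ι → ℝ) :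
    tiltHess V s l b ξ p φ v = ∑ e ∈ s, deriv (deriv V) (l e φ - b e ξ) * b e p * b e v := by
  simp [tiltHess]

lemma continuous_tiltForce (hV : ContDiff ℝ 2 V) (ξ : E) : Continuous (tiltForce V s l b ξ) :=
  continuous_finsetSum _ fun e _ => ((contDiff_deriv hV).continuous.comp
    ((l e).continuous.sub continuous_const)).smul continuous_const

lemma continuous_tiltHess (hV : ContDiff ℝ 2 V) (ξ p : E) : Continuous (tiltHess V s l b ξ p) :=
  continuous_finsetSum _ fun e _ => (((continuous_deriv_deriv hV).comp
    ((l e).continuous.sub continuous_const)).mul continuous_const).smul continuous_const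

lemma exists_norm_tiltForce_le (hV : IsPotential γ lam Lam M V) (R : ℝ) :
    ∃ K : ℝ, 0 ≤ K ∧ ∀ ξ : E, ‖ξ‖ ≤ R → ∀ φ : ι → ℝ,
      ‖tiltForce V s l b ξ φ‖ ≤ K * (1 + ‖φ‖) := by
  have hLam : 0 ≤ Lam := hV.lam_pos.le.trans hV.lam_le
  refine ⟨∑ e ∈ s, Lam * (‖l e‖ + ‖b e‖ * |R|) * ‖b e‖, by positivity, fun ξ hξ φ => ?_⟩
  refine (norm_sum_le _ _).trans ?_
  rw [Finset.sum_mul]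
  refine Finset.sum_le_sum fun e _ => ?_
  rw [norm_smul, Real.norm_eq_abs]
  have h1 : |l e φ - b e ξ| ≤ (‖l e‖ + ‖b e‖ * |R|) * (1 + ‖φ‖) := by
    have h2 : |l e φ| ≤ ‖l e‖ * ‖φ‖ := (l e).le_opNorm φ
    have h3 : |b e ξ| ≤ ‖b e‖ * |R| := (b e).le_opNorm_of_le (hξ.trans (le_abs_self R))
    have h4 : 0 ≤ ‖b e‖ * |R| * ‖φ‖ := by positivity
    have h5 := norm_nonneg (l e)
    calc _ ≤ |l e φ| + |b e ξ| := abs_sub _ _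
      _ ≤ _ := by nlinarith
  calc _ ≤ Lam * |l e φ - b e ξ| * ‖b e‖ :=
        mul_le_mul_of_nonneg_right (hV.abs_deriv_le _) (norm_nonneg _)
    _ ≤ Lam * ((‖l e‖ + ‖b e‖ * |R|) * (1 + ‖φ‖)) * ‖b e‖ := by gcongr
    _ = _ := by ring

lemma norm_tiltHess_le (hV : IsPotential γ lam Lam M V) (ξ p : E) (φ : ι → ℝ) :
    ‖tiltHess V s l b ξ p φ‖ ≤ ∑ e ∈ s, Lam * |b e p| * ‖b e‖ := by
  refine (norm_sum_le _ _).trans (Finset.sum_le_sum fun e _ => ?_)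
  rw [norm_smul, norm_mul, Real.norm_eq_abs, Real.norm_eq_abs]
  have := hV.abs_deriv_deriv_le (l e φ - b e ξ)
  gcongr

/-- The bounds needed for differentiation under the integral: up to constants, the weight times a
quadratic polynomial in the force is dominated by a Gaussian envelope. -/
lemma exists_envelope_bound (hV : IsPotential γ lam Lam M V) {c : ℝ} (hc : 0 < c)
    (hco : ∀ φ, c * ‖φ‖ ^ 2 ≤ ∑ e ∈ s, l e φ ^ 2) (R : ℝ) :
    ∃ C a : ℝ, 0 < a ∧ 0 ≤ C ∧ ∀ ξ : E, ‖ξ‖ ≤ R → ∀ φ : ι → ℝ,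
      Real.exp (-edgeEnergy V s l (fun e => b e ξ) φ) * (1 + ‖tiltForce V s l b ξ φ‖) ^ 2 ≤
        C * envelope a 2 φ := by
  obtain ⟨C, hC0, hC⟩ := exists_exp_neg_edgeEnergy_le (b := b) hV hco R
  obtain ⟨K, hK0, hK⟩ := exists_norm_tiltForce_le (s := s) (l := l) (b := b) hV R
  refine ⟨C * (1 + K) ^ 2, lam * c / 4, by have := hV.lam_pos; positivity, by positivity,
    fun ξ hξ φ => ?_⟩
  have h1 : 1 + ‖tiltForce V s l b ξ φ‖ ≤ (1 + K) * (1 + ‖φ‖) := by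
    have := hK ξ hξ φ
    have := norm_nonneg φ
    linarith
  calc _ ≤ C * Real.exp (-(lam * c / 4 * ‖φ‖ ^ 2)) * ((1 + K) * (1 + ‖φ‖)) ^ 2 :=
        mul_le_mul (hC ξ hξ φ) (by gcongr) (by positivity) (by positivity)
    _ = _ := by unfold envelope; ring

end Tilt

section PartitionFunction

variable {ι : Type*} [Fintype ι] [DecidableEq ι] {κ : Type*} {E : Type*} [NormedAddCommGroup E]
  [NormedSpace ℝ E]
  {γ lam Lam M : ℝ} {V : ℝ → ℝ} {s : Finset κ} {l : κ → (ι → ℝ) →L[ℝ] ℝ} {b : κ → E →L[ℝ] ℝ}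

/-- The partition function as a function of the tilt. -/
def tiltZ (V : ℝ → ℝ) (s : Finset κ) (l : κ → (ι → ℝ) →L[ℝ] ℝ) (b : κ → E →L[ℝ] ℝ) (ξ : E) : ℝ :=
  ∫ φ : ι → ℝ, Real.exp (-edgeEnergy V s l (fun e => b e ξ) φ)

/-- The unnormalized expectation of the force in the direction `p`, which is the derivative of `tiltZ` in
this direction. -/
def tiltN (V : ℝ → ℝ) (s : Finset κ) (l : κ → (ι → ℝ) →L[ℝ] ℝ) (b : κ → E →L[ℝ] ℝ) (p ξ : E) : ℝ :=
  ∫ φ : ι → ℝ, Real.exp (-edgeEnergy V s l (fun e => b e ξ) φ) * tiltForce V s l b ξ φ p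

lemma hasFDerivAt_comp_tilt {f : ℝ → ℝ} (hf : Differentiable ℝ f) (L : E →L[ℝ] ℝ) (c : ℝ) (ξ : E) :
    HasFDerivAt (fun η => f (c - L η)) (-(deriv f (c - L ξ) • L)) ξ := by
  have h1 : HasFDerivAt (fun η => c - L η) (-L) ξ := L.hasFDerivAt.const_sub c
  have h2 : HasFDerivAt (fun η => f (c - L η)) (deriv f (c - L ξ) • -L) ξ :=
    (hf (c - L ξ)).hasDerivAt.comp_hasFDerivAt ξ h1
  rwa [smul_neg] at h2

lemma hasFDerivAt_weight (hV : IsPotential γ lam Lam M V) (ξ : E) (φ : ι → ℝ) :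
    HasFDerivAt (fun η => Real.exp (-edgeEnergy V s l (fun e => b e η) φ))
      (Real.exp (-edgeEnergy V s l (fun e => b e ξ) φ) • tiltForce V s l b ξ φ) ξ := by
  have h : HasFDerivAt (fun η => edgeEnergy V s l (fun e => b e η) φ)
      (-tiltForce V s l b ξ φ) ξ := by
    rw [tiltForce, ← Finset.sum_neg_distrib]
    exact HasFDerivAt.fun_sum fun e _ => hasFDerivAt_comp_tilt hV.differentiable (b e) (l e φ) ξ
  simpa using h.fun_neg.exp

lemma hasFDerivAt_force (hV : IsPotential γ lam Lam M V) (ξ p : E) (φ : ι → ℝ) :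
    HasFDerivAt (fun η => tiltForce V s l b η φ p) (-tiltHess V s l b ξ p φ) ξ := by
  simp only [tiltForce_apply, edgeForce]
  rw [tiltHess, ← Finset.sum_neg_distrib]
  refine HasFDerivAt.fun_sum fun e _ => ?_
  have h := (hasFDerivAt_comp_tilt hV.differentiable_deriv (b e) (l e φ) ξ).mul_const (b e p)
  convert! h using 1
  ext v
  simp
  ring

section Coercive

variable (hV : IsPotential γ lam Lam M V) {c : ℝ} (hc : 0 < c)
  (hco : ∀ φ, c * ‖φ‖ ^ 2 ≤ ∑ e ∈ s, l e φ ^ 2)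

include hV hc hco

lemma hasFDerivAt_tiltZ (ξ : E) : HasFDerivAt (tiltZ V s l b)
    (∫ φ, Real.exp (-edgeEnergy V s l (fun e => b e ξ) φ) • tiltForce V s l b ξ φ) ξ := by
  have hw : ∀ ξ : E, Continuous fun φ => Real.exp (-edgeEnergy V s l (fun e => b e ξ) φ) := fun ξ =>
    Real.continuous_exp.comp (contDiff_edgeEnergy hV.contDiff).continuous.neg
  refine hasFDerivAt_integral_of_locally_dominated
    (F' := fun ξ φ => Real.exp (-edgeEnergy V s l (fun e => b e ξ) φ) • tiltForce V s l b ξ φ) hw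
    (fun ξ => (hw ξ).smul (continuous_tiltForce hV.contDiff ξ))
    (fun ξ φ => hasFDerivAt_weight hV ξ φ) (fun R => ?_) ξ
  obtain ⟨C, a, ha, -, h⟩ := exists_envelope_bound (b := b) hV hc hco R
  refine ⟨fun φ => C * envelope a 2 φ, (integrable_envelope volume ha 2).const_mul C,
    fun ξ hξ φ => ⟨?_, ?_⟩⟩
  · refine le_trans ?_ (h ξ hξ φ)
    rw [Real.abs_exp]
    refine le_mul_of_one_le_right (Real.exp_pos _).le ?_
    exact one_le_pow₀ (by linarith [norm_nonneg (tiltForce V s l b ξ φ)])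
  · refine le_trans ?_ (h ξ hξ φ)
    rw [norm_smul, Real.norm_eq_abs, Real.abs_exp]
    refine mul_le_mul_of_nonneg_left ?_ (Real.exp_pos _).le
    nlinarith [norm_nonneg (tiltForce V s l b ξ φ)]

lemma hasFDerivAt_tiltN (p ξ : E) : HasFDerivAt (tiltN V s l b p)
    (∫ φ, (Real.exp (-edgeEnergy V s l (fun e => b e ξ) φ) • -tiltHess V s l b ξ p φ +
      tiltForce V s l b ξ φ p •
        Real.exp (-edgeEnergy V s l (fun e => b e ξ) φ) • tiltForce V s l b ξ φ)) ξ := by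
  have hw : ∀ ξ : E, Continuous fun φ => Real.exp (-edgeEnergy V s l (fun e => b e ξ) φ) := fun ξ =>
    Real.continuous_exp.comp (contDiff_edgeEnergy hV.contDiff).continuous.neg
  have hT : ∀ ξ : E, Continuous (tiltForce V s l b ξ) := continuous_tiltForce hV.contDiff
  have hTp : ∀ ξ : E, Continuous fun φ => tiltForce V s l b ξ φ p := fun ξ =>
    (hT ξ).clm_apply continuous_const
  refine hasFDerivAt_integral_of_locally_dominated
    (F := fun ξ φ => Real.exp (-edgeEnergy V s l (fun e => b e ξ) φ) * tiltForce V s l b ξ φ p)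
    (F' := fun ξ φ => Real.exp (-edgeEnergy V s l (fun e => b e ξ) φ) • -tiltHess V s l b ξ p φ +
      tiltForce V s l b ξ φ p • Real.exp (-edgeEnergy V s l (fun e => b e ξ) φ) • tiltForce V s l b ξ φ)
    (fun ξ => (hw ξ).mul (hTp ξ))
    (fun ξ => ((hw ξ).smul (continuous_tiltHess hV.contDiff ξ p).neg).add
      ((hTp ξ).smul ((hw ξ).smul (hT ξ))))
    (fun ξ φ => (hasFDerivAt_weight hV ξ φ).mul (hasFDerivAt_force hV ξ p φ)) (fun R => ?_) ξ
  obtain ⟨C, a, ha, hC0, h⟩ := exists_envelope_bound (b := b) hV hc hco R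
  have hLam : 0 ≤ Lam := hV.lam_pos.le.trans hV.lam_le
  obtain ⟨K, hK⟩ : ∃ K, K = ∑ e ∈ s, Lam * |b e p| * ‖b e‖ := ⟨_, rfl⟩
  have hK0 : 0 ≤ K := by rw [hK]; positivity
  refine ⟨fun φ => (K + ‖p‖) * (C * envelope a 2 φ),
    ((integrable_envelope volume ha 2).const_mul C).const_mul _, fun ξ hξ φ => ?_⟩
  have hφ := h ξ hξ φ
  have hTle : |tiltForce V s l b ξ φ p| ≤ ‖tiltForce V s l b ξ φ‖ * ‖p‖ :=
    (tiltForce V s l b ξ φ).le_opNorm p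
  have hHle := norm_tiltHess_le (s := s) (l := l) (b := b) hV ξ p φ
  rw [← hK] at hHle
  have hx := norm_nonneg (tiltForce V s l b ξ φ)
  have hp := norm_nonneg p
  have hr0 := Real.exp_pos (-edgeEnergy V s l (fun e => b e ξ) φ)
  beta_reduce
  generalize Real.exp (-edgeEnergy V s l (fun e => b e ξ) φ) = r at *
  have hKp : 0 ≤ K + ‖p‖ := add_nonneg hK0 hp
  constructor
  · generalize ‖tiltForce V s l b ξ φ‖ = x at *
    rw [abs_mul, abs_of_pos hr0]
    calc r * |tiltForce V s l b ξ φ p| ≤ r * (x * ‖p‖) := by gcongr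
      _ ≤ (K + ‖p‖) * (r * (1 + x) ^ 2) := by
        have : x * ‖p‖ ≤ (K + ‖p‖) * (1 + x) ^ 2 := by
          have h1 : x ≤ (1 + x) ^ 2 := by nlinarith
          calc x * ‖p‖ ≤ (1 + x) ^ 2 * (K + ‖p‖) := by gcongr; linarith
            _ = _ := by ring
        calc _ ≤ r * ((K + ‖p‖) * (1 + x) ^ 2) := by gcongr
          _ = _ := by ring
      _ ≤ _ := mul_le_mul_of_nonneg_left hφ hKp
  · set x := ‖tiltForce V s l b ξ φ‖
    calc _ ≤ r * K + |tiltForce V s l b ξ φ p| * (r * x) := by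
          refine (norm_add_le _ _).trans (add_le_add ?_ ?_)
          · rw [norm_smul, norm_neg, Real.norm_of_nonneg hr0.le]
            gcongr
          · rw [norm_smul, norm_smul, Real.norm_of_nonneg hr0.le, Real.norm_eq_abs]
      _ ≤ r * K + x * ‖p‖ * (r * x) := by gcongr
      _ ≤ (K + ‖p‖) * (r * (1 + x) ^ 2) := by
        have h1 : K ≤ K * (1 + x) ^ 2 := le_mul_of_one_le_right hK0 (one_le_pow₀ (by linarith))
        have h2 : x * x ≤ (1 + x) ^ 2 := by nlinarith
        have h3 : ‖p‖ * (x * x) ≤ ‖p‖ * (1 + x) ^ 2 := by gcongr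
        have h4 := mul_le_mul_of_nonneg_left (add_le_add h1 h3) hr0.le
        linarith
      _ ≤ _ := mul_le_mul_of_nonneg_left hφ hKp

/-- Functions bounded by a quadratic polynomial in the force are integrable against the weight. -/
lemma integrable_weight_smul {F : Type*} [NormedAddCommGroup F] [NormedSpace ℝ F]
    (ξ : E) {f : (ι → ℝ) → F} (hf : Continuous f)
    {K : ℝ} (hK : ∀ φ, ‖f φ‖ ≤ K * (1 + ‖tiltForce V s l b ξ φ‖) ^ 2) :
    Integrable fun φ => Real.exp (-edgeEnergy V s l (fun e => b e ξ) φ) • f φ := by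
  obtain ⟨C, a, ha, hC0, h⟩ := exists_envelope_bound (b := b) hV hc hco ‖ξ‖
  have hw : Continuous fun φ => Real.exp (-edgeEnergy V s l (fun e => b e ξ) φ) :=
    Real.continuous_exp.comp (contDiff_edgeEnergy hV.contDiff).continuous.neg
  have hK0 : 0 ≤ K := by
    by_contra hneg
    have := (norm_nonneg _).trans (hK 0)
    have h2 : 0 < (1 + ‖tiltForce V s l b ξ 0‖) ^ 2 := by positivity
    nlinarith
  refine ((integrable_envelope volume ha 2).const_mul (K * C)).mono'
    (hw.smul hf).aestronglyMeasurable (ae_of_all _ fun φ => ?_)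
  rw [norm_smul, Real.norm_eq_abs, Real.abs_exp]
  calc _ ≤ Real.exp (-edgeEnergy V s l (fun e => b e ξ) φ) *
        (K * (1 + ‖tiltForce V s l b ξ φ‖) ^ 2) := by gcongr; exact hK φ
    _ = K * (Real.exp (-edgeEnergy V s l (fun e => b e ξ) φ) *
        (1 + ‖tiltForce V s l b ξ φ‖) ^ 2) := by ring
    _ ≤ K * (C * envelope a 2 φ) := mul_le_mul_of_nonneg_left (h ξ le_rfl φ) hK0
    _ = _ := by ring

lemma integrable_weight (ξ : E) :
    Integrable fun φ => Real.exp (-edgeEnergy V s l (fun e => b e ξ) φ) := by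
  have h := integrable_weight_smul (b := b) hV hc hco ξ (f := fun _ => (1 : ℝ)) continuous_const (K := 1)
    fun φ => by
      rw [norm_one, one_mul]
      exact one_le_pow₀ (by linarith [norm_nonneg (tiltForce V s l b ξ φ)])
  simpa using h

lemma tiltZ_pos (ξ : E) : 0 < tiltZ V s l b ξ :=
  integral_exp_neg_pos (integrable_weight hV hc hco ξ)

lemma integrable_weight_mul_force_mul_force (ξ p v : E) : Integrable fun φ =>
    Real.exp (-edgeEnergy V s l (fun e => b e ξ) φ) *
      (tiltForce V s l b ξ φ p * tiltForce V s l b ξ φ v) := by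
  have hT := continuous_tiltForce (s := s) (l := l) (b := b) hV.contDiff ξ
  refine integrable_weight_smul hV hc hco ξ
    ((hT.clm_apply continuous_const).mul (hT.clm_apply continuous_const)) (K := ‖p‖ * ‖v‖)
    fun φ => ?_
  have h1 := (tiltForce V s l b ξ φ).le_opNorm p
  have h2 := (tiltForce V s l b ξ φ).le_opNorm v
  have hx := norm_nonneg (tiltForce V s l b ξ φ)
  rw [norm_mul]
  set x := ‖tiltForce V s l b ξ φ‖
  calc _ ≤ x * ‖p‖ * (x * ‖v‖) := by gcongr
    _ = ‖p‖ * ‖v‖ * x ^ 2 := by ring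
    _ ≤ ‖p‖ * ‖v‖ * (1 + x) ^ 2 := by gcongr; linarith

lemma integrable_weight_mul_hess (ξ p v : E) : Integrable fun φ =>
    Real.exp (-edgeEnergy V s l (fun e => b e ξ) φ) * tiltHess V s l b ξ p φ v := by
  refine integrable_weight_smul hV hc hco ξ
    ((continuous_tiltHess hV.contDiff ξ p).clm_apply continuous_const)
    (K := (∑ e ∈ s, Lam * |b e p| * ‖b e‖) * ‖v‖) fun φ => ?_
  have h1 := (tiltHess V s l b ξ p φ).le_opNorm v
  have h2 := norm_tiltHess_le (s := s) (l := l) (b := b) hV ξ p φ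
  have hLam : 0 ≤ Lam := hV.lam_pos.le.trans hV.lam_le
  calc _ ≤ _ := h1
    _ ≤ (∑ e ∈ s, Lam * |b e p| * ‖b e‖) * ‖v‖ := by gcongr
    _ ≤ _ := le_mul_of_one_le_right (by positivity)
      (one_le_pow₀ (by linarith [norm_nonneg (tiltForce V s l b ξ φ)]))

lemma memLp_edgeForce (ξ p : E) : MemLp (edgeForce V s l (fun e => b e ξ) fun e => b e p) 2
    (expMeasure (edgeEnergy V s l fun e => b e ξ)) := by
  have hH := (contDiff_edgeEnergy (s := s) (l := l) (t := fun e => b e ξ) hV.contDiff).continuous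
  rw [memLp_two_iff_integrable_sq (contDiff_edgeForce hV.contDiff).continuous.aestronglyMeasurable,
    integrable_expMeasure_iff hH (integrable_weight hV hc hco ξ)]
  refine (integrable_weight_mul_force_mul_force (b := b) hV hc hco ξ p p).congr
    (ae_of_all _ fun φ => ?_)
  simp only [tiltForce_apply]
  ring

lemma fderiv_tiltZ_apply (ξ p : E) : fderiv ℝ (tiltZ V s l b) ξ p = tiltN V s l b p ξ := by
  rw [(hasFDerivAt_tiltZ hV hc hco ξ).fderiv, ContinuousLinearMap.integral_apply]
  · rfl
  · refine integrable_weight_smul hV hc hco ξ (continuous_tiltForce hV.contDiff ξ) (K := 1) fun φ => ?_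
    nlinarith [norm_nonneg (tiltForce V s l b ξ φ)]

lemma fderiv_tiltN_apply (ξ p v : E) : fderiv ℝ (tiltN V s l b p) ξ v =
    (∫ φ, Real.exp (-edgeEnergy V s l (fun e => b e ξ) φ) *
      (tiltForce V s l b ξ φ p * tiltForce V s l b ξ φ v)) -
    ∫ φ, Real.exp (-edgeEnergy V s l (fun e => b e ξ) φ) * tiltHess V s l b ξ p φ v := by
  have hT := continuous_tiltForce (s := s) (l := l) (b := b) hV.contDiff ξ
  have hLam : 0 ≤ Lam := hV.lam_pos.le.trans hV.lam_le
  rw [(hasFDerivAt_tiltN hV hc hco p ξ).fderiv, ContinuousLinearMap.integral_apply,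
    ← integral_sub (integrable_weight_mul_force_mul_force hV hc hco ξ p v)
      (integrable_weight_mul_hess hV hc hco ξ p v)]
  · congr 1
    funext φ
    simp
    ring
  · refine Integrable.add (f := fun φ => Real.exp (-edgeEnergy V s l (fun e => b e ξ) φ) • -tiltHess V s l b ξ p φ)
      (g := fun φ => tiltForce V s l b ξ φ p • Real.exp (-edgeEnergy V s l (fun e => b e ξ) φ) • tiltForce V s l b ξ φ) ?_ ?_
    · refine integrable_weight_smul hV hc hco ξ (continuous_tiltHess hV.contDiff ξ p).neg
        (K := ∑ e ∈ s, Lam * |b e p| * ‖b e‖) fun φ => ?_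
      rw [norm_neg]
      exact (norm_tiltHess_le hV ξ p φ).trans (le_mul_of_one_le_right (by positivity)
        (one_le_pow₀ (by linarith [norm_nonneg (tiltForce V s l b ξ φ)])))
    · refine (integrable_weight_smul hV hc hco ξ
        (f := fun φ => tiltForce V s l b ξ φ p • tiltForce V s l b ξ φ)
        ((hT.clm_apply continuous_const).smul hT) (K := ‖p‖) fun φ => ?_).congr
        (ae_of_all _ fun φ => smul_comm _ _ _)
      have h1 := (tiltForce V s l b ξ φ).le_opNorm p
      have hx := norm_nonneg (tiltForce V s l b ξ φ)
      rw [norm_smul]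
      set x := ‖tiltForce V s l b ξ φ‖
      calc _ ≤ x * ‖p‖ * x := by gcongr
        _ = ‖p‖ * x ^ 2 := by ring
        _ ≤ ‖p‖ * (1 + x) ^ 2 := by gcongr; linarith

/-- The first derivative of `-k log Z`. -/
lemma hasFDerivAt_neg_log_tiltZ (k : ℝ) (ξ : E) :
    HasFDerivAt (fun η => -k * Real.log (tiltZ V s l b η / tiltZ V s l b 0))
      ((-k * (tiltZ V s l b ξ)⁻¹) • fderiv ℝ (tiltZ V s l b) ξ) ξ := by
  have hZ := hasFDerivAt_tiltZ (b := b) hV hc hco ξ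
  have h0 := tiltZ_pos (b := b) hV hc hco
  have h1 : (fun η => -k * Real.log (tiltZ V s l b η / tiltZ V s l b 0)) =
      fun η => -k * (Real.log (tiltZ V s l b η) - Real.log (tiltZ V s l b 0)) := by
    funext η
    rw [Real.log_div (h0 η).ne' (h0 0).ne']
  rw [h1, hZ.fderiv, mul_smul]
  exact ((hZ.log (h0 ξ).ne').sub_const _).const_mul (-k)

lemma fderiv_neg_log_tiltZ_apply (k : ℝ) (ξ p : E) :
    fderiv ℝ (fun η => -k * Real.log (tiltZ V s l b η / tiltZ V s l b 0)) ξ p =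
      -k * (tiltN V s l b p ξ / tiltZ V s l b ξ) := by
  rw [(hasFDerivAt_neg_log_tiltZ hV hc hco k ξ).fderiv, smul_apply, fderiv_tiltZ_apply hV hc hco]
  simp only [smul_eq_mul]
  ring

lemma differentiable_fderiv_neg_log_tiltZ [FiniteDimensional ℝ E] (k : ℝ) :
    Differentiable ℝ (fderiv ℝ fun η => -k * Real.log (tiltZ V s l b η / tiltZ V s l b 0)) := by
  set f := fun η => -k * Real.log (tiltZ V s l b η / tiltZ V s l b 0) with hf
  let B := Module.finBasis ℝ E
  have h : fderiv ℝ f = fun ξ => ∑ i, (-k * (tiltN V s l b (B i) ξ / tiltZ V s l b ξ)) •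
      LinearMap.toContinuousLinearMap (B.coord i) := by
    funext ξ
    ext v
    have hb : ∀ i, fderiv ℝ f ξ (B i) = -k * (tiltN V s l b (B i) ξ / tiltZ V s l b ξ) := fun i =>
      fderiv_neg_log_tiltZ_apply hV hc hco k ξ (B i)
    conv_lhs => rw [← B.sum_repr v, map_sum]
    simp [hb, mul_comm]
  rw [h]
  refine Differentiable.fun_sum fun i _ => Differentiable.smul_const ?_ _
  refine Differentiable.const_mul ?_ _
  simp only [div_eq_mul_inv]
  exact fun ξ => (hasFDerivAt_tiltN hV hc hco _ ξ).differentiableAt.mul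
    ((hasFDerivAt_tiltZ hV hc hco ξ).differentiableAt.inv (tiltZ_pos hV hc hco ξ).ne')

/-- The second derivative of `-k log Z`: the mean of the Hessian minus the covariance of the
forces. -/
lemma fderiv_fderiv_neg_log_tiltZ_apply (k : ℝ) (ξ p v : E) :
    fderiv ℝ (fun ζ => fderiv ℝ (fun η => -k * Real.log (tiltZ V s l b η / tiltZ V s l b 0)) ζ p) ξ v =
      k * ((∫ φ, Real.exp (-edgeEnergy V s l (fun e => b e ξ) φ) * tiltHess V s l b ξ p φ v) /
          tiltZ V s l b ξ -
        ((∫ φ, Real.exp (-edgeEnergy V s l (fun e => b e ξ) φ) *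
          (tiltForce V s l b ξ φ p * tiltForce V s l b ξ φ v)) / tiltZ V s l b ξ -
        tiltN V s l b p ξ / tiltZ V s l b ξ * (tiltN V s l b v ξ / tiltZ V s l b ξ))) := by
  have h0 := (tiltZ_pos (b := b) hV hc hco ξ).ne'
  have hN := (hasFDerivAt_tiltN (b := b) hV hc hco p ξ).differentiableAt
  have hZ := (hasFDerivAt_tiltZ (b := b) hV hc hco ξ).differentiableAt
  simp only [fderiv_neg_log_tiltZ_apply hV hc hco]
  have h1 : HasFDerivAt (fun ζ => -k * (tiltN V s l b p ζ * (tiltZ V s l b ζ)⁻¹)) _ ξ :=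
    (hN.hasFDerivAt.mul ((hasDerivAt_inv h0).comp_hasFDerivAt ξ hZ.hasFDerivAt)).const_mul (-k)
  simp only [div_eq_mul_inv (tiltN _ _ _ _ _ _)]
  rw [h1.fderiv]
  simp only [smul_apply, add_apply, smul_eq_mul, Function.comp_apply, fderiv_tiltZ_apply hV hc hco,
    fderiv_tiltN_apply hV hc hco]
  field_simp
  ring

/-- The symmetric bilinear form of `fderiv_fderiv_neg_log_tiltZ_apply` on the diagonal is the minimal
Helffer–Sjöstrand energy. -/
lemma fderiv_fderiv_neg_log_tiltZ_self (k : ℝ) (ξ p : E) :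
    fderiv ℝ (fun ζ => fderiv ℝ (fun η => -k * Real.log (tiltZ V s l b η / tiltZ V s l b 0)) ζ p) ξ p =
      k * hsMin V s l (fun e => b e ξ) (fun e => b e p) := by
  have hi := integrable_weight (b := b) hV hc hco ξ
  have hH := (contDiff_edgeEnergy (s := s) (l := l) (t := fun e => b e ξ) hV.contDiff).continuous
  have hprob := isProbabilityMeasure_expMeasure hi
  have hmean := integral_expMeasure hH hi
  have hG := memLp_edgeForce (b := b) hV hc hco ξ p
  have hβ : ∀ e, Integrable (fun φ => deriv (deriv V) (l e φ - b e ξ) * b e p ^ 2)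
      (expMeasure (edgeEnergy V s l fun e => b e ξ)) := fun e =>
    ((Integrable.of_bound ((continuous_deriv_deriv hV.contDiff).comp
      ((l e).continuous.sub continuous_const)).aestronglyMeasurable Lam
      (ae_of_all _ fun φ => hV.abs_deriv_deriv_le _)).mul_const _)
  rw [fderiv_fderiv_neg_log_tiltZ_apply hV hc hco, hsMin, ← integral_finsetSum _ fun e _ => hβ e]
  set μ := expMeasure (edgeEnergy V s l fun e => b e ξ)
  set G := edgeForce V s l (fun e => b e ξ) (fun e => b e p) with hGdef
  set m := ∫ φ, G φ ∂μ with hm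
  have hZ : tiltZ V s l b ξ = ∫ φ, Real.exp (-edgeEnergy V s l (fun e => b e ξ) φ) := rfl
  have e1 : ∫ φ, (G φ - m) ^ 2 ∂μ = ∫ φ, G φ ^ 2 ∂μ - m * m := by
    have e : ∀ φ, (G φ - m) ^ 2 = (G φ ^ 2 - (2 * m) * G φ) + m ^ 2 := fun φ => by ring
    have i1 := hG.integrable (by norm_num)
    have i2 : Integrable (fun φ => G φ ^ 2 - (2 * m) * G φ) μ :=
      hG.integrable_sq.sub (i1.const_mul _)
    simp only [e]
    rw [integral_add i2 (integrable_const _), integral_sub hG.integrable_sq (i1.const_mul _),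
      integral_const_mul, ← hm]
    simp
    ring
  have e2 : tiltN V s l b p ξ / tiltZ V s l b ξ = m := by
    have hN : tiltN V s l b p ξ = ∫ φ, G φ * Real.exp (-edgeEnergy V s l (fun e => b e ξ) φ) :=
      integral_congr_ae (ae_of_all _ fun φ => by
        simp only [tiltForce_apply, mul_comm, hGdef])
    rw [hm, hmean, ← hZ, hN, div_eq_inv_mul]
  rw [e1, e2, hmean, hmean, ← hZ, div_eq_inv_mul, div_eq_inv_mul]
  congr 5
  · funext φ
    rw [tiltHess_apply, mul_comm]
    congr 1
    exact Finset.sum_congr rfl fun e _ => by ring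
  · funext φ
    rw [tiltForce_apply, ← hGdef]
    ring

end Coercive

end PartitionFunction

/-! ### The lattice model -/

section Lattice

open scoped Classical

variable {d : ℕ}

/-- Evaluation at the site `x` of a configuration extended by zero, as a linear functional. -/
def evalL (U : Finset (Site d)) (x : Site d) : Conf U →L[ℝ] ℝ :=
  if h : x ∈ inner U then ContinuousLinearMap.proj ⟨x, h⟩ else 0

/-- The gradient `φ ↦ ∇φ(e)`, as a linear functional. -/
def gradL (U : Finset (Site d)) (e : Site d × Site d) : Conf U →L[ℝ] ℝ := evalL U e.2 - evalL U e.1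

/-- The gradient `p ↦ ∇ℓ_p(e)`, as a linear functional. -/
def affineGradL (e : Site d × Site d) : Slope d →L[ℝ] ℝ :=
  ∑ i, ((e.2 i : ℝ) - (e.1 i : ℝ)) • EuclideanSpace.proj i

lemma evalL_apply (U : Finset (Site d)) (x : Site d) (φ : Conf U) : evalL U x φ = extend φ x := by
  unfold evalL extend
  split_ifs <;> rfl

lemma gradL_apply (U : Finset (Site d)) (e : Site d × Site d) (φ : Conf U) :
    gradL U e φ = grad (extend φ) e := by
  rw [gradL, sub_apply, evalL_apply, evalL_apply, grad]

lemma affineGradL_apply (e : Site d × Site d) (p : Slope d) :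
    affineGradL e p = grad (affine p) e := by
  simp only [affineGradL, grad, affine, sum_apply, smul_apply, smul_eq_mul,
    ← Finset.sum_sub_distrib]
  refine Finset.sum_congr rfl fun i _ => ?_
  change _ * p i = _
  ring

lemma hamiltonian_eq_edgeEnergy (V : ℝ → ℝ) (U : Finset (Site d)) (ξ : Slope d) :
    hamiltonian V U ξ = edgeEnergy V (edges U) (gradL U) fun e => affineGradL e ξ := by
  funext φ
  simp only [hamiltonian, edgeEnergy, gradL_apply, affineGradL_apply]

lemma gibbs_eq_expMeasure (V : ℝ → ℝ) (U : Finset (Site d)) (ξ : Slope d) :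
    gibbs V U ξ = expMeasure (edgeEnergy V (edges U) (gradL U) fun e => affineGradL e ξ) := by
  rw [← hamiltonian_eq_edgeEnergy]
  rfl

lemma partitionFn_eq_tiltZ (V : ℝ → ℝ) (U : Finset (Site d)) :
    partitionFn V U = tiltZ V (edges U) (gradL U) affineGradL := by
  funext ξ
  rw [partitionFn, hamiltonian_eq_edgeEnergy, tiltZ]

lemma Adj.symm {x y : Site d} (h : Adj x y) : Adj y x := by
  unfold Adj at *
  rw [← h]
  exact Finset.sum_congr rfl fun i _ => by ring

lemma inner_subset (U : Finset (Site d)) : inner U ⊆ U := Finset.filter_subset _ _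

lemma mem_of_adj_of_mem_inner {U : Finset (Site d)} {x y : Site d} (hx : x ∈ inner U)
    (h : Adj x y) : y ∈ U := (Finset.mem_filter.1 hx).2 y h

lemma extend_of_mem {U : Finset (Site d)} {x : Site d} (hx : x ∈ inner U) (φ : Conf U) :
    extend φ x = φ ⟨x, hx⟩ := dif_pos hx

lemma extend_of_notMem {U : Finset (Site d)} {x : Site d} (hx : x ∉ inner U) (φ : Conf U) :
    extend φ x = 0 := dif_neg hx

lemma mem_edges_of_adj {U : Finset (Site d)} {x y : Site d} (h : Adj x y) (hle : x ≤ y)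
    (hin : x ∈ inner U ∨ y ∈ inner U) : (x, y) ∈ edges U := by
  have hxy : x ∈ U ∧ y ∈ U := by
    rcases hin with hx | hy
    · exact ⟨inner_subset U hx, mem_of_adj_of_mem_inner hx h⟩
    · exact ⟨mem_of_adj_of_mem_inner hy h.symm, inner_subset U hy⟩
  refine Finset.mem_filter.2 ⟨Finset.mem_product.2 hxy, fun hb => ?_, h, hle⟩
  rcases hin with hx | hy
  · exact (Finset.mem_sdiff.1 hb.1).2 hx
  · exact (Finset.mem_sdiff.1 hb.2).2 hy

lemma adj_add_single (x : Site d) (i : Fin d) : Adj x (x + Pi.single i 1) := by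
  unfold Adj
  rw [Finset.sum_eq_single i]
  · simp
  · intro j _ hj
    simp [Pi.single_eq_of_ne hj]
  · simp

/-- A configuration with vanishing gradient is constant on each line in direction `i`, and vanishes where
the line has left `U`. -/
lemma eq_zero_of_forall_gradL_eq_zero (hd : 0 < d) {U : Finset (Site d)} {φ : Conf U}
    (h : ∀ e ∈ edges U, gradL U e φ = 0) : φ = 0 := by
  let i : Fin d := ⟨0, hd⟩
  have hstep : ∀ x, extend φ (x + Pi.single i 1) = extend φ x := fun x => by
    by_cases hin : x ∈ inner U ∨ x + Pi.single i 1 ∈ inner U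
    · have hle : x ≤ x + Pi.single i 1 := le_add_of_nonneg_right (Pi.single_nonneg.2 zero_le_one)
      have := h _ (mem_edges_of_adj (adj_add_single x i) hle hin)
      rw [gradL_apply] at this
      exact sub_eq_zero.1 this
    · push Not at hin
      rw [extend_of_notMem hin.1, extend_of_notMem hin.2]
  have hline : ∀ (n : ℕ) (x : Site d), extend φ (x + Pi.single i (n : ℤ)) = extend φ x := fun n => by
    induction n with
    | zero => simp
    | succ n ih =>
      intro x
      have h1 : x + Pi.single i ((n + 1 : ℕ) : ℤ) = x + Pi.single i (n : ℤ) + Pi.single i 1 := by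
        rw [add_assoc, ← Pi.single_add, Nat.cast_succ]
      rw [h1, hstep, ih]
  funext ⟨x, hx⟩
  have hinj : Function.Injective fun n : ℕ => x + Pi.single i (n : ℤ) := fun m n hmn => by
    simpa using hmn
  obtain ⟨n, hn⟩ : ∃ n : ℕ, x + Pi.single i (n : ℤ) ∉ U := by
    by_contra hcon
    push Not at hcon
    exact Set.infinite_univ ((U.finite_toSet.preimage hinj.injOn).subset fun n _ => hcon n)
  rw [← extend_of_mem hx φ, ← hline n, extend_of_notMem fun hmem => hn (inner_subset U hmem)]
  rfl

end Lattice

/-- Finitely many functionals without common zero control the norm. -/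
lemma exists_coercive {ι κ : Type*} [Fintype ι] {s : Finset κ} {l : κ → (ι → ℝ) →L[ℝ] ℝ}
    (h : ∀ φ, (∀ e ∈ s, l e φ = 0) → φ = 0) :
    ∃ c : ℝ, 0 < c ∧ ∀ φ, c * ‖φ‖ ^ 2 ≤ ∑ e ∈ s, l e φ ^ 2 := by
  let T : (ι → ℝ) →ₗ[ℝ] (s → ℝ) := LinearMap.pi fun e => (l e).toLinearMap
  obtain ⟨K, hK, hT⟩ := T.exists_antilipschitzWith <| LinearMap.ker_eq_bot'.2 fun φ hφ =>
    h φ fun e he => congrFun hφ ⟨e, he⟩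
  have hK' : (0 : ℝ) < K := hK
  refine ⟨((K : ℝ) ^ 2)⁻¹, by positivity, fun φ => ?_⟩
  have h1 : ‖φ‖ ≤ K * ‖T φ‖ := by simpa using hT.le_mul_dist φ 0
  have hs : 0 ≤ ∑ e ∈ s, l e φ ^ 2 := Finset.sum_nonneg fun e _ => sq_nonneg _
  have h2 : ‖T φ‖ ≤ √(∑ e ∈ s, l e φ ^ 2) :=
    (pi_norm_le_iff_of_nonneg (Real.sqrt_nonneg _)).2 fun e => Real.abs_le_sqrt
      (Finset.single_le_sum (f := fun e => l e φ ^ 2) (fun e _ => sq_nonneg _) e.2)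
  rw [inv_mul_le_iff₀ (by positivity)]
  calc ‖φ‖ ^ 2 ≤ (K * √(∑ e ∈ s, l e φ ^ 2)) ^ 2 := by
        gcongr
        exact h1.trans (by gcongr)
    _ = _ := by rw [mul_pow, Real.sq_sqrt hs]

/-- The functions `e^{-H}` and `(∂_i H)² e^{-H}` are bounded. The components of `∇H` are forces in
the sense of `tiltForce` for the family of functionals enlarged by `l`. -/
lemma exists_weight_bound {ι κ E : Type*} [Fintype ι] [DecidableEq ι] [NormedAddCommGroup E]
    [NormedSpace ℝ E] {γ lam Lam M : ℝ} {V : ℝ → ℝ} {s : Finset κ} {l : κ → (ι → ℝ) →L[ℝ] ℝ}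
    {b : κ → E →L[ℝ] ℝ} (hV : IsPotential γ lam Lam M V) {c : ℝ} (hc : 0 < c)
    (hco : ∀ φ, c * ‖φ‖ ^ 2 ≤ ∑ e ∈ s, l e φ ^ 2) (ξ : E) :
    ∃ C : ℝ, (∀ φ, Real.exp (-edgeEnergy V s l (fun e => b e ξ) φ) ≤ C) ∧
      ∀ i φ, pd i (edgeEnergy V s l fun e => b e ξ) φ ^ 2 *
        Real.exp (-edgeEnergy V s l (fun e => b e ξ) φ) ≤ C := by
  let b' : κ → (E × (ι → ℝ)) →L[ℝ] ℝ := fun e => (b e).coprod (l e)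
  obtain ⟨C, a, ha, hC0, h⟩ := exists_envelope_bound (b := b') hV hc hco ‖(ξ, (0 : ι → ℝ))‖
  obtain ⟨C', hC'⟩ := exists_envelope_le (X := ι → ℝ) ha 2
  have hb : (fun e => b' e (ξ, (0 : ι → ℝ))) = fun e => b e ξ := by
    funext e
    simp [b']
  have key : ∀ φ, Real.exp (-edgeEnergy V s l (fun e => b e ξ) φ) *
      (1 + ‖tiltForce V s l b' (ξ, 0) φ‖) ^ 2 ≤ C * C' := fun φ => by
    have h1 := h (ξ, 0) le_rfl φ
    rw [hb] at h1
    exact h1.trans (mul_le_mul_of_nonneg_left (hC' φ) hC0)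
  -- `b'` is evaluated in the direction `(0, e_i)`, where it gives `∂_i H`
  refine ⟨C * C', fun φ => (le_mul_of_one_le_right (Real.exp_pos _).le (one_le_pow₀ ?_)).trans
    (key φ), fun i φ => le_trans ?_ (key φ)⟩
  · linarith [norm_nonneg (tiltForce V s l b' (ξ, 0) φ)]
  · have h2 : pd i (edgeEnergy V s l fun e => b e ξ) φ =
        tiltForce V s l b' (ξ, 0) φ (0, Pi.single i 1) := by
      rw [pd_edgeEnergy hV.contDiff, tiltForce_apply, hb]
      simp only [b', ContinuousLinearMap.coprod_apply, map_zero, zero_add]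
    have h3 : |pd i (edgeEnergy V s l fun e => b e ξ) φ| ≤ ‖tiltForce V s l b' (ξ, 0) φ‖ := by
      rw [h2]
      refine ((tiltForce V s l b' (ξ, 0) φ).le_opNorm _).trans_eq ?_
      have : ‖(Pi.single i 1 : ι → ℝ)‖ = 1 := by rw [Pi.norm_single, norm_one]
      rw [Prod.norm_def, this]
      simp
    rw [mul_comm, ← sq_abs]
    gcongr
    linarith

/-! ### The Dirichlet energy of the lattice model -/

section Dirichlet

open scoped Classical

variable {d L : ℕ} {γ lam Lam M : ℝ} {V : ℝ → ℝ}

lemma cubeVol_pos (hL : 1 ≤ L) : 0 < cubeVol d L := by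
  have : (1 : ℝ) ≤ L := by exact_mod_cast hL
  unfold cubeVol
  have : 0 < 2 * (L : ℝ) - 1 := by linarith
  positivity

lemma exists_coercive_edges (hd : 0 < d) (U : Finset (Site d)) :
    ∃ c : ℝ, 0 < c ∧ ∀ φ, c * ‖φ‖ ^ 2 ≤ ∑ e ∈ edges U, gradL U e φ ^ 2 :=
  exists_coercive fun _ h => eq_zero_of_forall_gradL_eq_zero hd h

lemma surfaceTension_eq (V : ℝ → ℝ) (L : ℕ) :
    surfaceTension (d := d) V L = fun η => -(1 / cubeVol d L) *
      Real.log (tiltZ V (edges (cube d L)) (gradL (cube d L)) affineGradL η /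
        tiltZ V (edges (cube d L)) (gradL (cube d L)) affineGradL 0) := by
  funext η
  rw [surfaceTension, partitionFn_eq_tiltZ]

/-- For fields with zero boundary values the Dirichlet form is `hsEnergy` of the interior
components. -/
lemma formB_affineAdd (V : ℝ → ℝ) (ξ p : Slope d) {w : Field (cube d L)}
    (hw : ∀ x ∈ bdry (cube d L), ∀ φ, w.val x φ = 0) :
    formB V L ξ (affineAdd p w) (affineAdd p w) = 1 / cubeVol d L *
      hsEnergy V (edges (cube d L)) (gradL (cube d L)) (fun e => affineGradL e ξ)
        (fun e => affineGradL e p) (fun x => w.val x) fun x y => w.der x y := by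
  have hval : ∀ x ∈ cube d L, ∀ φ, w.val x φ = extend (fun y : inner (cube d L) => w.val y φ) x := by
    intro x hx φ
    by_cases hin : x ∈ inner (cube d L)
    · exact (extend_of_mem hin fun y : inner (cube d L) => w.val y φ).symm
    · rw [hw x (Finset.mem_sdiff.2 ⟨hx, hin⟩), extend_of_notMem hin]
  rw [formB, hsEnergy, ← mul_add, gibbs_eq_expMeasure]
  congr 2
  · rw [Finset.sum_comm, ← Finset.sum_coe_sort]
    simp only [affineAdd, sq]
  · refine Finset.sum_congr rfl fun e he => ?_
    obtain ⟨h1, h2⟩ := Finset.mem_product.1 (Finset.mem_filter.1 he).1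
    congr 1
    funext φ
    rw [gradL_apply, gradL_apply, affineGradL_apply, affineGradL_apply, coeff]
    simp only [grad, affineAdd]
    rw [hval _ h1, hval _ h2]
    ring

/-- Smooth compactly supported components on the interior define an admissible field. -/
lemma exists_memH10 {μ : Measure (Conf (cube d L))} [IsFiniteMeasure μ]
    {w : inner (cube d L) → Conf (cube d L) → ℝ} (hw : ∀ x, ContDiff ℝ 2 (w x))
    (hc : ∀ x, HasCompactSupport (w x)) :
    ∃ W : Field (cube d L), MemH10 μ W ∧ (fun x : inner (cube d L) => W.val x) = w ∧
      (fun x y : inner (cube d L) => W.der x y) = fun x y => pd y (w x) := by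
  let W : Field (cube d L) :=
    { val := fun x => if h : x ∈ inner (cube d L) then w ⟨x, h⟩ else 0
      der := fun x y => if h : x ∈ inner (cube d L) then pd y (w ⟨x, h⟩) else 0 }
  have hv : ∀ x : inner (cube d L), W.val x = w x := fun x => dif_pos x.2
  have hD : ∀ x y : inner (cube d L), W.der x y = pd y (w x) := fun x y => dif_pos x.2
  refine ⟨W, ⟨fun x _ => ?_, fun x hx φ => ?_⟩, funext hv, funext fun x => funext (hD x)⟩
  · by_cases h : x ∈ inner (cube d L)
    · rw [hv ⟨x, h⟩, show W.der x = fun y => pd y (w ⟨x, h⟩) from funext (hD ⟨x, h⟩)]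
      refine ⟨(hw _).continuous.memLp_of_hasCompactSupport (hc _), fun y =>
        (continuous_pd ((hw _).of_le (by norm_num)) y).memLp_of_hasCompactSupport
          (hasCompactSupport_pd (hc _) y), fun _ => w ⟨x, h⟩, fun _ => ⟨hw _, hc _⟩, ?_, fun y => ?_⟩
      · simp
      · change Tendsto (fun _ : ℕ => eLpNorm (pd y (w ⟨x, h⟩) - pd y (w ⟨x, h⟩)) 2 μ) _ _
        simp
    · have h0 : W.val x = 0 := dif_neg h
      have h1 : W.der x = 0 := funext fun y => dif_neg h
      rw [h0, h1]
      refine ⟨MemLp.zero, fun y => MemLp.zero, fun _ => 0,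
        fun _ => ⟨contDiff_const, HasCompactSupport.zero⟩, by simp, fun y => ?_⟩
      have h2 : partialD y (0 : Conf (cube d L) → ℝ) = 0 := by
        funext φ
        simp [partialD]
      simp [h2]
  · have h0 : W.val x = 0 := dif_neg (Finset.mem_sdiff.1 hx).2
    rw [h0]
    rfl

/-- The infimum over `H¹₀` is `hsMin`: a lower bound by approximation with smooth fields, approached along
gradient fields. -/
lemma nu_eq_hsMin (hd : 0 < d) (hL : 1 ≤ L) (hV : IsPotential γ lam Lam M V) (ξ p : Slope d) :
    nu V L ξ p = 1 / 2 * (1 / cubeVol d L * hsMin V (edges (cube d L)) (gradL (cube d L))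
      (fun e => affineGradL e ξ) fun e => affineGradL e p) := by
  obtain ⟨c, hc, hco⟩ := exists_coercive_edges hd (cube d L)
  have hi := integrable_weight (b := affineGradL) hV hc hco ξ
  have hG := memLp_edgeForce (b := affineGradL) hV hc hco ξ p
  obtain ⟨C, hC, hC'⟩ := exists_weight_bound (b := affineGradL) hV hc hco ξ
  have hvol := cubeVol_pos (d := d) hL
  have hprob : IsProbabilityMeasure (gibbs V (cube d L) ξ) := by
    rw [gibbs_eq_expMeasure]
    exact isProbabilityMeasure_expMeasure hi
  refine IsGLB.csInf_eq (s := {E : ℝ | ∃ w : Field (cube d L), MemH10 (gibbs V (cube d L) ξ) w ∧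
    E = 1 / 2 * formB V L ξ (affineAdd p w) (affineAdd p w)}) ⟨?_, fun m hm => ?_⟩ ?_
  · rintro _ ⟨w, hw, rfl⟩
    rw [formB_affineAdd V ξ p hw.2]
    rw [gibbs_eq_expMeasure] at hw
    have hw1 := fun x : inner (cube d L) => hw.1 x (inner_subset _ x.2)
    choose h1 h2 ψ hψ hl hDl using hw1
    have := hsMin_le_hsEnergy (w := fun n x => ψ x n) hV.contDiff hV.abs_deriv_deriv_le hi hG
      h1 h2 (fun n x => (hψ x n).1) (fun n x => (hψ x n).2) hl hDl
    gcongr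
  · refine le_of_forall_pos_lt_add fun ε hε => ?_
    obtain ⟨w, hw, hwc, hlt⟩ := exists_hsEnergy_lt (β := fun e => affineGradL e p) hV.contDiff
      hV.abs_deriv_deriv_le hi hC hC' hG (ε := 2 * cubeVol d L * ε) (by positivity)
    obtain ⟨W, hW, hv, hD⟩ := exists_memH10 (μ := gibbs V (cube d L) ξ) hw hwc
    have := hm ⟨W, hW, rfl⟩
    rw [formB_affineAdd V ξ p hW.2, hv, hD] at this
    refine this.trans_lt ?_
    calc _ < 1 / 2 * (1 / cubeVol d L * (hsMin V (edges (cube d L)) (gradL (cube d L))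
          (fun e => affineGradL e ξ) (fun e => affineGradL e p) + 2 * cubeVol d L * ε)) := by gcongr
      _ = _ := by field_simp
  · obtain ⟨W, hW, -⟩ := exists_memH10 (μ := gibbs V (cube d L) ξ) (w := fun _ _ => 0)
      (fun _ => contDiff_const) fun _ => HasCompactSupport.zero
    exact ⟨_, W, hW, rfl⟩

end Dirichlet

/-! ### The second derivative of the surface tension -/

section SurfaceTension

variable {d L : ℕ} {γ lam Lam M : ℝ} {V : ℝ → ℝ}

lemma differentiable_surfaceTension (hd : 0 < d) (hV : IsPotential γ lam Lam M V) :
    Differentiable ℝ (surfaceTension (d := d) V L) := by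
  obtain ⟨c, hc, hco⟩ := exists_coercive_edges hd (cube d L)
  rw [surfaceTension_eq]
  exact fun ξ => (hasFDerivAt_neg_log_tiltZ hV hc hco _ ξ).differentiableAt

lemma differentiable_fderiv_surfaceTension (hd : 0 < d) (hV : IsPotential γ lam Lam M V) :
    Differentiable ℝ (fderiv ℝ (surfaceTension (d := d) V L)) := by
  obtain ⟨c, hc, hco⟩ := exists_coercive_edges hd (cube d L)
  rw [surfaceTension_eq]
  exact differentiable_fderiv_neg_log_tiltZ hV hc hco _

lemma fderiv_fderiv_surfaceTension_eq (hd : 0 < d) (hV : IsPotential γ lam Lam M V)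
    (ξ p v : Slope d) : fderiv ℝ (fun ζ => fderiv ℝ (surfaceTension V L) ζ p) ξ v =
      fderiv ℝ (fderiv ℝ (surfaceTension V L)) ξ v p := by
  have h := (differentiable_fderiv_surfaceTension (L := L) hd hV ξ).hasFDerivAt
  rw [(h.clm_apply (hasFDerivAt_const p ξ)).fderiv]
  simp

lemma fderiv_fderiv_surfaceTension_symm (hd : 0 < d) (hV : IsPotential γ lam Lam M V)
    (ξ p v : Slope d) : fderiv ℝ (fderiv ℝ (surfaceTension V L)) ξ v p =
      fderiv ℝ (fderiv ℝ (surfaceTension V L)) ξ p v := by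
  obtain ⟨c, hc, hco⟩ := exists_coercive_edges hd (cube d L)
  rw [← fderiv_fderiv_surfaceTension_eq hd hV, ← fderiv_fderiv_surfaceTension_eq hd hV,
    surfaceTension_eq, fderiv_fderiv_neg_log_tiltZ_apply hV hc hco,
    fderiv_fderiv_neg_log_tiltZ_apply hV hc hco]
  simp only [tiltHess_apply, mul_comm, mul_left_comm, mul_assoc]

/-- The second derivative of the surface tension on the diagonal is twice the minimal Dirichlet
Helffer–Sjöstrand energy. -/
lemma nu_eq_fderiv_fderiv_surfaceTension (hd : 0 < d) (hL : 1 ≤ L) (hV : IsPotential γ lam Lam M V)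
    (ξ p : Slope d) :
    nu V L ξ p = 1 / 2 * fderiv ℝ (fderiv ℝ (surfaceTension V L)) ξ p p := by
  obtain ⟨c, hc, hco⟩ := exists_coercive_edges hd (cube d L)
  rw [nu_eq_hsMin hd hL hV, ← fderiv_fderiv_surfaceTension_eq hd hV, surfaceTension_eq,
    fderiv_fderiv_neg_log_tiltZ_self hV hc hco]

lemma aBar_apply (hd : 0 < d) (hL : 1 ≤ L) (hV : IsPotential γ lam Lam M V) (ξ : Slope d)
    (i j : Fin d) : aBar V L ξ i j =
      fderiv ℝ (fderiv ℝ (surfaceTension V L)) ξ (stdVec i) (stdVec j) := by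
  simp only [aBar, Matrix.of_apply, nu_eq_fderiv_fderiv_surfaceTension hd hL hV, map_add, add_apply]
  rw [fderiv_fderiv_surfaceTension_symm hd hV ξ (stdVec i) (stdVec j)]
  ring

lemma eq_sum_smul_stdVec (p : Slope d) : p = ∑ i, p i • stdVec i := by
  ext j
  simp [stdVec, Pi.single_apply]

end SurfaceTension

end GradPhi

end

theorem mainTheorem5 (d : ℕ) (hd : 2 ≤ d) (γ lam Lam M : ℝ) (V : ℝ → ℝ)
    (hV : GradPhi.IsPotential γ lam Lam M V) (L : ℕ) (hL : 1 ≤ L) :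
    Differentiable ℝ (GradPhi.surfaceTension (d := d) V L) ∧
    Differentiable ℝ (fderiv ℝ (GradPhi.surfaceTension (d := d) V L)) ∧
    ∀ ξ : GradPhi.Slope d,
      (GradPhi.aBar V L ξ).IsSymm ∧
      (∀ p : GradPhi.Slope d,
        GradPhi.nu V L ξ p = 1 / 2 * ∑ i, ∑ j, p i * GradPhi.aBar V L ξ i j * p j) ∧
      GradPhi.hessian (GradPhi.surfaceTension V L) ξ = GradPhi.aBar V L ξ := by
  have hd0 : 0 < d := by omega
  refine ⟨GradPhi.differentiable_surfaceTension hd0 hV,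
    GradPhi.differentiable_fderiv_surfaceTension hd0 hV, fun ξ => ⟨?_, fun p => ?_, ?_⟩⟩
  · ext i j
    rw [Matrix.transpose_apply, GradPhi.aBar_apply hd0 hL hV, GradPhi.aBar_apply hd0 hL hV,
      GradPhi.fderiv_fderiv_surfaceTension_symm hd0 hV]
  · rw [GradPhi.nu_eq_fderiv_fderiv_surfaceTension hd0 hL hV]
    congr 1
    conv_lhs => rw [GradPhi.eq_sum_smul_stdVec p]
    simp only [map_sum, sum_apply, map_smul, smul_apply, smul_eq_mul, Finset.mul_sum,
      GradPhi.aBar_apply hd0 hL hV]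
    refine Finset.sum_comm.trans ?_
    exact Finset.sum_congr rfl fun i _ => Finset.sum_congr rfl fun j _ => by ring
  · ext i j
    rw [GradPhi.aBar_apply hd0 hL hV, GradPhi.hessian, Matrix.of_apply,
      GradPhi.fderiv_fderiv_surfaceTension_eq hd0 hV]
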